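/- Throughout, graphs are finite and simple. A graph is 2-connected if it has at least three vertices, is connected, and remains connected after the deletion of any one vertex. A 2-connected graph $G$ is series-parallel if there is a multigraph, obtained from a single vertex with a loop by repeatedly subdividing an edge (series operation) or doubling an edge (parallel operation), from which $G$ arises by removing all but one edge of each class of parallel edges. For distinct non-adjacent vertices $s,t$ of $G$, an $st$-separator is a set $S\subseteq V(G)\setminus\{s,t\}$ such that there is no path between $s$ and $t$ in $G-S$. Two sets $S,T$ of vertices are adjacent under token jumping (TJ) if $|S|=|T|$ and $|S\setminus T|=|T\setminus S|=1$. A TJ-reconfiguration sequence from $A$ to $B$ is a finite sequence $S_1=A,S_2,\dots,S_\ell=B$ of $st$-separators in which consecutive sets are adjacent under TJ. **Theorem.** Let $G$ be a 2-connected series-parallel graph, let $s,t$ be distinct non-adjacent vertices of $G$, and let $A,B$ be $st$-separators with $|A|=|B|$. 1. There is a TJ-reconfiguration sequence from $A$ to $B$. Moreover, for every $st$-separator $M$ of minimum cardinality, there is such a sequence one of whose members contains $M$. 2. Such a sequence can be constructed in polynomial time: there are an algorithm and a polynomial $p$ such that, for every 2-connected series-parallel graph $G$ on the vertex set $\{0,\dots,n-1\}$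 (given by its adjacency matrix) and all distinct non-adjacent $s,t$, there is an $st$-separator $M=M(s,t)$ of minimum cardinality, depending only on $G,s,t$, such that for all $st$-separators $A,B$ with $|A|=|B|$ the algorithm, on input $(G,s,t,A,B)$, halts after at most $p(n)$ steps and outputs a TJ-reconfiguration sequence from $A$ to $B$ one of whose members contains $M$. Here algorithms are WHILE-programs over binary trees, with unit cost for each elementary operation (a deterministic model of computation that is polynomially equivalent to Turing machines). -/

import Mathlib

namespace SepReconf

universe u

/-! ## Series-parallel graphs -/

/-- A graph is 2-connected if it has at least three vertices, is connected, and stays connected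
after the removal of any single vertex. -/
structure IsTwoConnected {V : Type u} [Fintype V] (G : SimpleGraph V) : Prop where
  three_le_card : 3 ≤ Fintype.card V
  connected : G.Connected
  connected_delete : ∀ v : V, (G.induce {w | w ≠ v}).Connected

/-- `FromLoop W E` : the multigraph with vertex set `W` and multiset of edges `E` (loops and
parallel edges allowed) is obtained from a single vertex with a loop by series operations
(subdivide an edge `uv` with a new vertex `w`) and parallel operations (double an edge). -/
inductive FromLoop {V : Type u} : Set V → Multiset (Sym2 V) → Prop
  | loop (v : V) : FromLoop {v} {s(v, v)}
  | series {W : Set V} {E : Multiset (Sym2 V)} {u v : V} (w : V) :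
      FromLoop W (s(u, v) ::ₘ E) → w ∉ W → FromLoop (insert w W) (s(u, w) ::ₘ s(w, v) ::ₘ E)
  | parallel {W : Set V} {E : Multiset (Sym2 V)} {e : Sym2 V} :
      FromLoop W (e ::ₘ E) → FromLoop W (e ::ₘ e ::ₘ E)

/-- A 2-connected series-parallel (simple) graph: it is 2-connected and is obtained from a
multigraph generated from a loop by series and parallel operations, by keeping exactly one edge
of each class of parallel edges. (As `G` has no loops, the multigraph has none either.) -/
structure IsTwoConnectedSeriesParallel {V : Type u} [Fintype V] (G : SimpleGraph V) : Prop where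
  twoConnected : IsTwoConnected G
  fromLoop : ∃ E : Multiset (Sym2 V), FromLoop Set.univ E ∧ ∀ u v : V, G.Adj u v ↔ s(u, v) ∈ E

/-! ## Separators and token jumping -/

/-- `S` is an `st`-separator: it contains neither `s` nor `t`, and there is no path between
`s` and `t` in the subgraph induced by the complement of `S`. -/
def IsSeparator {V : Type u} (G : SimpleGraph V) (s t : V) (S : Finset V) : Prop :=
  ∃ (hs : s ∉ S) (ht : t ∉ S), ¬ (G.induce {v | v ∉ S}).Reachable ⟨s, hs⟩ ⟨t, ht⟩

/-- An `st`-separator of minimum cardinality. -/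
def IsMinimumSeparator {V : Type u} (G : SimpleGraph V) (s t : V) (M : Finset V) : Prop :=
  IsSeparator G s t M ∧ ∀ S : Finset V, IsSeparator G s t S → M.card ≤ S.card

/-- Adjacency of token sets under token jumping. -/
def TJAdj {V : Type u} [DecidableEq V] (S T : Finset V) : Prop :=
  S.card = T.card ∧ (S \ T).card = 1 ∧ (T \ S).card = 1

/-- `L` is a reconfiguration sequence of `st`-separators under token jumping, from `A` to `B`. -/
structure IsTJSequence {V : Type u} [DecidableEq V] (G : SimpleGraph V) (s t : V)
    (A B : Finset V) (L : List (Finset V)) : Prop where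
  isSeparator : ∀ S ∈ L, IsSeparator G s t S
  chain : L.IsChain TJAdj
  head : L.head? = some A
  last : L.getLast? = some B

/-! ## Running time

Programs of the language WHILE over binary trees, with the usual unit-cost measure: a program has
finitely many variables holding binary trees (nested pairs built from `nil`), and every elementary
operation (`nil`, reading a variable, building a pair, taking the first or second component,
assigning, testing) costs one step. Programs are deterministic. This is a standard sequential
model of computation, polynomially equivalent to Turing machines: each step builds at most one new
pair and inspects at most one, so a program is simulated on a pointer machine with constant
overhead. -/

/-- The data: binary trees. -/
inductive Data
  | nil : Data
  | pair : Data → Data → Data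

/-- First component (`nil` for `nil`). -/
def Data.fst : Data → Data
  | .nil => .nil
  | .pair a _ => a

/-- Second component (`nil` for `nil`). -/
def Data.snd : Data → Data
  | .nil => .nil
  | .pair _ b => b

/-- Expressions; variables are numbered. -/
inductive Expr
  | var : ℕ → Expr
  | nil : Expr
  | pair : Expr → Expr → Expr
  | fst : Expr → Expr
  | snd : Expr → Expr

/-- The value of an expression, given the contents of the variables. -/
def Expr.eval (σ : ℕ → Data) : Expr → Data
  | .var i => σ i
  | .nil => .nil
  | .pair a b => .pair (a.eval σ) (b.eval σ)
  | .fst a => (a.eval σ).fst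
  | .snd a => (a.eval σ).snd

/-- The number of elementary operations in the evaluation of an expression. -/
def Expr.cost : Expr → ℕ
  | .var _ => 1
  | .nil => 1
  | .pair a b => a.cost + b.cost + 1
  | .fst a => a.cost + 1
  | .snd a => a.cost + 1

/-- Programs. A test succeeds if the value of the tested expression is not `nil`. -/
inductive Program
  | skip : Program
  | assign : ℕ → Expr → Program
  | seq : Program → Program → Program
  | ite : Expr → Program → Program → Program
  | while : Expr → Program → Program

/-- `Runs c σ k τ` : program `c`, started with variable contents `σ`, halts after exactly `k`
steps with variable contents `τ`. -/
inductive Runs : Program → (ℕ → Data) → ℕ → (ℕ → Data) → Prop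
  | skip (σ : ℕ → Data) : Runs .skip σ 1 σ
  | assign (σ : ℕ → Data) (i : ℕ) (e : Expr) :
      Runs (.assign i e) σ (e.cost + 1) (Function.update σ i (e.eval σ))
  | seq {c d : Program} {σ τ ρ : ℕ → Data} {k l : ℕ} :
      Runs c σ k τ → Runs d τ l ρ → Runs (.seq c d) σ (k + l) ρ
  | ite_true {e : Expr} {c d : Program} {σ τ : ℕ → Data} {k : ℕ} :
      e.eval σ ≠ .nil → Runs c σ k τ → Runs (.ite e c d) σ (e.cost + 1 + k) τ
  | ite_false {e : Expr} {c d : Program} {σ τ : ℕ → Data} {k : ℕ} :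
      e.eval σ = .nil → Runs d σ k τ → Runs (.ite e c d) σ (e.cost + 1 + k) τ
  | while_true {e : Expr} {c : Program} {σ τ ρ : ℕ → Data} {k l : ℕ} :
      e.eval σ ≠ .nil → Runs c σ k τ → Runs (.while e c) τ l ρ →
        Runs (.while e c) σ (e.cost + 1 + k + l) ρ
  | while_false {e : Expr} {c : Program} {σ : ℕ → Data} :
      e.eval σ = .nil → Runs (.while e c) σ (e.cost + 1) σ

/-- On input `x` (placed in variable 0, all other variables being `nil`), the program halts with
output `y` (in variable 0) after at most `b` steps. -/
def OutputsWithin (c : Program) (x y : Data) (b : ℕ) : Prop :=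
  ∃ (k : ℕ) (τ : ℕ → Data), k ≤ b ∧
    Runs c (Function.update (fun _ => Data.nil) 0 x) k τ ∧ τ 0 = y

/-! ## Encoding of instances -/

/-- A list is encoded by right-nested pairs. -/
def encList : List Data → Data
  | [] => .nil
  | x :: l => .pair x (encList l)

/-- A truth value: `nil` for false, `(nil, nil)` for true. -/
noncomputable def encProp (p : Prop) : Data :=
  open scoped Classical in if p then .pair .nil .nil else .nil

/-- A natural number in unary. -/
def encNat (k : ℕ) : Data := encList (List.replicate k .nil)

/-- A set of vertices by its list of `n` membership bits. -/
noncomputable def encSet {n : ℕ} (S : Finset (Fin n)) : Data :=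
  encList ((List.finRange n).map fun i => encProp (i ∈ S))

/-- A graph by the list of the rows of its adjacency matrix. -/
noncomputable def encGraph {n : ℕ} (G : SimpleGraph (Fin n)) : Data :=
  encList ((List.finRange n).map fun i =>
    encList ((List.finRange n).map fun j => encProp (G.Adj i j)))

/-- The input `(G, s, t, A, B)`. -/
noncomputable def encInput {n : ℕ} (G : SimpleGraph (Fin n)) (s t : Fin n)
    (A B : Finset (Fin n)) : Data :=
  encList [encGraph G, encNat s, encNat t, encSet A, encSet B]

/-- A sequence of sets of vertices. -/
noncomputable def encSequence {n : ℕ} (L : List (Finset (Fin n))) : Data :=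
  encList (L.map encSet)

end SepReconf

/-!
Write `G - S` for the graph without the vertices in `S`. Let `M` be a minimum `st`-separator and `A`
any `st`-separator. As long as a token of `A` can be moved to an uncovered vertex of `M`, do this.
The theorem rests on an analysis of the situation in which no such move is left and `A` does not
contain `M`.

Graphs generated from a loop have three properties, each of which is inherited under the
subdivision of an edge and unaffected by doubling (`FromLoop.properties`). By the first, two
non-adjacent vertices `s`, `t` are separated by at most two vertices unless `G - {s, t}` is
disconnected. By the second, in the latter case each component of `G - {s, t}` is cut by a single
vertex. So if there is no separator of size two, a minimum separator consists of one cut vertex for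
each component, every separator meets every component, and a token can always be moved to the
missing vertex of `M` in its component (`subset_of_noMove_of_componentsCut`).

If `M` has two vertices, uncrossing shows that a separator `A` without a move to `M` lies strictly
on one side of `M` (`nested_of_noMove`). The third property, a substitute for the absence of a
`K₄`-minor, then shows that `M` can be moved one step in the direction of `A` (`exists_advance`).
Hence take a chain of minimum separators, each arising from the next by moving one vertex, whose
first member cannot be moved towards `t` and whose last member cannot be moved towards `s`. Run
through this chain, each time moving tokens of `A` to the current member greedily. At the first
member `A` cannot be stuck beyond it, at the last one it cannot be stuck before it, and it cannot
be beyond one member and before the preceding one, as these share a vertex. So in the end `A`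
contains the last member (`normalize_spec`). Doing this for `A` and for `B` leaves two separators
with a common minimum separator, and their other tokens are free (`reconfigure_spec`).

All steps are loops through lists of polynomial length whose bodies are set operations and
reachability tests. The predicate `Computes` expresses that a value is obtained by a program of
polynomial running time; it is closed under composition, pairing, case distinction and such loops,
which turns the definition of the algorithm into a program (`exists_program`).
-/

namespace SepReconf

universe u

/-! ### Separation and connectedness through closed sets -/

section Relation

variable {V : Type u}

/-- No `r`-path leads from `a` to `b` while avoiding `S`, expressed by a set that contains `a`, not
`b`, and is closed under `r` off `S`. The start `a` itself may lie in `S`. -/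
def SepBy (r : V → V → Prop) (S : Set V) (a b : V) : Prop :=
  ∃ X : Set V, a ∈ X ∧ b ∉ X ∧ ∀ p ∈ X, ∀ q, r p q → q ∉ S → q ∈ X

/-- The set `K` is nonempty and induces a connected subgraph: every part of it closed under `r`
is empty or everything. -/
def ConnIn (r : V → V → Prop) (K : Set V) : Prop :=
  K.Nonempty ∧ ∀ X : Set V, (K ∩ X).Nonempty → (∀ p ∈ K ∩ X, ∀ q ∈ K, r p q → q ∈ X) → K ⊆ X

/-- The vertex `p` has a neighbour in `K`. -/
def Touches (r : V → V → Prop) (K : Set V) (p : V) : Prop := ∃ q ∈ K, r q p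

theorem SepBy.symm {r : V → V → Prop} (hr : ∀ a b, r a b → r b a) {S : Set V} {a b : V}
    (hb : b ∉ S) (h : SepBy r S a b) : SepBy r S b a := by
  obtain ⟨X, ha, hbX, hX⟩ := h
  refine ⟨{p | p ∉ X ∧ p ∉ S}, ⟨hbX, hb⟩, fun h => h.1 ha, ?_⟩
  rintro p ⟨hp, hpS⟩ q hpq hq
  exact ⟨fun hqX => hp (hX q hqX p (hr _ _ hpq) hpS), hq⟩

/-- In a connected set with a further element, every element has a neighbour. -/
theorem ConnIn.exists_adj {r : V → V → Prop} {K : Set V} (hK : ConnIn r K) {w p : V} (hw : w ∈ K)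
    (hp : p ∈ K) (hpw : p ≠ w) : ∃ q ∈ K, q ≠ w ∧ r w q := by
  by_contra! h
  have := hK.2 {w} ⟨w, hw, rfl⟩ (by
    rintro a ⟨-, rfl⟩ q hq haq
    by_contra hne
    exact h q hq hne haq)
  exact hpw (this hp)

/-- The vertices reached from `a` by `r`-paths that avoid `S` after their start. -/
def reachSet (r : V → V → Prop) (S : Set V) (a : V) : Set V :=
  {b | Relation.ReflTransGen (fun p q => r p q ∧ q ∉ S) a b}

theorem self_mem_reachSet (r : V → V → Prop) (S : Set V) (a : V) : a ∈ reachSet r S a :=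
  Relation.ReflTransGen.refl

theorem reachSet_closed {r : V → V → Prop} {S : Set V} {a p q : V} (hp : p ∈ reachSet r S a)
    (hpq : r p q) (hq : q ∉ S) : q ∈ reachSet r S a :=
  Relation.ReflTransGen.tail hp ⟨hpq, hq⟩

theorem reachSet_subset {r : V → V → Prop} {S : Set V} {a : V} {X : Set V} (ha : a ∈ X)
    (hX : ∀ p ∈ X, ∀ q, r p q → q ∉ S → q ∈ X) : reachSet r S a ⊆ X := fun b hb => by
  induction hb with
  | refl => exact ha
  | tail _ h ih => exact hX _ ih _ h.1 h.2

theorem notMem_of_mem_reachSet {r : V → V → Prop} {S : Set V} {a b : V} (ha : a ∉ S)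
    (hb : b ∈ reachSet r S a) : b ∉ S := by
  cases hb with
  | refl => exact ha
  | tail _ h => exact h.2

theorem sepBy_iff {r : V → V → Prop} {S : Set V} {a b : V} :
    SepBy r S a b ↔ b ∉ reachSet r S a :=
  ⟨fun ⟨_, ha, hb, hX⟩ h => hb (reachSet_subset ha hX h), fun h =>
    ⟨_, self_mem_reachSet r S a, h, fun _ hp _ hpq hq => reachSet_closed hp hpq hq⟩⟩

theorem connIn_reachSet {r : V → V → Prop} (hr : ∀ a b, r a b → r b a) {S : Set V} {a : V} :
    ConnIn r (reachSet r S a) := by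
  refine ⟨⟨a, self_mem_reachSet r S a⟩, fun X ⟨b, hb, hbX⟩ hX => ?_⟩
  have haX : a ∈ X := by
    by_contra haX
    have : reachSet r S a ⊆ {p | p ∈ reachSet r S a ∧ p ∉ X} :=
      reachSet_subset ⟨self_mem_reachSet r S a, haX⟩ fun p hp q hpq hq =>
        ⟨reachSet_closed hp.1 hpq hq, fun hqX =>
          hp.2 (hX q ⟨reachSet_closed hp.1 hpq hq, hqX⟩ p hp.1 (hr _ _ hpq))⟩
    exact (this hb).2 hbX
  have : reachSet r S a ⊆ reachSet r S a ∩ X :=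
    reachSet_subset ⟨self_mem_reachSet r S a, haX⟩ fun p hp q hpq hq =>
      ⟨reachSet_closed hp.1 hpq hq, hX p hp q (reachSet_closed hp.1 hpq hq) hpq⟩
  exact fun p hp => (this hp).2

/-- The relation `r'` arises from the symmetric relation `r` by subdividing an edge `uv` with a
vertex `w` that is isolated in `r`; other copies of the edge `uv` may persist. -/
structure Subdivides (r r' : V → V → Prop) (u v w : V) : Prop where
  symm : ∀ a b, r a b → r b a
  symm' : ∀ a b, r' a b → r' b a
  adj : r u v
  isolated : ∀ a, ¬ r a w
  adj_new : ∀ b, r' w b ↔ b = u ∨ b = v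
  of_ne : ∀ a b, a ≠ w → b ≠ w → r' a b → r a b
  old : ∀ a b, r a b → r' a b ∨ (a = u ∧ b = v) ∨ (a = v ∧ b = u)

namespace Subdivides

variable {r r' : V → V → Prop} {u v w : V}

theorem swap (h : Subdivides r r' u v w) : Subdivides r r' v u w where
  symm := h.symm
  symm' := h.symm'
  adj := h.symm _ _ h.adj
  isolated := h.isolated
  adj_new b := (h.adj_new b).trans or_comm
  of_ne := h.of_ne
  old a b hab := (h.old a b hab).imp id Or.symm

theorem left_ne (h : Subdivides r r' u v w) : u ≠ w := by
  rintro rfl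
  exact h.isolated _ (h.symm _ _ h.adj)

theorem right_ne (h : Subdivides r r' u v w) : v ≠ w := h.swap.left_ne

theorem adj_new' (h : Subdivides r r' u v w) {a : V} (ha : r' a w) : a = u ∨ a = v :=
  (h.adj_new a).1 (h.symm' _ _ ha)

/-- Subdividing an edge does not destroy separations. -/
theorem sepBy (h : Subdivides r r' u v w) {S : Set V} {a b : V} (ha : a ≠ w) (hb : b ≠ w)
    (hs : SepBy r S a b) : SepBy r' S a b := by
  obtain ⟨X, haX, hbX, hX⟩ := hs
  refine ⟨{p | (p ≠ w ∧ p ∈ X) ∨ (p = w ∧ (u ∈ X ∨ v ∈ X))}, Or.inl ⟨ha, haX⟩, ?_, ?_⟩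
  · rintro (⟨-, hb'⟩ | ⟨hb', -⟩)
    exacts [hbX hb', hb hb']
  · rintro p (⟨hp, hpX⟩ | ⟨rfl, huv⟩) q hpq hq
    · by_cases hqw : q = w
      · subst hqw
        rcases h.adj_new' hpq with rfl | rfl
        exacts [Or.inr ⟨rfl, Or.inl hpX⟩, Or.inr ⟨rfl, Or.inr hpX⟩]
      · exact Or.inl ⟨hqw, hX p hpX q (h.of_ne _ _ hp hqw hpq) hq⟩
    · left
      rcases (h.adj_new q).1 hpq with rfl | rfl
      · exact ⟨h.left_ne, huv.elim id fun hv => hX v hv q (h.symm _ _ h.adj) hq⟩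
      · exact ⟨h.right_ne, huv.elim (fun hu => hX u hu q h.adj hq) id⟩

theorem connIn (h : Subdivides r r' u v w) {K : Set V} (hK : ConnIn r' K)
    (hne : (K \ {w}).Nonempty) : ConnIn r (K \ {w}) := by
  refine ⟨hne, fun X ⟨a, haK, haX⟩ hX => ?_⟩
  have := hK.2 {p | (p ≠ w ∧ p ∈ X) ∨ (p = w ∧ ((u ∈ K ∧ u ∈ X) ∨ (v ∈ K ∧ v ∈ X)))}
    ⟨a, haK.1, Or.inl ⟨haK.2, haX⟩⟩ (by
      rintro p ⟨hpK, (⟨hp, hpX⟩ | ⟨rfl, huv⟩)⟩ q hq hpq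
      · by_cases hqw : q = w
        · subst hqw
          rcases h.adj_new' hpq with rfl | rfl
          exacts [Or.inr ⟨rfl, Or.inl ⟨hpK, hpX⟩⟩, Or.inr ⟨rfl, Or.inr ⟨hpK, hpX⟩⟩]
        · exact Or.inl ⟨hqw, hX p ⟨⟨hpK, hp⟩, hpX⟩ q ⟨hq, hqw⟩ (h.of_ne _ _ hp hqw hpq)⟩
      · left
        rcases (h.adj_new q).1 hpq with rfl | rfl
        · exact ⟨h.left_ne, huv.elim (·.2) fun hv =>
            hX v ⟨⟨hv.1, h.right_ne⟩, hv.2⟩ q ⟨hq, h.left_ne⟩ (h.symm _ _ h.adj)⟩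
        · exact ⟨h.right_ne, huv.elim (fun hu =>
            hX u ⟨⟨hu.1, h.left_ne⟩, hu.2⟩ q ⟨hq, h.right_ne⟩ h.adj) (·.2)⟩)
  intro p hp
  rcases this hp.1 with hp' | hp'
  exacts [hp'.2, absurd hp'.1 hp.2]

theorem touches (h : Subdivides r r' u v w) {K : Set V} (hK : ConnIn r' K)
    (hne : (K \ {w}).Nonempty) {p : V} (hp : p ∉ K) (hpw : p ≠ w) (ht : Touches r' K p) :
    Touches r (K \ {w}) p := by
  obtain ⟨q, hq, hqp⟩ := ht
  by_cases hqw : q = w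
  · subst hqw
    obtain ⟨a, haK, haw⟩ := hne
    obtain ⟨b, hb, hbw, hqb⟩ := hK.exists_adj hq haK haw
    have hbp : b ≠ p := fun h => hp (h ▸ hb)
    refine ⟨b, ⟨hb, hbw⟩, ?_⟩
    rcases (h.adj_new p).1 hqp with rfl | rfl <;> rcases (h.adj_new b).1 hqb with rfl | rfl
    exacts [absurd rfl hbp, h.symm _ _ h.adj, h.adj, absurd rfl hbp]
  · exact ⟨q, ⟨hq, hqw⟩, h.of_ne _ _ hqw hpw hqp⟩

end Subdivides

/-! ### Three properties of graphs generated by subdividing and doubling -/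

/-- The vertices `x` and `y` are linked off `t`: they are adjacent, or both have a neighbour in a
connected set whose only further neighbours are `x` and `y`. -/
def LinkedOff (r : V → V → Prop) (x y t : V) (S : Set V) : Prop :=
  r x y ∨ (ConnIn r S ∧ x ∉ S ∧ y ∉ S ∧ t ∉ S ∧ Touches r S x ∧ Touches r S y ∧
    ∀ a ∈ S, ∀ b, r a b → b ∈ S ∨ b = x ∨ b = y)

theorem LinkedOff.swap {r : V → V → Prop} (hr : ∀ a b, r a b → r b a) {x y t : V} {S : Set V}
    (h : LinkedOff r x y t S) : LinkedOff r y x t S := by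
  rcases h with h | ⟨h1, h2, h3, h4, h5, h6, h7⟩
  · exact Or.inl (hr _ _ h)
  · exact Or.inr ⟨h1, h3, h2, h4, h6, h5, fun a ha b hab => (h7 a ha b hab).imp id Or.symm⟩

/-- If a connected set `K` touches `x`, `y` and `t`, where `x` and `y` are linked off `t`, then `t`
can be separated from `x` by `y` and one more vertex, or from `y` by `x` and one more vertex. -/
def TripodProperty (r : V → V → Prop) : Prop :=
  ∀ (x y t : V) (S K : Set V), x ≠ y → x ≠ t → y ≠ t → LinkedOff r x y t S →
    ConnIn r K → x ∉ K → y ∉ K → t ∉ K → Touches r K x → Touches r K y → Touches r K t →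
    ∃ z, z ≠ x ∧ z ≠ y ∧ z ≠ t ∧ (SepBy r {y, z} x t ∨ SepBy r {x, z} y t)

/-- If `s` and `t` are adjacent, or joined through a connected set disjoint from the connected set
`C`, then a single vertex `x` of `C` meets all paths from `s` to `t` with interior in `C`. The set
`X` collects the vertices of `C` reached from `s` before `x`. -/
def CutVertexProperty (r : V → V → Prop) : Prop :=
  ∀ (s t : V) (C L : Set V), s ≠ t → ConnIn r C → s ∉ C → t ∉ C →
    (r s t ∨ (ConnIn r L ∧ s ∉ L ∧ t ∉ L ∧ Disjoint C L ∧ Touches r L s ∧ Touches r L t)) →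
    ∃ x ∈ C, ∃ X : Set V, X ⊆ C \ {x} ∧ (∀ b ∈ C, b ≠ x → r s b → b ∈ X) ∧
      (∀ a ∈ X, ∀ b ∈ C, b ≠ x → r a b → b ∈ X) ∧ ∀ a ∈ X, ¬ r a t

/-- Two non-adjacent vertices are separated by at most two vertices, or separate the graph. -/
def PairOrDisconnectedProperty (r : V → V → Prop) (W : Set V) : Prop :=
  ∀ s ∈ W, ∀ t ∈ W, s ≠ t → ¬ r s t →
    (∃ a b, s ≠ a ∧ s ≠ b ∧ t ≠ a ∧ t ≠ b ∧ SepBy r {a, b} s t) ∨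
    (∃ p ∈ W, ∃ q ∈ W, p ≠ s ∧ p ≠ t ∧ q ≠ s ∧ q ≠ t ∧ SepBy r {s, t} p q)

namespace Subdivides

variable {r r' : V → V → Prop} {u v w : V}

theorem linkedOff (h : Subdivides r r' u v w) {x y t : V} {S : Set V} (hxy : x ≠ y)
    (hx : x ≠ w) (hy : y ≠ w) (hl : LinkedOff r' x y t S) : LinkedOff r x y t (S \ {w}) := by
  rcases hl with hl | ⟨hS, hxS, hyS, htS, hSx, hSy, hcl⟩
  · exact Or.inl (h.of_ne _ _ hx hy hl)
  by_cases hne : (S \ {w}).Nonempty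
  · refine Or.inr ⟨h.connIn hS hne, fun h => hxS h.1, fun h => hyS h.1, fun h => htS h.1,
      h.touches hS hne hxS hx hSx, h.touches hS hne hyS hy hSy, ?_⟩
    rintro a ⟨haS, haw⟩ b hab
    have hbw : b ≠ w := fun hb => h.isolated a (hb ▸ hab)
    -- an edge that gets subdivided leads to its other end through `w`
    have key : r' a w → r' w b → b ∈ S \ {w} ∨ b = x ∨ b = y := fun h1 h2 => by
      rcases hcl a haS w h1 with hw | hw | hw
      · exact (hcl w hw b h2).imp (⟨·, hbw⟩) id
      · exact absurd hw.symm hx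
      · exact absurd hw.symm hy
    rcases h.old a b hab with hab' | ⟨rfl, rfl⟩ | ⟨rfl, rfl⟩
    · exact (hcl a haS b hab').imp (⟨·, hbw⟩) id
    · exact key (h.symm' _ _ ((h.adj_new _).2 (Or.inl rfl))) ((h.adj_new _).2 (Or.inr rfl))
    · exact key (h.symm' _ _ ((h.adj_new _).2 (Or.inr rfl))) ((h.adj_new _).2 (Or.inl rfl))
  · have hsub : ∀ a ∈ S, a = w := fun a ha => by
      by_contra haw
      exact hne ⟨a, ha, haw⟩
    obtain ⟨a, ha, hax⟩ := hSx
    obtain ⟨b, hb, hby⟩ := hSy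
    obtain rfl := hsub a ha
    obtain rfl := hsub b hb
    left
    rcases (h.adj_new x).1 hax with rfl | rfl <;> rcases (h.adj_new y).1 hby with rfl | rfl
    exacts [absurd rfl hxy, h.adj, h.symm _ _ h.adj, absurd rfl hxy]

/-- The case of the tripod property in which the subdividing vertex is a linked vertex. -/
theorem tripod_linked (h : Subdivides r r' u v w) {y t : V} {S K : Set V}
    (hwt : w ≠ t) (hyt : y ≠ t) (hl : LinkedOff r' w y t S) (hK : ConnIn r' K)
    (hwK : w ∉ K) (hyK : y ∉ K) (htK : t ∉ K) (hKw : Touches r' K w) (hKt : Touches r' K t) :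
    ∃ z, z ≠ w ∧ z ≠ y ∧ z ≠ t ∧ SepBy r' {y, z} w t := by
  obtain ⟨z, hzK, hzw⟩ := hKw
  refine ⟨z, fun h => hwK (h ▸ hzK), fun h => hyK (h ▸ hzK), fun h => htK (h ▸ hzK), ?_⟩
  have hz := h.adj_new' hzw
  rcases hl with hwy | ⟨-, hwS, hyS, htS, ⟨a, haS, haw⟩, -, hcl⟩
  · have hy := (h.adj_new y).1 hwy
    have hyz : y ≠ z := fun h => hyK (h ▸ hzK)
    refine ⟨{w}, rfl, fun h => hwt h.symm, ?_⟩
    rintro p rfl q hpq hq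
    have := (h.adj_new q).1 hpq
    simp only [Set.mem_insert_iff, Set.mem_singleton_iff] at hq
    exact absurd (by grind) hq
  · have hzS : z ∉ S := fun hzS => by
      have hKS : K ⊆ S := hK.2 S ⟨z, hzK, hzS⟩ fun p hp q hq hpq => by
        rcases hcl p hp.2 q hpq with h | h | h
        exacts [h, absurd (h ▸ hq) hwK, absurd (h ▸ hq) hyK]
      obtain ⟨b, hb, hbt⟩ := hKt
      rcases hcl b (hKS hb) t hbt with h | h | h
      exacts [htS h, hwt h.symm, hyt h.symm]
    have haz : a ≠ z := fun h => hzS (h ▸ haS)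
    have ha := h.adj_new' haw
    refine ⟨insert w S, Or.inl rfl, fun h => h.elim (fun h => hwt h.symm) htS, ?_⟩
    rintro p (rfl | hp) q hpq hq
    · have := (h.adj_new q).1 hpq
      have hq' : q = a := by
        simp only [Set.mem_insert_iff, Set.mem_singleton_iff] at hq
        grind
      exact Or.inr (hq' ▸ haS)
    · rcases hcl p hp q hpq with h | h | h
      exacts [Or.inr h, Or.inl h, absurd (Or.inl h) hq]

/-- The case of the tripod property in which the subdividing vertex is the third vertex `t`: the
other neighbour `v` of `w` takes the place of `t`, unless the part of `u` off `x`, `y` and `v`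
misses `x` or `y`. -/
theorem tripod_apex (h : Subdivides r r' u v w) (hr : TripodProperty r) {x y : V} {S K : Set V}
    (hxy : x ≠ y) (hxw : x ≠ w) (hyw : y ≠ w) (hl : LinkedOff r' x y w S)
    (hxK : x ∉ K) (hyK : y ∉ K) (hu : u ∈ K) :
    ∃ z, z ≠ x ∧ z ≠ y ∧ z ≠ w ∧ (SepBy r' {y, z} x w ∨ SepBy r' {x, z} y w) := by
  have hux : u ≠ x := fun h => hxK (h ▸ hu)
  have huy : u ≠ y := fun h => hyK (h ▸ hu)
  -- if both neighbours of `w` are removed, then `w` is isolated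
  have block : ∀ {p q : V}, p ≠ w → p ≠ q → p ≠ u → (v = q ∨ v = u) → SepBy r' {q, u} p w :=
    fun {p q} hp h1 h2 hv => by
      refine SepBy.symm h.symm' (by simp [h1, h2]) ⟨{w}, rfl, hp, ?_⟩
      rintro a rfl b hab hb
      simp only [Set.mem_insert_iff, Set.mem_singleton_iff, not_or] at hb
      have := (h.adj_new b).1 hab
      grind
  by_cases hvx : v = x
  · exact ⟨u, hux, huy, h.left_ne, Or.inr (block hyw hxy.symm huy.symm (Or.inl hvx))⟩
  by_cases hvy : v = y
  · exact ⟨u, hux, huy, h.left_ne, Or.inl (block hxw hxy hux.symm (Or.inl hvy))⟩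
  by_cases hvu : v = u
  · exact ⟨u, hux, huy, h.left_ne, Or.inl (block hxw hxy hux.symm (Or.inr hvu))⟩
  have huS : u ∉ ({v, x, y} : Set V) := by simp [Ne.symm hvu, hux, huy]
  set R := reachSet r {v, x, y} u with hR
  have hRn : ∀ p ∈ R, p ≠ v ∧ p ≠ x ∧ p ≠ y := fun p hp => by
    simpa using notMem_of_mem_reachSet huS hp
  have hRw : ∀ p ∈ R, p ≠ w := fun p hp => by
    have : R ⊆ {w}ᶜ := reachSet_subset h.left_ne fun a _ b hab _ hb => h.isolated a (hb ▸ hab)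
    exact this hp
  -- if the part of `u` misses `p`, then `v` and the other one cut it off together with `w`
  have miss : ∀ {p q : V}, ({v, x, y} : Set V) = {v, p, q} → p ≠ w → p ≠ q → p ≠ v →
      ¬ Touches r R p → SepBy r' {q, v} p w := fun {p q} hpq hpw hne hpv ht => by
    have hpR : p ∉ R := fun hp => notMem_of_mem_reachSet huS hp (by rw [hpq]; simp)
    refine SepBy.symm h.symm' (by simp [hne, hpv])
      ⟨insert w R, Or.inl rfl, fun h => h.elim hpw hpR, ?_⟩
    rintro a (rfl | ha) b hab hb
    · rcases (h.adj_new b).1 hab with rfl | rfl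
      · exact Or.inr (self_mem_reachSet r _ _)
      · exact absurd (Or.inr rfl) hb
    · by_cases hbw : b = w
      · exact Or.inl hbw
      have hab' := h.of_ne _ _ (hRw a ha) hbw hab
      refine Or.inr (reachSet_closed ha hab' ?_)
      rw [hpq]
      rintro (rfl | rfl | rfl)
      exacts [hb (Or.inr rfl), ht ⟨a, ha, hab'⟩, hb (Or.inl rfl)]
  by_cases htx : Touches r R x
  swap
  · exact ⟨v, hvx, hvy, h.right_ne, Or.inl (miss rfl hxw hxy (Ne.symm hvx) htx)⟩
  by_cases hty : Touches r R y
  swap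
  · exact ⟨v, hvx, hvy, h.right_ne, Or.inr (miss (by rw [Set.pair_comm x y]) hyw hxy.symm
      (Ne.symm hvy) hty)⟩
  have hvS : LinkedOff r x y v (S \ {w}) := by
    have hl' : LinkedOff r' x y v S := by
      rcases hl with hl | ⟨h1, h2, h3, h4, h5, h6, h7⟩
      · exact Or.inl hl
      · refine Or.inr ⟨h1, h2, h3, fun hv => ?_, h5, h6, h7⟩
        rcases h7 v hv w (h.symm' _ _ ((h.adj_new v).2 (Or.inr rfl))) with h | h | h
        exacts [h4 h, hxw h.symm, hyw h.symm]
    exact h.linkedOff hxy hxw hyw hl'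
  obtain ⟨z, hzx, hzy, hzv, hz⟩ := hr x y v (S \ {w}) R hxy (Ne.symm hvx) (Ne.symm hvy) hvS
    (connIn_reachSet h.symm) (fun h => (hRn _ h).2.1 rfl) (fun h => (hRn _ h).2.2 rfl)
    (fun h => (hRn _ h).1 rfl) htx hty ⟨u, self_mem_reachSet r _ _, h.adj⟩
  -- what is cut off from `v` is cut off from `w`, since `u` and `v` are adjacent
  have lift : ∀ {p q z : V}, p ≠ w → v ∉ ({q, z} : Set V) → SepBy r {q, z} p v →
      SepBy r' {q, z} p w := by
    rintro p q z hp hv ⟨X, hpX, hvX, hX⟩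
    refine ⟨X \ {w}, ⟨hpX, hp⟩, fun h => h.2 rfl, ?_⟩
    rintro a ⟨haX, haw⟩ b hab hb
    by_cases hbw : b = w
    · subst hbw
      rcases h.adj_new' hab with rfl | rfl
      exacts [absurd (hX _ haX v h.adj hv) hvX, absurd haX hvX]
    · exact ⟨hX a haX b (h.of_ne _ _ haw hbw hab) hb, hbw⟩
  by_cases hzw : z = w
  · -- the vertex `w` is isolated in `r`, so that any vertex may replace it, for instance `u`
    subst hzw
    have drop : ∀ {p q : V}, p ≠ z → SepBy r {q, z} p v → SepBy r {q, u} p v := by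
      rintro p q hp ⟨X, hpX, hvX, hX⟩
      refine ⟨X, hpX, hvX, fun a ha b hab hb => hX a ha b hab ?_⟩
      rintro (rfl | rfl)
      exacts [hb (Or.inl rfl), h.isolated _ hab]
    exact ⟨u, hux, huy, h.left_ne, hz.imp
      (fun h => lift hxw (by simp [hvy, hvu]) (drop hxw h))
      (fun h => lift hyw (by simp [hvx, hvu]) (drop hyw h))⟩
  · exact ⟨z, hzx, hzy, hzw, hz.imp (lift hxw (by simp [hvy, Ne.symm hzv]))
      (lift hyw (by simp [hvx, Ne.symm hzv]))⟩

theorem tripodProperty (h : Subdivides r r' u v w) (hr : TripodProperty r) :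
    TripodProperty r' := by
  intro x y t S K hxy hxt hyt hl hK hxK hyK htK hKx hKy hKt
  by_cases hxw : x = w
  · subst hxw
    obtain ⟨z, h1, h2, h3, h4⟩ := h.tripod_linked hxt hyt hl hK hxK hyK htK hKx hKt
    exact ⟨z, h1, h2, h3, Or.inl h4⟩
  by_cases hyw : y = w
  · subst hyw
    obtain ⟨z, h1, h2, h3, h4⟩ :=
      h.tripod_linked hyt hxt (hl.swap h.symm') hK hyK hxK htK hKy hKt
    exact ⟨z, h2, h1, h3, Or.inr h4⟩
  by_cases htw : t = w
  · subst htw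
    obtain ⟨a, ha, hat⟩ := hKt
    rcases h.adj_new' hat with rfl | rfl
    · exact h.tripod_apex hr hxy hxw hyw hl hxK hyK ha
    · exact h.swap.tripod_apex hr hxy hxw hyw hl hxK hyK ha
  have hne : (K \ {w}).Nonempty := by
    by_contra hne
    have hsub : ∀ a ∈ K, a = w := fun a ha => by
      by_contra haw
      exact hne ⟨a, ha, haw⟩
    obtain ⟨a, ha, hax⟩ := hKx
    obtain ⟨b, hb, hby⟩ := hKy
    obtain ⟨c, hc, hct⟩ := hKt
    obtain rfl := hsub a ha
    obtain rfl := hsub b hb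
    obtain rfl := hsub c hc
    have h1 := (h.adj_new _).1 hax
    have h2 := (h.adj_new _).1 hby
    have h3 := (h.adj_new _).1 hct
    grind
  obtain ⟨z, h1, h2, h3, h4⟩ := hr x y t (S \ {w}) (K \ {w}) hxy hxt hyt
    (h.linkedOff hxy hxw hyw hl) (h.connIn hK hne) (fun h => hxK h.1) (fun h => hyK h.1)
    (fun h => htK h.1) (h.touches hK hne hxK hxw hKx) (h.touches hK hne hyK hyw hKy)
    (h.touches hK hne htK htw hKt)
  exact ⟨z, h1, h2, h3, h4.imp (h.sepBy hxw htw) (h.sepBy hyw htw)⟩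

/-- A vertex of `C` next to the subdividing vertex `w` meets all paths through `C` that start or
end in `w`, because the other neighbour of `w` lies outside `C`. -/
theorem exists_only_neighbor (h : Subdivides r r' u v w) {t : V} {C L : Set V} (hC : ConnIn r' C)
    (htC : t ∉ C) (hl : r' w t ∨ (Disjoint C L ∧ Touches r' L w)) :
    ∃ x ∈ C, ∀ b ∈ C, r' w b → b = x := by
  obtain ⟨d, hd, hdC⟩ : ∃ d, r' w d ∧ d ∉ C := by
    rcases hl with hl | ⟨hd, a, ha, haw⟩
    · exact ⟨t, hl, htC⟩
    · exact ⟨a, h.symm' _ _ haw, fun haC => Set.disjoint_left.1 hd haC ha⟩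
  have hd' := (h.adj_new d).1 hd
  by_cases hb : ∃ b ∈ C, r' w b
  · obtain ⟨b, hb, hwb⟩ := hb
    refine ⟨b, hb, fun c hc hwc => ?_⟩
    have h1 := (h.adj_new b).1 hwb
    have h2 := (h.adj_new c).1 hwc
    grind
  · obtain ⟨x, hx⟩ := hC.1
    exact ⟨x, hx, fun b hbC hwb => absurd ⟨b, hbC, hwb⟩ hb⟩

theorem cutVertexProperty (h : Subdivides r r' u v w) (hr : CutVertexProperty r) :
    CutVertexProperty r' := by
  intro s t C L hst hC hsC htC hl
  by_cases hsw : s = w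
  · subst hsw
    obtain ⟨x, hx, hx'⟩ := h.exists_only_neighbor hC htC
      (hl.imp id fun hl => ⟨hl.2.2.2.1, hl.2.2.2.2.1⟩)
    exact ⟨x, hx, ∅, Set.empty_subset _, fun b hb hbx hsb => absurd (hx' b hb hsb) hbx,
      by simp, by simp⟩
  by_cases htw : t = w
  · subst htw
    obtain ⟨x, hx, hx'⟩ := h.exists_only_neighbor hC hsC
      (hl.imp (h.symm' _ _) fun hl => ⟨hl.2.2.2.1, hl.2.2.2.2.2⟩)
    exact ⟨x, hx, C \ {x}, le_rfl, fun b hb hbx _ => ⟨hb, hbx⟩, fun _ _ b hb hbx _ => ⟨hb, hbx⟩,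
      fun a ha hat => ha.2 (hx' a ha.1 (h.symm' _ _ hat))⟩
  by_cases hne : (C \ {w}).Nonempty
  swap
  · have hsub : ∀ a ∈ C, a = w := fun a ha => by
      by_contra haw
      exact hne ⟨a, ha, haw⟩
    obtain ⟨x, hx⟩ := hC.1
    obtain rfl := hsub x hx
    exact ⟨x, hx, ∅, Set.empty_subset _, fun b hb hbx _ => absurd (hsub b hb) hbx,
      by simp, by simp⟩
  have hl' : r s t ∨ (ConnIn r (L \ {w}) ∧ s ∉ L \ {w} ∧ t ∉ L \ {w} ∧
      Disjoint (C \ {w}) (L \ {w}) ∧ Touches r (L \ {w}) s ∧ Touches r (L \ {w}) t) := by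
    rcases hl with hl | ⟨hL, hsL, htL, hd, hLs, hLt⟩
    · exact Or.inl (h.of_ne _ _ hsw htw hl)
    by_cases hLne : (L \ {w}).Nonempty
    · exact Or.inr ⟨h.connIn hL hLne, fun h => hsL h.1, fun h => htL h.1,
        hd.mono Set.sdiff_subset Set.sdiff_subset, h.touches hL hLne hsL hsw hLs,
        h.touches hL hLne htL htw hLt⟩
    · left
      have hsub : ∀ a ∈ L, a = w := fun a ha => by
        by_contra haw
        exact hLne ⟨a, ha, haw⟩
      obtain ⟨a, ha, has⟩ := hLs
      obtain ⟨b, hb, hbt⟩ := hLt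
      obtain rfl := hsub a ha
      obtain rfl := hsub b hb
      rcases (h.adj_new s).1 has with rfl | rfl <;> rcases (h.adj_new t).1 hbt with rfl | rfl
      exacts [absurd rfl hst, h.adj, h.symm _ _ h.adj, absurd rfl hst]
  obtain ⟨x, hx, X, hXC, hX1, hX2, hX3⟩ := hr s t (C \ {w}) (L \ {w}) hst (h.connIn hC hne)
    (fun h => hsC h.1) (fun h => htC h.1) hl'
  refine ⟨x, hx.1, X ∪ {p | p = w ∧ w ∈ C ∧ ∃ q, (q = s ∨ q ∈ X) ∧ r' q w}, ?_, ?_, ?_, ?_⟩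
  · rintro p (hp | ⟨rfl, hp, -⟩)
    exacts [⟨(hXC hp).1.1, (hXC hp).2⟩, ⟨hp, fun h => hx.2 h.symm⟩]
  · intro b hb hbx hsb
    by_cases hbw : b = w
    · subst hbw
      exact Or.inr ⟨rfl, hb, s, Or.inl rfl, hsb⟩
    · exact Or.inl (hX1 b ⟨hb, hbw⟩ hbx (h.of_ne _ _ hsw hbw hsb))
  · rintro a (ha | ⟨rfl, haC, q, hq, hqa⟩) b hb hbx hab
    · by_cases hbw : b = w
      · subst hbw
        exact Or.inr ⟨rfl, hb, a, Or.inr ha, hab⟩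
      · exact Or.inl (hX2 a ha b ⟨hb, hbw⟩ hbx (h.of_ne _ _ (hXC ha).1.2 hbw hab))
    · left
      have h1 := h.adj_new' hqa
      have h2 := (h.adj_new b).1 hab
      have hba : b ≠ a := by
        rintro rfl
        exact h2.elim (fun h' => h.left_ne h'.symm) (fun h' => h.right_ne h'.symm)
      by_cases hbq : b = q
      · subst hbq
        exact hq.elim (fun h => absurd (h ▸ hb) hsC) id
      have hqb : r q b := by
        rcases h1 with rfl | rfl <;> rcases h2 with rfl | rfl
        exacts [absurd rfl hbq, h.adj, h.symm _ _ h.adj, absurd rfl hbq]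
      rcases hq with rfl | hq
      · exact hX1 b ⟨hb, hba⟩ hbx hqb
      · exact hX2 q hq b ⟨hb, hba⟩ hbx hqb
  · rintro a (ha | ⟨rfl, haC, q, hq, hqa⟩) hat
    · exact hX3 a ha (h.of_ne _ _ (hXC ha).1.2 htw hat)
    · have h1 := h.adj_new' hqa
      have h2 := (h.adj_new t).1 hat
      obtain ⟨b, hb, hbw⟩ := hne
      obtain ⟨c, hc, hcw, hac⟩ := hC.exists_adj haC hb hbw
      have h3 := (h.adj_new c).1 hac
      have hct : c ≠ t := fun h => htC (h ▸ hc)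
      rcases hq with rfl | hq
      · have : c ≠ q := fun h => hsC (h ▸ hc)
        grind
      · have hqt : q ≠ t := fun h => htC (h ▸ (hXC hq).1.1)
        have hqt' : r q t := by
          rcases h1 with rfl | rfl <;> rcases h2 with rfl | rfl
          exacts [absurd rfl hqt, h.adj, h.symm _ _ h.adj, absurd rfl hqt]
        exact hX3 q hq hqt'

theorem pairOrDisconnectedProperty (h : Subdivides r r' u v w) {W : Set V}
    (hW : ∀ a b, r a b → a ∈ W) (hw : w ∉ W) (hr : PairOrDisconnectedProperty r W) :
    PairOrDisconnectedProperty r' (insert w W) := by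
  have hu : u ∈ W := hW _ _ h.adj
  have hv : v ∈ W := hW _ _ (h.symm _ _ h.adj)
  -- a vertex with only two neighbours is cut off by them
  have new : ∀ t, t ≠ w → ¬ r' w t → w ≠ u ∧ w ≠ v ∧ t ≠ u ∧ t ≠ v ∧ SepBy r' {u, v} w t := by
    intro t ht hwt
    have := mt (h.adj_new t).2 hwt
    push Not at this
    refine ⟨h.left_ne.symm, h.right_ne.symm, this.1, this.2, {w}, rfl, ht, ?_⟩
    rintro a rfl b hab hb
    exact absurd ((h.adj_new b).1 hab) hb
  intro s hs t ht hst hnst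
  rcases hs with rfl | hs
  · obtain ⟨h1, h2, h3, h4, h5⟩ := new t (Ne.symm hst) hnst
    exact Or.inl ⟨u, v, h1, h2, h3, h4, h5⟩
  rcases ht with rfl | ht
  · obtain ⟨h1, h2, h3, h4, h5⟩ := new s hst fun h' => hnst (h.symm' _ _ h')
    exact Or.inl ⟨u, v, h3, h4, h1, h2, h5.symm h.symm' (by simp [h3, h4])⟩
  have hne : ∀ a ∈ W, a ≠ w := fun a ha h => hw (h ▸ ha)
  by_cases hrst : r s t
  · have huv : (s = u ∧ t = v) ∨ (s = v ∧ t = u) := (h.old s t hrst).resolve_left hnst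
    by_cases hp : ∃ p ∈ W, p ≠ s ∧ p ≠ t
    · obtain ⟨p, hp, hps, hpt⟩ := hp
      refine Or.inr ⟨w, Or.inl rfl, p, Or.inr hp, (hne s hs).symm, (hne t ht).symm, hps, hpt,
        {w}, rfl, hne p hp, ?_⟩
      rintro a rfl b hab hb
      have := (h.adj_new b).1 hab
      simp only [Set.mem_insert_iff, Set.mem_singleton_iff] at hb
      grind
    · refine Or.inl ⟨w, w, hne s hs, hne s hs, hne t ht, hne t ht, {s}, rfl, hst.symm, ?_⟩
      rintro a rfl b hab hb
      have hbw : b ≠ w := fun h => hb (Or.inl h)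
      have hbW : b ∈ W := hW b a (h.symm _ _ (h.of_ne _ _ (hne a hs) hbw hab))
      by_contra hba
      refine hp ⟨b, hbW, hba, ?_⟩
      rintro rfl
      exact hnst hab
  · rcases hr s hs t ht hst hrst with
      ⟨a, b, h1, h2, h3, h4, h5⟩ | ⟨p, hp, q, hq, h1, h2, h3, h4, h5⟩
    · exact Or.inl ⟨a, b, h1, h2, h3, h4, h.sepBy (hne s hs) (hne t ht) h5⟩
    · exact Or.inr ⟨p, Or.inr hp, q, Or.inr hq, h1, h2, h3, h4, h.sepBy (hne p hp) (hne q hq) h5⟩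

end Subdivides

theorem FromLoop.mem {W : Set V} {E : Multiset (Sym2 V)} (h : FromLoop W E) {a b : V}
    (hab : s(a, b) ∈ E) : a ∈ W := by
  induction h generalizing a b with
  | loop v =>
    simp only [Multiset.mem_singleton, Sym2.eq_iff] at hab
    rcases hab with h | h <;> exact h.1
  | @series W E u v w h hw ih =>
    have hu : u ∈ W := ih (Multiset.mem_cons_self _ _)
    have hv : v ∈ W := ih (a := v) (b := u) (by rw [Sym2.eq_swap]; exact Multiset.mem_cons_self _ _)
    simp only [Multiset.mem_cons, Sym2.eq_iff] at hab
    rcases hab with (⟨rfl, -⟩ | ⟨rfl, -⟩) | (⟨rfl, -⟩ | ⟨rfl, -⟩) | hab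
    exacts [Or.inr hu, Or.inl rfl, Or.inl rfl, Or.inr hv,
      Or.inr (ih (Multiset.mem_cons_of_mem hab))]
  | parallel h ih => exact ih (by simpa using hab)

theorem FromLoop.subdivides {W : Set V} {E : Multiset (Sym2 V)} {u v w : V}
    (h : FromLoop W (s(u, v) ::ₘ E)) (hw : w ∉ W) :
    Subdivides (fun a b => s(a, b) ∈ s(u, v) ::ₘ E)
      (fun a b => s(a, b) ∈ s(u, w) ::ₘ s(w, v) ::ₘ E) u v w where
  symm a b hab := by rwa [Sym2.eq_swap (a := b)]
  symm' a b hab := by rwa [Sym2.eq_swap (a := b)]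
  adj := Multiset.mem_cons_self _ _
  isolated a ha := hw (h.mem (b := a) (by rwa [Sym2.eq_swap (a := w)]))
  adj_new b := by
    have hE : s(w, b) ∉ E := fun hb => hw (h.mem (Multiset.mem_cons_of_mem hb))
    simp only [Multiset.mem_cons, Sym2.eq_iff, hE]
    grind
  of_ne a b ha hb hab := by
    simp only [Multiset.mem_cons, Sym2.eq_iff] at hab ⊢
    grind
  old a b hab := by
    simp only [Multiset.mem_cons, Sym2.eq_iff] at hab ⊢
    grind

/-- Graphs generated from a loop have all three properties. Doubling an edge does not change the
adjacency relation. -/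
theorem FromLoop.properties {W : Set V} {E : Multiset (Sym2 V)} (h : FromLoop W E) :
    TripodProperty (fun a b => s(a, b) ∈ E) ∧ CutVertexProperty (fun a b => s(a, b) ∈ E) ∧
      PairOrDisconnectedProperty (fun a b => s(a, b) ∈ E) W := by
  induction h with
  | loop v =>
    have hv : ∀ {a b : V}, s(a, b) ∈ ({s(v, v)} : Multiset (Sym2 V)) → a = v ∧ b = v :=
      fun hab => by simpa using hab
    refine ⟨?_, ?_, ?_⟩
    · rintro x y t S K hxy - - - - - - - ⟨a, -, ha⟩ ⟨b, -, hb⟩ -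
      exact absurd ((hv ha).2.trans (hv hb).2.symm) hxy
    · rintro s t C L hst - - - (h | ⟨-, -, -, -, ⟨a, -, ha⟩, ⟨b, -, hb⟩⟩)
      · exact absurd ((hv h).1.trans (hv h).2.symm) hst
      · exact absurd ((hv ha).2.trans (hv hb).2.symm) hst
    · rintro s rfl t rfl hst
      exact absurd rfl hst
  | series w h hw ih =>
    have hs := h.subdivides hw
    exact ⟨hs.tripodProperty ih.1, hs.cutVertexProperty ih.2.1,
      hs.pairOrDisconnectedProperty (fun a b hab => h.mem hab) hw ih.2.2⟩
  | @parallel W E e h ih =>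
    have : (fun a b : V => s(a, b) ∈ e ::ₘ e ::ₘ E) = fun a b => s(a, b) ∈ e ::ₘ E := by
      ext a b
      simp
    rwa [this]

end Relation

/-! ### Separators and reachability -/

section Separators

variable {V : Type u} {G : SimpleGraph V} {s t : V}

theorem reachSet_of_reachable_induce {T : Set V} {a b : T} (h : (G.induce T).Reachable a b) :
    (b : V) ∈ reachSet G.Adj Tᶜ (a : V) := by
  rw [SimpleGraph.reachable_iff_reflTransGen] at h
  induction h with
  | refl => exact self_mem_reachSet _ _ _
  | @tail b c _ hbc ih => exact reachSet_closed ih hbc fun h => h c.2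

theorem reachable_induce_of_reachSet {T : Set V} {a b : V} (ha : a ∈ T) (hb : b ∈ T)
    (h : b ∈ reachSet G.Adj Tᶜ a) : (G.induce T).Reachable ⟨a, ha⟩ ⟨b, hb⟩ := by
  induction h with
  | refl => exact SimpleGraph.Reachable.refl _
  | @tail b c _ hbc ih =>
    have hbT : b ∈ T := not_not.1
      (notMem_of_mem_reachSet (r := G.Adj) (not_not.2 ha) (by assumption))
    have : (G.induce T).Adj ⟨b, hbT⟩ ⟨c, hb⟩ := hbc.1
    exact (ih hbT).trans this.reachable

theorem isSeparator_iff {S : Finset V} :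
    IsSeparator G s t S ↔ s ∉ S ∧ t ∉ S ∧ t ∉ reachSet G.Adj S s := by
  have hS : ({v | v ∉ S} : Set V)ᶜ = S := by
    ext
    simp
  constructor
  · rintro ⟨hs, ht, h⟩
    refine ⟨hs, ht, fun hr => h (reachable_induce_of_reachSet hs ht ?_)⟩
    rwa [hS]
  · rintro ⟨hs, ht, h⟩
    refine ⟨hs, ht, fun hr => h ?_⟩
    have := reachSet_of_reachable_induce hr
    rwa [hS] at this

theorem IsSeparator.of_closed {S : Finset V} {X : Set V} (hs : s ∉ S) (ht : t ∉ S) (hsX : s ∈ X)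
    (htX : t ∉ X) (hX : ∀ p ∈ X, ∀ q, G.Adj p q → q ∉ S → q ∈ X) : IsSeparator G s t S :=
  isSeparator_iff.2 ⟨hs, ht, fun h => htX (reachSet_subset hsX (by simpa using hX) h)⟩

theorem mem_reachSet_symm {S : Set V} {a b : V} (ha : a ∉ S) (h : b ∈ reachSet G.Adj S a) :
    a ∈ reachSet G.Adj S b := by
  by_contra hn
  exact sepBy_iff.1 (SepBy.symm (fun _ _ => G.symm.symm _ _) ha (sepBy_iff.2 hn)) h

theorem reachSet_trans {S : Set V} {a b : V} (h : b ∈ reachSet G.Adj S a) :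
    reachSet G.Adj S b ⊆ reachSet G.Adj S a :=
  reachSet_subset h fun _ hp _ hpq hq => reachSet_closed hp hpq hq

theorem IsSeparator.symm {S : Finset V} (h : IsSeparator G s t S) : IsSeparator G t s S := by
  rw [isSeparator_iff] at h ⊢
  exact ⟨h.2.1, h.1, fun hs => h.2.2 (mem_reachSet_symm (by simpa using h.2.1) hs)⟩

theorem IsMinimumSeparator.symm {S : Finset V} (h : IsMinimumSeparator G s t S) :
    IsMinimumSeparator G t s S :=
  ⟨h.1.symm, fun T hT => h.2 T hT.symm⟩

theorem IsSeparator.superset {S T : Finset V} (h : IsSeparator G s t S) (hST : S ⊆ T) (hs : s ∉ T)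
    (ht : t ∉ T) : IsSeparator G s t T := by
  refine IsSeparator.of_closed hs ht (self_mem_reachSet _ (S : Set V) s) (isSeparator_iff.1 h).2.2
    fun p hp q hpq hq => reachSet_closed hp hpq fun hqS => hq (hST hqS)

theorem IsSeparator.disjoint_reachSet {S : Finset V} (h : IsSeparator G s t S) {p : V}
    (hs : p ∈ reachSet G.Adj S s) (ht : p ∈ reachSet G.Adj S t) : False := by
  rw [isSeparator_iff] at h
  exact h.2.2 (reachSet_trans hs (mem_reachSet_symm (by simpa using h.2.1) ht))

theorem IsSeparator.notMem_of_mem_reachSet {S : Finset V} (h : IsSeparator G s t S) {p : V}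
    (hs : p ∈ reachSet G.Adj S s) : p ∉ S := by
  have := SepReconf.notMem_of_mem_reachSet (r := G.Adj) (S := (S : Set V))
    (by simpa using (isSeparator_iff.1 h).1) hs
  simpa using this

/-- The set obtained from `A` by moving the token on `a` to `v`. -/
def moveToken [DecidableEq V] (A : Finset V) (a v : V) : Finset V := (A \ {a}) ∪ {v}

theorem mem_moveToken [DecidableEq V] {A : Finset V} {a v p : V} :
    p ∈ moveToken A a v ↔ (p ∈ A ∧ p ≠ a) ∨ p = v := by
  simp [moveToken, or_comm]

theorem card_moveToken [DecidableEq V] {A : Finset V} {a v : V} (ha : a ∈ A) (hv : v ∉ A) :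
    (moveToken A a v).card = A.card := by
  have : moveToken A a v = insert v (A.erase a) := by
    ext
    simp only [mem_moveToken, Finset.mem_insert, Finset.mem_erase]
    tauto
  rw [this, Finset.card_insert_of_notMem (by simp [hv]), Finset.card_erase_add_one ha]

theorem tjAdj_moveToken [DecidableEq V] {A : Finset V} {a v : V} (ha : a ∈ A) (hv : v ∉ A) :
    TJAdj A (moveToken A a v) := by
  have hav : a ≠ v := fun h => hv (h ▸ ha)
  refine ⟨(card_moveToken ha hv).symm, ?_, ?_⟩ <;> rw [Finset.card_eq_one]
  · refine ⟨a, ?_⟩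
    ext p
    simp only [Finset.mem_sdiff, mem_moveToken, Finset.mem_singleton]
    grind
  · refine ⟨v, ?_⟩
    ext p
    simp only [Finset.mem_sdiff, mem_moveToken, Finset.mem_singleton]
    grind

theorem TJAdj.symm [DecidableEq V] {A B : Finset V} (h : TJAdj A B) : TJAdj B A :=
  ⟨h.1.symm, h.2.2, h.2.1⟩

/-- No token on `P` can be moved to `Q` such that the result is a separator. -/
def NoMove [DecidableEq V] (G : SimpleGraph V) (s t : V) (P Q : Set V) (A : Finset V) : Prop :=
  ∀ a ∈ P, ∀ v ∈ Q, ¬ IsSeparator G s t (moveToken A a v)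

theorem NoMove.symm [DecidableEq V] {P Q : Set V} {A : Finset V} (h : NoMove G s t P Q A) :
    NoMove G t s P Q A :=
  fun a ha v hv hs => h a ha v hv hs.symm

/-- Each vertex of a minimum separator has a neighbour on the side of `s`, as it would be
superfluous otherwise. -/
theorem IsMinimumSeparator.touches {M : Finset V} (h : IsMinimumSeparator G s t M) {v : V}
    (hv : v ∈ M) : Touches G.Adj (reachSet G.Adj M s) v := by
  classical
  by_contra hn
  have hM := isSeparator_iff.1 h.1
  have : IsSeparator G s t (M.erase v) := by
    refine IsSeparator.of_closed (fun h => hM.1 (Finset.mem_of_mem_erase h))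
      (fun h => hM.2.1 (Finset.mem_of_mem_erase h)) (self_mem_reachSet _ (M : Set V) s) hM.2.2 ?_
    intro p hp q hpq hq
    by_cases hqv : q = v
    · subst hqv
      exact absurd ⟨p, hp, hpq⟩ hn
    · exact reachSet_closed hp hpq fun hqM => hq (Finset.mem_erase.2 ⟨hqv, hqM⟩)
  have h1 := h.2 _ this
  have h2 := Finset.card_erase_lt_of_mem hv
  omega

/-- If `A` avoids the side of `s` of the minimum separator `M`, as well as `M`, then `M` is reached
from `s` past `A`. -/
theorem IsMinimumSeparator.mem_reachSet {M A : Finset V} (h : IsMinimumSeparator G s t M)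
    (hA : ∀ a ∈ A, a ∉ M ∧ a ∉ reachSet G.Adj M s) {v : V} (hv : v ∈ M) :
    v ∈ reachSet G.Adj A s := by
  have hsub : reachSet G.Adj M s ⊆ reachSet G.Adj A s ∩ reachSet G.Adj M s := by
    refine reachSet_subset ⟨self_mem_reachSet _ _ _, self_mem_reachSet _ _ _⟩ ?_
    rintro p ⟨hpA, hpM⟩ q hpq hq
    have := reachSet_closed hpM hpq hq
    exact ⟨reachSet_closed hpA hpq fun hqA => (hA q hqA).2 this, this⟩
  obtain ⟨p, hp, hpv⟩ := h.touches hv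
  exact reachSet_closed (hsub hp).1 hpv fun hvA => (hA v hvA).1 hv

/-- A separator cannot lie strictly beyond one minimum separator and strictly before another one
if these have a common vertex. -/
theorem not_beyond_and_before {M N A : Finset V} (hM : IsMinimumSeparator G s t M)
    (hN : IsMinimumSeparator G s t N) (hA : IsSeparator G s t A) {v : V} (hvM : v ∈ M)
    (hvN : v ∈ N) (h1 : ∀ a ∈ A, a ∉ M ∧ a ∉ reachSet G.Adj M s)
    (h2 : ∀ a ∈ A, a ∉ N ∧ a ∉ reachSet G.Adj N t) : False :=
  hA.disjoint_reachSet (hM.mem_reachSet h1 hvM) (hN.symm.mem_reachSet h2 hvN)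

/-! ### Minimum separators with two vertices -/

/-- If no token of `A` can be moved to the minimum separator `M` of size two, then `A` contains `M`
or avoids `M` and one of its sides. Otherwise uncrossing `A` and `M` would yield a move. -/
theorem nested_of_noMove [DecidableEq V] {M A : Finset V} (hM : IsMinimumSeparator G s t M)
    (hM2 : M.card = 2) (hA : IsSeparator G s t A)
    (hno : NoMove G s t ((A \ M : Finset V) : Set V) ((M \ A : Finset V) : Set V) A)
    (hMA : ¬ M ⊆ A) :
    (∀ a ∈ A, a ∉ M ∧ a ∉ reachSet G.Adj M s) ∨ (∀ a ∈ A, a ∉ M ∧ a ∉ reachSet G.Adj M t) := by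
  have hM' := isSeparator_iff.1 hM.1
  have hA' := isSeparator_iff.1 hA
  -- a move is possible as soon as its result contains a separator
  have move : ∀ {a v : V} {S : Finset V}, a ∈ A → a ∉ M → v ∈ M → v ∉ A → IsSeparator G s t S →
      S ⊆ moveToken A a v → False := by
    intro a v S ha haM hv hvA hS hsub
    refine hno a (by simp [ha, haM]) v (by simp [hv, hvA]) (hS.superset hsub ?_ ?_)
    · rw [mem_moveToken]
      rintro (h | rfl)
      exacts [hA'.1 h.1, hM'.1 hv]
    · rw [mem_moveToken]
      rintro (h | rfl)
      exacts [hA'.2.1 h.1, hM'.2.1 hv]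
  obtain ⟨x, hxM, hxA⟩ := Finset.not_subset.1 hMA
  obtain ⟨y, hyx, hMxy⟩ : ∃ y, y ≠ x ∧ M = {x, y} := by
    obtain ⟨p, q, hpq, rfl⟩ := Finset.card_eq_two.1 hM2
    simp only [Finset.mem_insert, Finset.mem_singleton] at hxM
    rcases hxM with rfl | rfl
    exacts [⟨q, hpq.symm, rfl⟩, ⟨p, hpq, Finset.pair_comm _ _⟩]
  have hyM : y ∈ M := by simp [hMxy]
  by_cases hyA : y ∈ A
  · exfalso
    have : 1 < A.card := by
      have := hM.2 A hA
      omega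
    obtain ⟨a, ha, hay⟩ := Finset.exists_mem_ne this y
    have hax : a ≠ x := fun h => hxA (h ▸ ha)
    refine move ha (by simp [hMxy, hax, hay]) hxM hxA hM.1 ?_
    rw [hMxy]
    intro p hp
    simp only [Finset.mem_insert, Finset.mem_singleton] at hp
    rw [mem_moveToken]
    rcases hp with rfl | rfl
    exacts [Or.inr rfl, Or.inl ⟨hyA, hay.symm⟩]
  have hdisj : ∀ a ∈ A, a ∉ M := fun a ha haM => by
    rw [hMxy] at haM
    simp only [Finset.mem_insert, Finset.mem_singleton] at haM
    rcases haM with rfl | rfl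
    exacts [hxA ha, hyA ha]
  by_contra! hcon
  obtain ⟨⟨a, haA, ha⟩, ⟨b, hbA, hb⟩⟩ := hcon
  replace ha := ha (hdisj a haA)
  replace hb := hb (hdisj b hbA)
  classical
  -- the tokens on the side of `q` with the part of `M` reached from `q` past `A` separate
  have near : ∀ {p q : V}, IsSeparator G q p A → IsSeparator G q p M →
      IsSeparator G q p {v ∈ A ∪ M | (v ∈ A ∧ v ∈ reachSet G.Adj M q) ∨
        (v ∈ M ∧ v ∈ reachSet G.Adj A q)} := by
    intro p q hqA hqM
    have h1 := isSeparator_iff.1 hqA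
    have h2 := isSeparator_iff.1 hqM
    refine IsSeparator.of_closed (X := reachSet G.Adj A q ∩ reachSet G.Adj M q) ?_ ?_
      ⟨self_mem_reachSet _ _ _, self_mem_reachSet _ _ _⟩ (fun h => h1.2.2 h.1) ?_
    · simp [h1.1, h2.1]
    · simp [h1.2.1, h2.2.1]
    · rintro c ⟨hcA, hcM⟩ d hcd hd
      simp only [Finset.mem_filter, Finset.mem_union, not_and, not_or] at hd
      have hdA : d ∉ A := fun hdA =>
        (hd (Or.inl hdA)).1 hdA (reachSet_closed hcM hcd (by simpa using hdisj d hdA))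
      have hd1 := reachSet_closed (S := (A : Set V)) hcA hcd (by simpa using hdA)
      have hdM : d ∉ M := fun hdM => (hd (Or.inr hdM)).2 hdM hd1
      exact ⟨hd1, reachSet_closed hcM hcd (by simpa using hdM)⟩
  have hst : ∀ v, v ∈ reachSet G.Adj M s → v ∉ reachSet G.Adj M t :=
    fun v h1 h2 => hM.1.disjoint_reachSet h1 h2
  have hstA : ∀ v, v ∈ reachSet G.Adj A s → v ∉ reachSet G.Adj A t :=
    fun v h1 h2 => hA.disjoint_reachSet h1 h2
  have hmem : ∀ v, v ∈ M ↔ v = x ∨ v = y := fun v => by simp [hMxy]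
  have hS := near hA hM.1
  have hT := (near hA.symm hM.1.symm).symm
  -- both vertices of `M` are reached from `s` past `A`: otherwise the tokens on the side of `s` and
  -- one vertex of `M` separate, and a token on the side of `t` can be moved to this vertex
  have key : ∀ v w : V, v ∈ M → v ∉ A → (∀ u, u ∈ M ↔ u = v ∨ u = w) →
      w ∉ reachSet G.Adj A s → False := by
    intro v w hv hvA hvw hw
    refine move hbA (hdisj b hbA) hv hvA hS ?_
    intro p hp
    simp only [Finset.mem_filter, Finset.mem_union] at hp
    rw [mem_moveToken]
    rcases hp.2 with ⟨h1, h2⟩ | ⟨h1, h2⟩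
    · exact Or.inl ⟨h1, fun h => hst p h2 (h ▸ hb)⟩
    · rcases (hvw p).1 h1 with rfl | rfl
      exacts [Or.inr rfl, absurd h2 hw]
  have h1 : y ∈ reachSet G.Adj A s := by
    by_contra h
    exact key x y hxM hxA hmem h
  have h2 : x ∈ reachSet G.Adj A s := by
    by_contra h
    exact key y x hyM hyA (fun u => (hmem u).trans or_comm) h
  -- hence the tokens on the side of `t` separate on their own, and the other ones are free
  refine move haA (hdisj a haA) hxM hxA hT ?_
  intro p hp
  simp only [Finset.mem_filter, Finset.mem_union] at hp
  rw [mem_moveToken]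
  rcases hp.2 with ⟨h3, h4⟩ | ⟨h3, h4⟩
  · exact Or.inl ⟨h3, fun h => hst a ha (h ▸ h4)⟩
  · rcases (hmem p).1 h3 with rfl | rfl
    exacts [absurd h4 (hstA _ h2), absurd h4 (hstA _ h1)]

end Separators

section Separators

variable {V : Type u} {G : SimpleGraph V} {s t : V}

/-- Let `M` be a minimum separator of size two, and let `A` be a separator strictly beyond `M`. If
no token of `A` can be moved to `M`, then `M` itself can be moved one step towards `t`: otherwise,
by the tripod property, the sides of the two vertices of `M` in front of `t` do not meet, and
a token on the side of one of them can be moved to that vertex. -/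
theorem exists_advance [DecidableEq V] (hG : TripodProperty G.Adj) {M A : Finset V}
    (hM : IsMinimumSeparator G s t M) (hM2 : M.card = 2) (hA : IsSeparator G s t A)
    (hno : NoMove G s t ((A \ M : Finset V) : Set V) ((M \ A : Finset V) : Set V) A)
    (hbeyond : ∀ a ∈ A, a ∉ M ∧ a ∉ reachSet G.Adj M s) :
    ¬ NoMove G s t M (reachSet G.Adj M t) M := by
  intro hstuck
  have hM' := isSeparator_iff.1 hM.1
  have hA' := isSeparator_iff.1 hA
  obtain ⟨x, y, hxy, hMxy⟩ := Finset.card_eq_two.1 hM2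
  have hxM : x ∈ M := by simp [hMxy]
  have hyM : y ∈ M := by simp [hMxy]
  have hsx : s ≠ x := fun h => hM'.1 (h ▸ hxM)
  have hsy : s ≠ y := fun h => hM'.1 (h ▸ hyM)
  have htx : t ≠ x := fun h => hM'.2.1 (h ▸ hxM)
  have hty : t ≠ y := fun h => hM'.2.1 (h ▸ hyM)
  have hMmem : ∀ v, v ∈ M ↔ v = x ∨ v = y := fun v => by simp [hMxy]
  have hMset : (M : Set V) = {x, y} := by simp [hMxy]
  have hadj : ∀ a b, G.Adj a b → G.Adj b a := fun a b h => h.symm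
  -- the part of the side of `t`, without `t`, that contains `q`
  set K : V → Set V := fun q => reachSet G.Adj {x, y, t} q with hK
  have hKsub : ∀ q ∈ reachSet G.Adj M t, q ≠ t → ∀ p ∈ K q,
      p ∈ reachSet G.Adj M t ∧ p ≠ x ∧ p ≠ y ∧ p ≠ t := by
    intro q hq hqt p hp
    have hqM := hM.1.symm.notMem_of_mem_reachSet hq
    rw [hMmem] at hqM
    have h1 : p ∉ ({x, y, t} : Set V) := notMem_of_mem_reachSet (by simpa [hqt] using hqM) hp
    refine ⟨reachSet_subset hq (fun a ha b hab hb => reachSet_closed ha hab ?_) hp,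
      by simpa using h1⟩
    simp only [hMset, Set.mem_insert_iff, Set.mem_singleton_iff] at hb ⊢
    tauto
  have hKt : ∀ q ∈ reachSet G.Adj M t, q ≠ t → Touches G.Adj (K q) t := by
    intro q hq hqt
    by_contra hn
    have htq : t ∈ reachSet G.Adj M q := mem_reachSet_symm (by simpa using hM'.2.1) hq
    have : t ∈ K q := reachSet_subset (self_mem_reachSet _ _ _) (fun a ha b hab hb => by
      refine reachSet_closed ha hab ?_
      rintro (h | h | rfl)
      · exact hb (by simp [hMset, h])
      · exact hb (by simp [hMset, show b = y from h])
      · exact hn ⟨a, ha, hab⟩) htq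
    exact (hKsub q hq hqt t this).2.2.2 rfl
  -- by the tripod property, no such part touches both `x` and `y`
  have hKxy : ∀ q ∈ reachSet G.Adj M t, q ≠ t → G.Adj q x → ∀ p ∈ K q, ¬ G.Adj p y := by
    intro q hq hqt hqx p hp hpy
    have hKq := hKsub q hq hqt
    have hnS : ∀ {v}, v ∈ M → v ∉ reachSet G.Adj M s := fun hv h =>
      hM.1.notMem_of_mem_reachSet h hv
    obtain ⟨z, hzx, hzy, hzt, hz⟩ := hG x y t (reachSet G.Adj M s) (K q) hxy htx.symm hty.symm
      (Or.inr ⟨connIn_reachSet hadj, hnS hxM, hnS hyM, hM'.2.2, hM.touches hxM, hM.touches hyM, by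
        intro a ha b hab
        by_cases hb : b ∈ M
        · exact Or.inr ((hMmem b).1 hb)
        · exact Or.inl (reachSet_closed ha hab (by simpa using hb))⟩)
      (connIn_reachSet hadj) (fun h => (hKq _ h).2.1 rfl) (fun h => (hKq _ h).2.2.1 rfl)
      (fun h => (hKq _ h).2.2.2 rfl) ⟨q, self_mem_reachSet _ _ _, hqx⟩ ⟨p, hp, hpy⟩
      (hKt q hq hqt)
    have step : ∀ {v w : V}, v ∈ M → w ∈ M → v ≠ w → (∀ u, u ∈ M ↔ u = v ∨ u = w) → z ≠ v →
        SepBy G.Adj {w, z} v t → False := by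
      intro v w hv hw hvw hMvw hzv hsep
      -- the vertex `z` lies on the side of `t`, since this side links `v` to `t`
      have hzT : z ∈ reachSet G.Adj M t := by
        by_contra hzT
        obtain ⟨X, hvX, htX, hX⟩ := hsep.symm hadj (by
          rintro (h | h)
          exacts [hM'.2.1 (h ▸ hw), hzt h.symm])
        have hsub : reachSet G.Adj M t ⊆ X ∩ reachSet G.Adj M t := by
          refine reachSet_subset ⟨hvX, self_mem_reachSet _ _ _⟩ fun a ha b hab hb => ?_
          have hb' := reachSet_closed ha.2 hab hb
          refine ⟨hX a ha.1 b hab ?_, hb'⟩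
          rintro (rfl | rfl)
          exacts [hb hw, hzT hb']
        obtain ⟨a, ha, hav⟩ := hM.symm.touches hv
        exact htX (hX a (hsub ha).1 v hav (by
          rintro (h | h)
          exacts [hvw h, hzv h.symm]))
      have hzS : z ∉ reachSet G.Adj M s := fun h => hM.1.disjoint_reachSet h hzT
      refine hstuck v hv z hzT ?_
      obtain ⟨X, hvX, htX, hX⟩ := hsep
      have hmem : ∀ {u}, u ∈ moveToken M v z ↔ u = w ∨ u = z := by
        intro u
        rw [mem_moveToken, hMvw]
        grind
      -- the side of `s` joins the part of `v`
      refine IsSeparator.of_closed (X := X ∪ reachSet G.Adj M s) ?_ ?_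
        (Or.inr (self_mem_reachSet _ _ _)) (fun h => h.elim htX hM'.2.2) ?_
      · rw [hmem]
        rintro (h | h)
        exacts [hM'.1 (h ▸ hw), hzS (h ▸ self_mem_reachSet _ _ _)]
      · rw [hmem]
        rintro (h | h)
        exacts [hM'.2.1 (h ▸ hw), hzt h.symm]
      · rintro a (ha | ha) b hab hb
        · rw [hmem] at hb
          exact Or.inl (hX a ha b hab hb)
        · by_cases hbM : b ∈ M
          · rcases (hMvw b).1 hbM with rfl | rfl
            exacts [Or.inl hvX, absurd (hmem.2 (Or.inl rfl)) hb]
          · exact Or.inr (reachSet_closed ha hab (by simpa using hbM))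
    rcases hz with hz | hz
    · exact step hxM hyM hxy hMmem hzx hz
    · exact step hyM hxM hxy.symm (fun u => (hMmem u).trans or_comm) hzy hz
  have hxA : x ∈ reachSet G.Adj A s := hM.mem_reachSet hbeyond hxM
  obtain ⟨q, hq, hqx⟩ := hM.symm.touches hxM
  have hqt : q ≠ t := by
    rintro rfl
    exact hA'.2.2 (reachSet_closed hxA hqx.symm (by simpa using hA'.2.1))
  obtain ⟨a, haA, haK⟩ : ∃ a ∈ A, a ∈ K q := by
    by_contra! hn
    have hqA := reachSet_closed (S := (A : Set V)) hxA hqx.symm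
      (fun h => hn q h (self_mem_reachSet _ _ _))
    have hsub : K q ⊆ K q ∩ reachSet G.Adj A s :=
      reachSet_subset ⟨self_mem_reachSet _ _ _, hqA⟩ fun p hp b hpb hb =>
        ⟨reachSet_closed hp.1 hpb hb, reachSet_closed hp.2 hpb fun h =>
          hn b h (reachSet_closed hp.1 hpb hb)⟩
    obtain ⟨p, hp, hpt⟩ := hKt q hq hqt
    exact hA'.2.2 (reachSet_closed (hsub hp).2 hpt (by simpa using hA'.2.1))
  have hKq := hKsub q hq hqt
  refine hno a (by simp [haA, (hbeyond a haA).1]) x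
    (by simpa [hxM] using fun h => (hbeyond x h).1 hxM) ?_
  refine IsSeparator.of_closed (X := reachSet G.Adj A s \ insert x (K q)) ?_ ?_
    ⟨self_mem_reachSet _ _ _, ?_⟩ (fun h => hA'.2.2 h.1) ?_
  · rw [mem_moveToken]
    rintro (h | h)
    exacts [hA'.1 h.1, hsx h]
  · rw [mem_moveToken]
    rintro (h | h)
    exacts [hA'.2.1 h.1, htx h]
  · rintro (h | h)
    exacts [hsx h, hM.1.disjoint_reachSet (self_mem_reachSet _ _ _) (hKq s h).1]
  · rintro p ⟨hpA, hp⟩ b hpb hb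
    rw [mem_moveToken] at hb
    push Not at hb
    have hbK : b ∉ K q := by
      intro hbK
      have hpt : p ≠ t := fun h => hA'.2.2 (h ▸ hpA)
      have hpy : p ≠ y := by
        rintro rfl
        exact hKxy q hq hqt hqx b hbK hpb.symm
      have hpx : p ≠ x := fun h => hp (Or.inl h)
      exact hp (Or.inr (reachSet_closed hbK hpb.symm (by simp [hpt, hpy, hpx])))
    have hbA : b ∉ A := fun h => hbK ((hb.1 h) ▸ haK)
    refine ⟨reachSet_closed hpA hpb (by simpa using hbA), ?_⟩
    rintro (h | h)
    exacts [hb.2 h, hbK h]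

/-! ### Minimum separators with at least three vertices -/

variable [Fintype V]

theorem two_le_card (hG : IsTwoConnected G) {S : Finset V}
    (hS : IsSeparator G s t S) : 2 ≤ S.card := by
  have hS' := isSeparator_iff.1 hS
  by_contra hlt
  have : S.card = 0 ∨ S.card = 1 := by omega
  rcases this with h | h
  · obtain rfl := Finset.card_eq_zero.1 h
    have := reachSet_of_reachable_induce (T := Set.univ)
      (((SimpleGraph.induceUnivIso G).connected_iff.2 hG.connected).preconnected
        ⟨s, trivial⟩ ⟨t, trivial⟩)
    exact hS'.2.2 (by simpa using this)
  · obtain ⟨z, rfl⟩ := Finset.card_eq_one.1 h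
    have hsz : s ≠ z := by simpa using hS'.1
    have htz : t ≠ z := by simpa using hS'.2.1
    have := reachSet_of_reachable_induce ((hG.connected_delete z).preconnected ⟨s, hsz⟩ ⟨t, htz⟩)
    have hc : ({w | w ≠ z} : Set V)ᶜ = {z} := by
      ext
      simp
    rw [hc] at this
    exact hS'.2.2 (by simpa using this)

/-- Each component of `G - {s, t}` touches `s`, as `t` is not a cut vertex. -/
theorem component_touches (hG : IsTwoConnected G) (hst : s ≠ t) {p : V} (hps : p ≠ s)
    (hpt : p ≠ t) : Touches G.Adj (reachSet G.Adj {s, t} p) s := by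
  by_contra hn
  have h := reachSet_of_reachable_induce ((hG.connected_delete t).preconnected ⟨p, hpt⟩ ⟨s, hst⟩)
  have hc : ({w | w ≠ t} : Set V)ᶜ = {t} := by
    ext
    simp
  rw [hc] at h
  have : s ∈ reachSet G.Adj {s, t} p := reachSet_subset (self_mem_reachSet _ _ _)
    (fun a ha b hab hb => reachSet_closed ha hab (by
      rintro (rfl | h)
      exacts [hn ⟨a, ha, hab⟩, hb h])) h
  exact notMem_of_mem_reachSet (by simp [hps, hpt]) this (Or.inl rfl)

/-- Every component of `G - {s, t}` has a vertex that meets all paths from `s` to `t` through this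
component; `X` is the set of vertices reached from `s` before it. -/
def ComponentsCut (G : SimpleGraph V) (s t : V) : Prop :=
  ∀ p, p ≠ s → p ≠ t → ∃ x ∈ reachSet G.Adj {s, t} p, ∃ X : Set V,
    X ⊆ reachSet G.Adj {s, t} p \ {x} ∧
    (∀ b ∈ reachSet G.Adj {s, t} p, b ≠ x → G.Adj s b → b ∈ X) ∧
    (∀ a ∈ X, ∀ b ∈ reachSet G.Adj {s, t} p, b ≠ x → G.Adj a b → b ∈ X) ∧ ∀ a ∈ X, ¬ G.Adj a t

end Separators

section Separators

variable {V : Type u} [Fintype V] {G : SimpleGraph V} {s t : V}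

theorem IsTwoConnectedSeriesParallel.properties (hG : IsTwoConnectedSeriesParallel G) :
    TripodProperty G.Adj ∧ CutVertexProperty G.Adj ∧
      PairOrDisconnectedProperty G.Adj Set.univ := by
  obtain ⟨E, hE, hadj⟩ := hG.fromLoop
  have : G.Adj = fun a b => s(a, b) ∈ E := by
    ext a b
    exact hadj a b
  rw [this]
  exact hE.properties

theorem componentsCut (hG : IsTwoConnectedSeriesParallel G) (hst : s ≠ t) (hnst : ¬ G.Adj s t)
    (hpair : ∀ S : Finset V, IsSeparator G s t S → S.card ≠ 2) : ComponentsCut G s t := by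
  classical
  obtain ⟨-, hcut, hdis⟩ := hG.properties
  have hadj : ∀ a b, G.Adj a b → G.Adj b a := fun a b h => h.symm
  rcases hdis s trivial t trivial hst hnst with ⟨a, b, hsa, hsb, hta, htb, hsep⟩ |
    ⟨p₁, -, p₂, -, h1s, h1t, h2s, h2t, hsep⟩
  · have hS : IsSeparator G s t {a, b} := isSeparator_iff.2
      ⟨by simp [hsa, hsb], by simp [hta, htb], sepBy_iff.1 (by simpa using hsep)⟩
    have h1 := two_le_card hG.twoConnected hS
    have h2 : ({a, b} : Finset V).card ≤ 2 := Finset.card_le_two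
    exact absurd (le_antisymm h2 h1) (hpair _ hS)
  intro p hps hpt
  set C := reachSet G.Adj {s, t} p with hC
  have hpst : p ∉ ({s, t} : Set V) := by simp [hps, hpt]
  have hCst : ∀ c ∈ C, c ≠ s ∧ c ≠ t := fun c hc => by
    simpa using notMem_of_mem_reachSet hpst hc
  -- some component differs from that of `p`
  obtain ⟨q, hqs, hqt, hq⟩ : ∃ q, q ≠ s ∧ q ≠ t ∧ q ∉ C := by
    by_cases h1 : p₁ ∈ C
    · refine ⟨p₂, h2s, h2t, fun h2 => sepBy_iff.1 hsep ?_⟩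
      exact reachSet_trans (mem_reachSet_symm hpst h1) h2
    · exact ⟨p₁, h1s, h1t, h1⟩
  have hqst : q ∉ ({s, t} : Set V) := by simp [hqs, hqt]
  refine hcut s t C (reachSet G.Adj {s, t} q) hst (connIn_reachSet hadj)
    (fun h => (hCst _ h).1 rfl) (fun h => (hCst _ h).2 rfl) (Or.inr ⟨connIn_reachSet hadj, ?_, ?_,
      ?_, component_touches hG.twoConnected hst hqs hqt, ?_⟩)
  · exact fun h => notMem_of_mem_reachSet hqst h (Or.inl rfl)
  · exact fun h => notMem_of_mem_reachSet hqst h (Or.inr rfl)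
  · refine Set.disjoint_left.2 fun c hc hcq => hq ?_
    exact reachSet_trans hc (mem_reachSet_symm hqst hcq)
  · rw [Set.pair_comm]
    exact component_touches hG.twoConnected hst.symm hqt hqs

omit [Fintype V] in
/-- The tokens on a component of `G - {s, t}` may be replaced by one token on a vertex that cuts
this component. -/
theorem isSeparator_replace {S S' : Finset V} (hS : IsSeparator G s t S) {p x : V} (hps : p ≠ s)
    (hpt : p ≠ t) (hx : x ∈ reachSet G.Adj {s, t} p) {X : Set V}
    (h1 : X ⊆ reachSet G.Adj {s, t} p \ {x})
    (h2 : ∀ b ∈ reachSet G.Adj {s, t} p, b ≠ x → G.Adj s b → b ∈ X)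
    (h3 : ∀ a ∈ X, ∀ b ∈ reachSet G.Adj {s, t} p, b ≠ x → G.Adj a b → b ∈ X)
    (h4 : ∀ a ∈ X, ¬ G.Adj a t)
    (hS' : ∀ v, v ∈ S' ↔ (v ∈ S ∧ v ∉ reachSet G.Adj {s, t} p) ∨ v = x) :
    IsSeparator G s t S' := by
  have hS₀ := isSeparator_iff.1 hS
  have hCst : ∀ c ∈ reachSet G.Adj {s, t} p, c ≠ s ∧ c ≠ t := fun c hc => by
    simpa using notMem_of_mem_reachSet (by simp [hps, hpt]) hc
  refine IsSeparator.of_closed (X := X ∪ (reachSet G.Adj S s \ reachSet G.Adj {s, t} p)) ?_ ?_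
    (Or.inr ⟨self_mem_reachSet _ _ _, fun h => (hCst _ h).1 rfl⟩) ?_ ?_
  · rw [hS']
    rintro (h | h)
    exacts [hS₀.1 h.1, (hCst _ hx).1 h.symm]
  · rw [hS']
    rintro (h | h)
    exacts [hS₀.2.1 h.1, (hCst _ hx).2 h.symm]
  · rintro (h | h)
    exacts [(hCst _ (h1 h).1).2 rfl, hS₀.2.2 h.1]
  · intro a ha b hab hb
    rw [hS'] at hb
    push Not at hb
    by_cases hbt : b = t
    · subst hbt
      rcases ha with ha | ha
      · exact absurd hab (h4 a ha)
      · exact absurd (reachSet_closed ha.1 hab (by simpa using hS₀.2.1)) hS₀.2.2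
    by_cases hbC : b ∈ reachSet G.Adj {s, t} p
    · left
      rcases ha with ha | ⟨haS, haC⟩
      · exact h3 a ha b hbC hb.2 hab
      · by_cases has : a = s
        · exact h2 b hbC hb.2 (has ▸ hab)
        · have hat : a ≠ t := fun h => hS₀.2.2 (h ▸ haS)
          exact absurd (reachSet_closed hbC hab.symm (by simp [has, hat])) haC
    · by_cases hbs : b = s
      · exact Or.inr ⟨hbs ▸ self_mem_reachSet _ _ _, hbC⟩
      rcases ha with ha | ⟨haS, haC⟩
      · exact absurd (reachSet_closed (h1 ha).1 hab (by simp [hbs, hbt])) hbC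
      · exact Or.inr ⟨reachSet_closed haS hab fun h => hbC (hb.1 h), hbC⟩

theorem IsSeparator.meets_component (hG : IsTwoConnected G) (hst : s ≠ t) {A : Finset V}
    (hA : IsSeparator G s t A) {p : V} (hps : p ≠ s) (hpt : p ≠ t) :
    ∃ a ∈ A, a ∈ reachSet G.Adj {s, t} p := by
  by_contra! hn
  have hA' := isSeparator_iff.1 hA
  obtain ⟨a, ha, has⟩ := component_touches hG hst hps hpt
  obtain ⟨b, hb, hbt⟩ := component_touches hG hst.symm hpt hps
  rw [Set.pair_comm] at hb
  have hpst : p ∉ ({s, t} : Set V) := by simp [hps, hpt]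
  have haA : a ∈ reachSet G.Adj A s :=
    reachSet_closed (self_mem_reachSet _ _ _) has.symm fun h => hn a h ha
  have hsub : reachSet G.Adj {s, t} a ⊆ reachSet G.Adj {s, t} a ∩ reachSet G.Adj A s :=
    reachSet_subset ⟨self_mem_reachSet _ _ _, haA⟩ fun c hc d hcd hd => by
      have := reachSet_closed hc.1 hcd hd
      exact ⟨this, reachSet_closed hc.2 hcd fun h => hn d h (reachSet_trans ha this)⟩
  have hb' := hsub (reachSet_trans (mem_reachSet_symm hpst ha) hb)
  exact hA'.2.2 (reachSet_closed hb'.2 hbt (by simpa using hA'.2.1))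

omit [Fintype V] in
/-- A minimum separator has only one vertex in each component of `G - {s, t}`. -/
theorem IsMinimumSeparator.eq_of_mem_component (hcut : ComponentsCut G s t) {M : Finset V}
    (hM : IsMinimumSeparator G s t M) {p a b : V} (hps : p ≠ s) (hpt : p ≠ t) (ha : a ∈ M)
    (hb : b ∈ M) (haC : a ∈ reachSet G.Adj {s, t} p) (hbC : b ∈ reachSet G.Adj {s, t} p) :
    a = b := by
  classical
  by_contra hab
  obtain ⟨x, hx, X, h1, h2, h3, h4⟩ := hcut p hps hpt
  set S : Finset V := {v ∈ M | v ∉ reachSet G.Adj {s, t} p} with hS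
  have hsep : IsSeparator G s t (insert x S) :=
    isSeparator_replace hM.1 hps hpt hx h1 h2 h3 h4 fun v => by simp [hS, or_comm]
  have hsub : insert a (insert b S) ⊆ M := by
    intro v hv
    simp only [Finset.mem_insert, hS, Finset.mem_filter] at hv
    rcases hv with rfl | rfl | hv
    exacts [ha, hb, hv.1]
  have hcard := Finset.card_le_card hsub
  rw [Finset.card_insert_of_notMem (by simp [hab, hS, haC]),
    Finset.card_insert_of_notMem (by simp [hS, hbC])] at hcard
  have := hM.2 _ hsep
  have := Finset.card_insert_le x S
  omega

/-- If every component of `G - {s, t}` is cut by one vertex, a token can be moved to any uncovered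
vertex of a minimum separator from the same component. -/
theorem subset_of_noMove_of_componentsCut [DecidableEq V] (hG : IsTwoConnected G) (hst : s ≠ t)
    (hcut : ComponentsCut G s t) {M A : Finset V}
    (hM : IsMinimumSeparator G s t M) (hA : IsSeparator G s t A)
    (hno : NoMove G s t ((A \ M : Finset V) : Set V) ((M \ A : Finset V) : Set V) A) : M ⊆ A := by
  by_contra hMA
  obtain ⟨x, hxM, hxA⟩ := Finset.not_subset.1 hMA
  have hM' := isSeparator_iff.1 hM.1
  have hA' := isSeparator_iff.1 hA
  have hxs : x ≠ s := fun h => hM'.1 (h ▸ hxM)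
  have hxt : x ≠ t := fun h => hM'.2.1 (h ▸ hxM)
  obtain ⟨a, haA, haC⟩ := hA.meets_component hG hst hxs hxt
  have hone : ∀ b ∈ M, b ∈ reachSet G.Adj {s, t} x → b = x := fun b hb hbC =>
    hM.eq_of_mem_component hcut hxs hxt hb hxM hbC (self_mem_reachSet _ _ _)
  have haM : a ∉ M := fun h => hxA (hone a h haC ▸ haA)
  set C := reachSet G.Adj {s, t} x with hC
  have hCst : ∀ c ∈ C, c ≠ s ∧ c ≠ t := fun c hc => by
    simpa using notMem_of_mem_reachSet (by simp [hxs, hxt]) hc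
  refine hno a (by simp [haA, haM]) x (by simp [hxM, hxA]) ?_
  -- in the component of `x` the paths are cut by `M`, and in the others by `A`
  refine IsSeparator.of_closed (X := (reachSet G.Adj M s ∩ C) ∪ (reachSet G.Adj A s \ C)) ?_ ?_
    (Or.inr ⟨self_mem_reachSet _ _ _, fun h => (hCst _ h).1 rfl⟩) ?_ ?_
  · rw [mem_moveToken]
    rintro (h | h)
    exacts [hA'.1 h.1, hxs h.symm]
  · rw [mem_moveToken]
    rintro (h | h)
    exacts [hA'.2.1 h.1, hxt h.symm]
  · rintro (h | h)
    exacts [hM'.2.2 h.1, hA'.2.2 h.1]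
  · intro p hp q hpq hq
    rw [mem_moveToken] at hq
    push Not at hq
    have hpt : p ≠ t := by
      rintro rfl
      rcases hp with h | h
      exacts [hM'.2.2 h.1, hA'.2.2 h.1]
    by_cases hqC : q ∈ C
    · have hqM : q ∉ M := fun h => hq.2 (hone q h hqC)
      left
      refine ⟨?_, hqC⟩
      rcases hp with hp | hp
      · exact reachSet_closed hp.1 hpq (by simpa using hqM)
      · have hps : p = s := by
          by_contra hps
          exact hp.2 (reachSet_closed hqC hpq.symm (by simp [hps, hpt]))
        subst hps
        exact reachSet_closed (self_mem_reachSet _ _ _) hpq (by simpa using hqM)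
    · by_cases hqs : q = s
      · exact Or.inr ⟨hqs ▸ self_mem_reachSet _ _ _, hqC⟩
      by_cases hqt : q = t
      · subst hqt
        rcases hp with hp | hp
        · exact absurd (reachSet_closed hp.1 hpq (by simpa using hM'.2.1)) hM'.2.2
        · exact absurd (reachSet_closed hp.1 hpq (by simpa using hA'.2.1)) hA'.2.2
      rcases hp with hp | hp
      · exact absurd (reachSet_closed hp.2 hpq (by simp [hqs, hqt])) hqC
      · refine Or.inr ⟨reachSet_closed hp.1 hpq fun hqA => ?_, hqC⟩
        have : q = a := hq.1 hqA
        exact hqC (this ▸ haC)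

/-- A separator with at most one vertex in each component of `G - {s, t}` is a minimum one, since
every separator meets all components. -/
theorem isMinimumSeparator_of_components (hG : IsTwoConnected G) (hst : s ≠ t) {D : Finset V}
    (hD : IsSeparator G s t D)
    (hone : ∀ p, p ≠ s → p ≠ t → ∀ a ∈ D, ∀ b ∈ D, a ∈ reachSet G.Adj {s, t} p →
      b ∈ reachSet G.Adj {s, t} p → a = b) : IsMinimumSeparator G s t D := by
  refine ⟨hD, fun A hA => ?_⟩
  have hD' := isSeparator_iff.1 hD
  have hDst : ∀ d ∈ D, d ≠ s ∧ d ≠ t := fun d hd =>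
    ⟨fun h => hD'.1 (h ▸ hd), fun h => hD'.2.1 (h ▸ hd)⟩
  have : ∀ d : V, ∃ a, d ∈ D → a ∈ A ∧ a ∈ reachSet G.Adj {s, t} d := fun d => by
    by_cases hd : d ∈ D
    · obtain ⟨a, ha⟩ := hA.meets_component hG hst (hDst d hd).1 (hDst d hd).2
      exact ⟨a, fun _ => ha⟩
    · exact ⟨d, fun h => absurd h hd⟩
  choose f hf using this
  refine Finset.card_le_card_of_injOn f (fun d hd => (hf d hd).1) ?_
  intro d hd e he hde
  have h1 := (hf d hd).2
  have h2 := (hf e he).2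
  rw [← hde] at h2
  refine hone d (hDst d hd).1 (hDst d hd).2 d hd e he (self_mem_reachSet _ _ _) ?_
  exact reachSet_trans h1 (mem_reachSet_symm (by simpa using hDst e he) h2)

/-! ### Descent along a chain of minimum separators -/

variable [DecidableEq V]

/-- What the argument for the theorem uses about the graph: if no token of a separator `A` can be
moved to a minimum separator `M`, then `A` contains `M`, or it avoids `M` and one of the sides of
`M`; and in the latter case `M` can be moved one step in the direction of `A`. -/
structure Descent (G : SimpleGraph V) (s t : V) : Prop where
  nested : ∀ {M A : Finset V}, IsMinimumSeparator G s t M → IsSeparator G s t A →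
    NoMove G s t ((A \ M : Finset V) : Set V) ((M \ A : Finset V) : Set V) A →
    M ⊆ A ∨ (∀ a ∈ A, a ∉ M ∧ a ∉ reachSet G.Adj M s) ∨
      (∀ a ∈ A, a ∉ M ∧ a ∉ reachSet G.Adj M t)
  toTarget : ∀ {M A : Finset V}, IsMinimumSeparator G s t M → IsSeparator G s t A →
    NoMove G s t ((A \ M : Finset V) : Set V) ((M \ A : Finset V) : Set V) A →
    NoMove G s t M (reachSet G.Adj M t) M → ¬ ∀ a ∈ A, a ∉ M ∧ a ∉ reachSet G.Adj M s
  toSource : ∀ {M A : Finset V}, IsMinimumSeparator G s t M → IsSeparator G s t A →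
    NoMove G s t ((A \ M : Finset V) : Set V) ((M \ A : Finset V) : Set V) A →
    NoMove G s t M (reachSet G.Adj M s) M → ¬ ∀ a ∈ A, a ∉ M ∧ a ∉ reachSet G.Adj M t

theorem descent (hG : IsTwoConnectedSeriesParallel G) (hst : s ≠ t) (hnst : ¬ G.Adj s t) :
    Descent G s t := by
  by_cases hpair : ∃ S : Finset V, IsSeparator G s t S ∧ S.card = 2
  · obtain ⟨S, hS, hS2⟩ := hpair
    have hM2 : ∀ {M : Finset V}, IsMinimumSeparator G s t M → M.card = 2 := fun hM =>
      le_antisymm (hS2 ▸ hM.2 S hS) (two_le_card hG.twoConnected hM.1)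
    refine ⟨fun hM hA hno => ?_, fun hM hA hno hstuck hb => ?_, fun hM hA hno hstuck hb => ?_⟩
    · exact or_iff_not_imp_left.2 (nested_of_noMove hM (hM2 hM) hA hno)
    · exact exists_advance hG.properties.1 hM (hM2 hM) hA hno hb hstuck
    · exact exists_advance hG.properties.1 hM.symm (hM2 hM) hA.symm hno.symm hb hstuck.symm
  · have hcut := componentsCut hG hst hnst fun S hS h2 => hpair ⟨S, hS, h2⟩
    have key : ∀ {M A : Finset V}, IsMinimumSeparator G s t M → IsSeparator G s t A →
        NoMove G s t ((A \ M : Finset V) : Set V) ((M \ A : Finset V) : Set V) A →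
        M ⊆ A ∧ ∃ x, x ∈ M := fun hM hA hno => by
      refine ⟨subset_of_noMove_of_componentsCut hG.twoConnected hst hcut hM hA hno, ?_⟩
      have := two_le_card hG.twoConnected hM.1
      exact Finset.card_pos.1 (by omega)
    refine ⟨fun hM hA hno => Or.inl (key hM hA hno).1, fun hM hA hno _ hb => ?_,
      fun hM hA hno _ hb => ?_⟩
    all_goals
      obtain ⟨h, x, hx⟩ := key hM hA hno
      exact (hb x (h hx)).1 hx

end Separators

/-! ### The algorithm on sets of vertices -/

section Algorithm

variable {V : Type u} [Fintype V]

open Classical in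
/-- `reachSet` as a finite set of vertices. -/
noncomputable def reachFin (G : SimpleGraph V) (S : Finset V) (a : V) : Finset V :=
  {b | b ∈ reachSet G.Adj S a}

theorem coe_reachFin (G : SimpleGraph V) (S : Finset V) (a : V) :
    (reachFin G S a : Set V) = reachSet G.Adj S a := by
  ext
  simp [reachFin]

variable [DecidableEq V]

open Classical in
/-- Moves a token of `A` from a vertex of `P` to a vertex of `Q` such that the result is a
separator, if possible, and returns `A` otherwise. All vertices are tried in the order `vs`. -/
noncomputable def jump (G : SimpleGraph V) (s t : V) (vs : List V) (P Q A : Finset V) : Finset V :=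
  vs.foldl (fun acc a => vs.foldl (fun acc v =>
    if a ∈ P ∧ v ∈ Q ∧ IsSeparator G s t (moveToken A a v) then moveToken A a v else acc) acc) A

/-- A nonempty list of sets, with its head as first component. -/
abbrev Trail (V : Type u) := Finset V × List (Finset V)

/-- The list of the members of a trail. -/
def Trail.toList (T : Trail V) : List (Finset V) := T.1 :: T.2

/-- Extends a trail by the image of its head under `f`, unless this image is part of the head. -/
def extend (f : Finset V → Finset V) (T : Trail V) : Trail V :=
  if f T.1 \ T.1 = ∅ then T else (f T.1, T.1 :: T.2)

/-- Extends a trail as many times as there are elements in `vs`. -/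
def extendAll (vs : List V) (f : Finset V → Finset V) (T : Trail V) : Trail V :=
  vs.foldl (fun T _ => extend f T) T

/-- Moves tokens of the head of the trail `T` to `M` as long as possible. -/
noncomputable def greedyRun (G : SimpleGraph V) (s t : V) (vs : List V) (M : Finset V)
    (T : Trail V) : Trail V :=
  extendAll vs (fun A => jump G s t vs (A \ M) (M \ A) A) T

/-- Moves vertices of the separator `M` towards `r` as long as possible. -/
noncomputable def advanceRun (G : SimpleGraph V) (s t : V) (vs : List V) (r : V)
    (M : Finset V) : Trail V :=
  extendAll vs (fun M => jump G s t vs M (reachFin G M r) M) (M, [])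

open Classical in
/-- A separator with at most one vertex in each component of `G - {s, t}`, if each of these
components is cut by one vertex. -/
noncomputable def componentwise (G : SimpleGraph V) (s t : V) (vs : List V) : Finset V :=
  vs.foldl (fun S v =>
    if IsSeparator G s t ((S \ reachFin G ({s} ∪ {t}) v) ∪ {v})
    then (S \ reachFin G ({s} ∪ {t}) v) ∪ {v} else S) (Finset.univ \ ({s} ∪ {t}))

open Classical in
/-- A minimum separator: one with two vertices, if there is any. -/
noncomputable def someMinimum (G : SimpleGraph V) (s t : V) (vs : List V) : Finset V :=
  vs.foldl (fun acc x => vs.foldl (fun acc y =>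
    if IsSeparator G s t ({x} ∪ {y}) then {x} ∪ {y} else acc) acc) (componentwise G s t vs)

/-- The minimum separator that all sequences pass: one that cannot be moved towards `s`. -/
noncomputable def baseSeparator (G : SimpleGraph V) (s t : V) (vs : List V) : Finset V :=
  (advanceRun G s t vs s (someMinimum G s t vs)).1

/-- Moves `A` to a separator that contains `baseSeparator`: greedily to the members of a chain of
minimum separators that leads from the side of `t` to `baseSeparator`. -/
noncomputable def normalize (G : SimpleGraph V) (s t : V) (vs : List V) (A : Finset V) : Trail V :=
  (advanceRun G s t vs t (baseSeparator G s t vs)).toList.foldl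
    (fun T M => greedyRun G s t vs M T) (A, [])

/-- The sequence from `A` to `B`: both are moved to separators containing `baseSeparator`, and then
the other tokens are moved. -/
noncomputable def reconfigure (G : SimpleGraph V) (s t : V) (vs : List V) (A B : Finset V) :
    List (Finset V) :=
  (greedyRun G s t vs (normalize G s t vs B).1 (normalize G s t vs A)).toList.reverse ++
    (normalize G s t vs B).2

/-! ### Correctness of the algorithm -/

variable {G : SimpleGraph V} {s t : V} {vs : List V}

/-- If each step of a fold either changes nothing, because its element has the property `N`, or
leads to a state with property `Y`, then so does the whole fold. -/
theorem foldl_eq_or {α β : Type*} {step : β → α → β} {N : α → Prop} {Y : β → Prop}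
    (h : ∀ b x, (step b x = b ∧ N x) ∨ Y (step b x)) (l : List α) (d : β) :
    (l.foldl step d = d ∧ ∀ x ∈ l, N x) ∨ Y (l.foldl step d) := by
  induction l generalizing d with
  | nil => simp
  | cons x l ih =>
    rw [List.foldl_cons]
    rcases ih (step d x) with ⟨h1, h2⟩ | h1
    · rcases h d x with ⟨h3, h4⟩ | h3
      · exact Or.inl ⟨h1.trans h3, by simpa [h4] using h2⟩
      · exact Or.inr (h1.symm ▸ h3)
    · exact Or.inr h1

omit [Fintype V] in
theorem jump_spec (hvs : ∀ v, v ∈ vs) (P Q A : Finset V) :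
    (jump G s t vs P Q A = A ∧ NoMove G s t P Q A) ∨
      ∃ a ∈ P, ∃ v ∈ Q, IsSeparator G s t (moveToken A a v) ∧
        jump G s t vs P Q A = moveToken A a v := by
  classical
  rcases foldl_eq_or
    (N := fun a => ∀ v ∈ vs, ¬ (a ∈ P ∧ v ∈ Q ∧ IsSeparator G s t (moveToken A a v)))
    (Y := fun B => ∃ a ∈ P, ∃ v ∈ Q, IsSeparator G s t (moveToken A a v) ∧ B = moveToken A a v)
    (step := fun acc a => vs.foldl (fun acc v =>
      if a ∈ P ∧ v ∈ Q ∧ IsSeparator G s t (moveToken A a v) then moveToken A a v else acc) acc)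
    (fun b a => foldl_eq_or
      (N := fun v => ¬ (a ∈ P ∧ v ∈ Q ∧ IsSeparator G s t (moveToken A a v)))
      (Y := fun B => ∃ a ∈ P, ∃ v ∈ Q, IsSeparator G s t (moveToken A a v) ∧ B = moveToken A a v)
      (step := fun acc v =>
        if a ∈ P ∧ v ∈ Q ∧ IsSeparator G s t (moveToken A a v) then moveToken A a v else acc)
      (fun b v => by
        by_cases h : a ∈ P ∧ v ∈ Q ∧ IsSeparator G s t (moveToken A a v)
        · exact Or.inr ⟨a, h.1, v, h.2.1, h.2.2, if_pos h⟩
        · exact Or.inl ⟨if_neg h, h⟩) vs b) vs A with ⟨h1, h2⟩ | h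
  · exact Or.inl ⟨h1, fun a ha v hv hsep => h2 a (hvs a) v (hvs v) ⟨ha, hv, hsep⟩⟩
  · exact Or.inr h

omit [Fintype V] in
/-- Extending a trail reaches a set that cannot be extended further, provided each extension
increases a quantity bounded by the number of rounds. -/
theorem extendAll_spec {f : Finset V → Finset V} {Inv : Trail V → Prop} {μ : Finset V → ℕ}
    (hstep : ∀ T, Inv T → ¬ f T.1 ⊆ T.1 → Inv (f T.1, T.1 :: T.2) ∧ μ T.1 < μ (f T.1))
    (hμ : ∀ T, Inv T → μ T.1 ≤ vs.length) {T : Trail V} (hT : Inv T) :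
    Inv (extendAll vs f T) ∧ f (extendAll vs f T).1 ⊆ (extendAll vs f T).1 := by
  have key : ∀ (l : List V) (T : Trail V), Inv T →
      Inv (extendAll l f T) ∧ (f (extendAll l f T).1 ⊆ (extendAll l f T).1 ∨
        μ T.1 + l.length ≤ μ (extendAll l f T).1) := by
    intro l
    induction l with
    | nil => exact fun T hT => ⟨hT, Or.inr le_rfl⟩
    | cons x l ih =>
      intro T hT
      have hcons : extendAll (x :: l) f T = extendAll l f (extend f T) := rfl
      by_cases hsub : f T.1 ⊆ T.1
      · have hext : extend f T = T := by
          rw [extend, if_pos (Finset.sdiff_eq_empty_iff_subset.2 hsub)]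
        have hall : ∀ l : List V, extendAll l f T = T := fun l => by
          induction l with
          | nil => rfl
          | cons y l ih => exact (congrArg (extendAll l f) hext).trans ih
        rw [hall]
        exact ⟨hT, Or.inl hsub⟩
      · have hext : extend f T = (f T.1, T.1 :: T.2) := by
          rw [extend, if_neg fun h => hsub (Finset.sdiff_eq_empty_iff_subset.1 h)]
        obtain ⟨h1, h2⟩ := hstep T hT hsub
        obtain ⟨h3, h4⟩ := ih _ h1
        rw [hcons, hext]
        refine ⟨h3, h4.imp id fun h4 => ?_⟩
        simp only [List.length_cons] at h4 ⊢
        omega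
  obtain ⟨h1, h2⟩ := key vs T hT
  refine ⟨h1, ?_⟩
  by_contra hsub
  obtain ⟨h3, h4⟩ := hstep _ h1 hsub
  have h5 := hμ _ h3
  have h6 := h2.resolve_left hsub
  simp only at h5
  omega

omit [Fintype V] in
theorem card_le_length (hvs : ∀ v, v ∈ vs) (S : Finset V) : S.card ≤ vs.length := by
  have : S ⊆ vs.toFinset := fun v _ => by simpa using hvs v
  exact (Finset.card_le_card this).trans (List.toFinset_card_le vs)

omit [Fintype V] in
theorem IsTJSequence.cons {A B C : Finset V} {l : List (Finset V)}
    (h : IsTJSequence G s t A B (A :: l)) (hC : IsSeparator G s t C) (hCA : TJAdj C A) :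
    IsTJSequence G s t C B (C :: A :: l) where
  isSeparator S hS := by
    rcases List.mem_cons.1 hS with rfl | hS
    exacts [hC, h.isSeparator S hS]
  chain := List.isChain_cons_cons.2 ⟨hCA, h.chain⟩
  head := rfl
  last := by
    rw [List.getLast?_cons_cons]
    exact h.last

omit [Fintype V] in
theorem IsTJSequence.singleton {A : Finset V} (hA : IsSeparator G s t A) :
    IsTJSequence G s t A A [A] where
  isSeparator S hS := by
    rw [List.mem_singleton.1 hS]
    exact hA
  chain := List.isChain_singleton A
  head := rfl
  last := rfl

omit [Fintype V] in
theorem IsTJSequence.reverse {A B : Finset V} {L : List (Finset V)}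
    (h : IsTJSequence G s t A B L) : IsTJSequence G s t B A L.reverse where
  isSeparator S hS := h.isSeparator S (List.mem_reverse.1 hS)
  chain := List.isChain_reverse.2 (h.chain.imp fun _ _ h => h.symm)
  head := by rw [List.head?_reverse, h.last]
  last := by rw [List.getLast?_reverse, h.head]

omit [Fintype V] in
theorem IsTJSequence.append {A B C : Finset V} {L l : List (Finset V)}
    (h : IsTJSequence G s t A B L) (h' : IsTJSequence G s t B C (B :: l)) :
    IsTJSequence G s t A C (L ++ l) where
  isSeparator S hS := (List.mem_append.1 hS).elim (h.isSeparator S) fun hS =>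
    h'.isSeparator S (List.mem_cons_of_mem _ hS)
  chain := by
    refine List.isChain_append.2 ⟨h.chain, (List.isChain_cons.1 h'.chain).2, ?_⟩
    intro x hx y hy
    rw [h.last, Option.mem_some_iff] at hx
    exact hx ▸ (List.isChain_cons.1 h'.chain).1 y hy
  head := by
    rw [List.head?_append, h.head]
    rfl
  last := by
    have := h'.last
    cases l with
    | nil => simpa [h.last] using this
    | cons x l =>
      rw [List.getLast?_cons_cons] at this
      rw [List.getLast?_append, this]
      rfl

omit [Fintype V] in
/-- The properties of a greedy run towards `M`. -/
theorem greedyRun_spec (hvs : ∀ v, v ∈ vs) {M A₀ : Finset V}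
    {T : Trail V} (hT : IsTJSequence G s t T.1 A₀ T.toList) :
    IsTJSequence G s t (greedyRun G s t vs M T).1 A₀ (greedyRun G s t vs M T).toList ∧
    (greedyRun G s t vs M T).1.card = T.1.card ∧
    T.toList ⊆ (greedyRun G s t vs M T).toList ∧
    T.1 ∩ M ⊆ (greedyRun G s t vs M T).1 ∧
    ((greedyRun G s t vs M T).1 = T.1 ∨ ∃ v ∈ M, v ∈ (greedyRun G s t vs M T).1) ∧
    NoMove G s t (((greedyRun G s t vs M T).1 \ M : Finset V) : Set V)
      ((M \ (greedyRun G s t vs M T).1 : Finset V) : Set V) (greedyRun G s t vs M T).1 := by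
  have hstep : ∀ A : Finset V, ¬ jump G s t vs (A \ M) (M \ A) A ⊆ A →
      ∃ a ∈ A, a ∉ M ∧ ∃ v ∈ M, v ∉ A ∧ IsSeparator G s t (moveToken A a v) ∧
        jump G s t vs (A \ M) (M \ A) A = moveToken A a v := fun A hA => by
    rcases jump_spec (G := G) (s := s) (t := t) hvs (A \ M) (M \ A) A with ⟨h, -⟩ |
      ⟨a, ha, v, hv, h1, h2⟩
    · exact absurd h.le hA
    · rw [Finset.mem_sdiff] at ha hv
      exact ⟨a, ha.1, ha.2, v, hv.1, hv.2, h1, h2⟩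
  obtain ⟨⟨h1, h2, h3, h4, h5⟩, h6⟩ := extendAll_spec (vs := vs)
    (f := fun A => jump G s t vs (A \ M) (M \ A) A) (μ := fun A => (A ∩ M).card)
    (Inv := fun T' => IsTJSequence G s t T'.1 A₀ T'.toList ∧ T'.1.card = T.1.card ∧
      T.toList ⊆ T'.toList ∧ T.1 ∩ M ⊆ T'.1 ∧ (T'.1 = T.1 ∨ ∃ v ∈ M, v ∈ T'.1))
    (by
      rintro T' ⟨h1, h2, h3, h4, h5⟩ hsub
      obtain ⟨a, ha, haM, v, hv, hvA, hsep, heq⟩ := hstep T'.1 hsub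
      simp only [heq]
      refine ⟨⟨h1.cons hsep (tjAdj_moveToken ha hvA).symm, ?_, ?_, ?_, ?_⟩, ?_⟩
      · rw [card_moveToken ha hvA, h2]
      · exact fun S hS => List.mem_cons_of_mem _ (h3 hS)
      · intro p hp
        have hpa : p ≠ a := fun h => haM (h ▸ (Finset.mem_inter.1 hp).2)
        exact mem_moveToken.2 (Or.inl ⟨h4 hp, hpa⟩)
      · exact Or.inr ⟨v, hv, mem_moveToken.2 (Or.inr rfl)⟩
      · refine Finset.card_lt_card (Finset.ssubset_iff_of_subset ?_ |>.2 ⟨v, ?_, ?_⟩)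
        · intro p hp
          rw [Finset.mem_inter] at hp ⊢
          exact ⟨mem_moveToken.2 (Or.inl ⟨hp.1, fun h => haM (h ▸ hp.2)⟩), hp.2⟩
        · exact Finset.mem_inter.2 ⟨mem_moveToken.2 (Or.inr rfl), hv⟩
        · exact fun h => hvA (Finset.mem_inter.1 h).1)
    (fun T' _ => card_le_length hvs _)
    (T := T) ⟨hT, rfl, fun _ h => h, Finset.inter_subset_left, Or.inl rfl⟩
  refine ⟨h1, h2, h3, h4, h5, ?_⟩
  set A := (greedyRun G s t vs M T).1
  rcases jump_spec (G := G) (s := s) (t := t) hvs (A \ M) (M \ A) A with ⟨-, h⟩ |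
    ⟨a, ha, v, hv, h7, h8⟩
  · exact h
  · have h6' : jump G s t vs (A \ M) (M \ A) A ⊆ A := h6
    rw [h8] at h6'
    exact absurd (h6' (mem_moveToken.2 (Or.inr rfl))) (Finset.mem_sdiff.1 hv).2

omit [Fintype V] in
theorem IsMinimumSeparator.moveToken {M : Finset V} (hM : IsMinimumSeparator G s t M) {a v : V}
    (ha : a ∈ M) (hv : v ∉ M) (hsep : IsSeparator G s t (moveToken M a v)) :
    IsMinimumSeparator G s t (moveToken M a v) :=
  ⟨hsep, fun S hS => card_moveToken ha hv ▸ hM.2 S hS⟩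

omit [Fintype V] in
/-- Moving a vertex of a minimum separator towards `s` shrinks the side of `s`. -/
theorem reachSet_moveToken_ssubset {M : Finset V} (hM : IsMinimumSeparator G s t M) {a z : V}
    (ha : a ∈ M) (hz : z ∈ reachSet G.Adj M s) (hsep : IsSeparator G s t (moveToken M a z)) :
    reachSet G.Adj (moveToken M a z) s ⊂ reachSet G.Adj M s := by
  have hM' := isSeparator_iff.1 hM.1
  have hzM := hM.1.notMem_of_mem_reachSet hz
  have haz : a ≠ z := fun h => hzM (h ▸ ha)
  set N := SepReconf.moveToken M a z with hN
  have htN : reachSet G.Adj M t ⊆ reachSet G.Adj N t ∩ reachSet G.Adj M t := by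
    refine reachSet_subset ⟨self_mem_reachSet _ _ _, self_mem_reachSet _ _ _⟩ ?_
    rintro p ⟨hp1, hp2⟩ q hpq hq
    have h := reachSet_closed hp2 hpq hq
    refine ⟨reachSet_closed hp1 hpq fun hqN => ?_, h⟩
    rcases mem_moveToken.1 hqN with h' | rfl
    exacts [hq h'.1, hM.1.disjoint_reachSet hz h]
  have haN : a ∉ reachSet G.Adj N s := fun h => by
    obtain ⟨p, hp, hpa⟩ := hM.symm.touches ha
    refine hsep.disjoint_reachSet h (reachSet_closed (htN hp).1 hpa fun h => ?_)
    rcases mem_moveToken.1 h with h' | h'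
    exacts [h'.2 rfl, haz h']
  have hsub : reachSet G.Adj N s ⊆ reachSet G.Adj N s ∩ reachSet G.Adj M s := by
    refine reachSet_subset ⟨self_mem_reachSet _ _ _, self_mem_reachSet _ _ _⟩ ?_
    rintro p ⟨hp1, hp2⟩ q hpq hq
    have h := reachSet_closed hp1 hpq hq
    refine ⟨h, reachSet_closed hp2 hpq fun hqM => hq ?_⟩
    exact mem_moveToken.2 (Or.inl ⟨hqM, fun h' => haN (h' ▸ h)⟩)
  refine ⟨fun p hp => (hsub hp).2, fun h => ?_⟩
  exact hsep.notMem_of_mem_reachSet (h hz) (mem_moveToken.2 (Or.inr rfl))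

/-- The properties of the chain of minimum separators obtained by advancing `M` towards `r`. -/
theorem advanceRun_spec (hvs : ∀ v, v ∈ vs) {r : V} (hr : r = s ∨ r = t)
    {M : Finset V} (hM : IsMinimumSeparator G s t M) (hMne : 2 ≤ M.card) :
    (∀ N ∈ (advanceRun G s t vs r M).toList, IsMinimumSeparator G s t N) ∧
    (advanceRun G s t vs r M).toList.IsChain (fun N N' => ∃ v ∈ N, v ∈ N') ∧
    (advanceRun G s t vs r M).toList.getLast? = some M ∧
    NoMove G s t (advanceRun G s t vs r M).1 (reachSet G.Adj (advanceRun G s t vs r M).1 r)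
      (advanceRun G s t vs r M).1 := by
  have hnotMem : ∀ {N : Finset V}, IsMinimumSeparator G s t N → ∀ z ∈ reachSet G.Adj N r,
      z ∉ N := fun hN z hz => by
    rcases hr with rfl | rfl
    exacts [hN.1.notMem_of_mem_reachSet hz, hN.1.symm.notMem_of_mem_reachSet hz]
  obtain ⟨⟨h1, h2, h3, h4⟩, h5⟩ := extendAll_spec (vs := vs)
    (f := fun N => jump G s t vs N (reachFin G N r) N)
    (μ := fun N => vs.length - (reachFin G N r).card)
    (Inv := fun T => (∀ N ∈ T.toList, IsMinimumSeparator G s t N) ∧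
      T.toList.IsChain (fun N N' => ∃ v ∈ N, v ∈ N') ∧ T.toList.getLast? = some M ∧ 2 ≤ T.1.card)
    (by
      rintro T ⟨h1, h2, h3, h4⟩ hsub
      have hT : IsMinimumSeparator G s t T.1 := h1 _ List.mem_cons_self
      rcases jump_spec (G := G) (s := s) (t := t) hvs T.1 (reachFin G T.1 r) T.1 with ⟨h, -⟩ |
        ⟨a, ha, z, hz, hsep, heq⟩
      · exact absurd h.le hsub
      rw [← Finset.mem_coe, coe_reachFin] at hz
      have hzT := hnotMem hT z hz
      simp only [heq]
      refine ⟨⟨?_, ?_, ?_, ?_⟩, ?_⟩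
      · intro N hN
        rcases List.mem_cons.1 hN with rfl | hN
        exacts [hT.moveToken ha hzT hsep, h1 N hN]
      · refine List.isChain_cons_cons.2 ⟨?_, h2⟩
        obtain ⟨b, hb, hba⟩ := Finset.exists_mem_ne (show 1 < T.1.card by omega) a
        exact ⟨b, mem_moveToken.2 (Or.inl ⟨hb, hba⟩), hb⟩
      · exact (List.getLast?_cons_cons).trans h3
      · simpa [card_moveToken ha hzT] using h4
      · have hss : reachFin G (moveToken T.1 a z) r ⊂ reachFin G T.1 r := by
          rw [← Finset.coe_ssubset, coe_reachFin, coe_reachFin]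
          rcases hr with rfl | rfl
          · exact reachSet_moveToken_ssubset hT ha hz hsep
          · exact reachSet_moveToken_ssubset hT.symm ha hz hsep.symm
        have h6 := Finset.card_lt_card hss
        have h7 := card_le_length hvs (reachFin G T.1 r)
        omega)
    (fun _ _ => Nat.sub_le _ _)
    (T := (M, []))
    ⟨fun N hN => by
      rw [List.mem_singleton.1 hN]
      exact hM, List.isChain_singleton M, rfl, hMne⟩
  refine ⟨h1, h2, h3, ?_⟩
  have hT : IsMinimumSeparator G s t (advanceRun G s t vs r M).1 := h1 _ List.mem_cons_self
  set N := (advanceRun G s t vs r M).1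
  rcases jump_spec (G := G) (s := s) (t := t) hvs N (reachFin G N r) N with ⟨-, h⟩ |
    ⟨a, ha, z, hz, hsep, heq⟩
  · rwa [coe_reachFin] at h
  · have h5' : jump G s t vs N (reachFin G N r) N ⊆ N := h5
    rw [heq] at h5'
    rw [← Finset.mem_coe, coe_reachFin] at hz
    exact absurd (h5' (mem_moveToken.2 (Or.inr rfl))) (hnotMem hT z hz)

omit [Fintype V] in
/-- Along a chain of minimum separators with common vertices, greedy runs keep the following
alternative: the head of the trail contains the current member of the chain or avoids this member
together with its side of `t`. -/
theorem foldl_greedyRun_spec (hvs : ∀ v, v ∈ vs) (hd : Descent G s t) {A₀ : Finset V}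
    (l : List (Finset V)) : ∀ (M : Finset V) (T : Trail V),
    (∀ N ∈ M :: l, IsMinimumSeparator G s t N) →
    (M :: l).IsChain (fun N N' => ∃ v ∈ N, v ∈ N') →
    IsTJSequence G s t T.1 A₀ T.toList →
    NoMove G s t ((T.1 \ M : Finset V) : Set V) ((M \ T.1 : Finset V) : Set V) T.1 →
    (M ⊆ T.1 ∨ ∀ a ∈ T.1, a ∉ M ∧ a ∉ reachSet G.Adj M t) →
    ∀ N, (M :: l).getLast? = some N → ∀ T', T' = l.foldl (fun T M => greedyRun G s t vs M T) T →
      IsTJSequence G s t T'.1 A₀ T'.toList ∧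
      NoMove G s t ((T'.1 \ N : Finset V) : Set V) ((N \ T'.1 : Finset V) : Set V) T'.1 ∧
      (N ⊆ T'.1 ∨ ∀ a ∈ T'.1, a ∉ N ∧ a ∉ reachSet G.Adj N t) ∧ T'.1.card = T.1.card := by
  induction l with
  | nil =>
    rintro M T hmin - hT hno hor N hN T' rfl
    obtain rfl : M = N := by simpa using hN
    exact ⟨hT, hno, hor, rfl⟩
  | cons M' l ih =>
    rintro M T hmin hchain hT hno hor N hN T' rfl
    rw [List.isChain_cons_cons] at hchain
    obtain ⟨⟨v, hvM, hvM'⟩, hchain⟩ := hchain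
    have hM := hmin M List.mem_cons_self
    have hM' := hmin M' (List.mem_cons_of_mem _ List.mem_cons_self)
    obtain ⟨h1, h2, -, h4, h5, h6⟩ := greedyRun_spec hvs (M := M') hT
    have hsep := h1.isSeparator _ List.mem_cons_self
    rw [List.getLast?_cons_cons] at hN
    rw [List.foldl_cons]
    have := ih M' (greedyRun G s t vs M' T) (fun N hN => hmin N (List.mem_cons_of_mem _ hN)) hchain
      h1 h6 ?_ N hN _ rfl
    · exact ⟨this.1, this.2.1, this.2.2.1, this.2.2.2.trans h2⟩
    rcases hd.nested hM' hsep h6 with h | h | h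
    · exact Or.inl h
    · -- the head would lie strictly beyond `M'`, while it meets `M'` or lies strictly before `M`
      exfalso
      rcases h5 with h5 | ⟨w, hw, hw'⟩
      · rcases hor with hor | hor
        · exact (h v (h4 (Finset.mem_inter.2 ⟨hor hvM, hvM'⟩))).1 hvM'
        · rw [h5] at h hsep
          exact not_beyond_and_before hM' hM hsep hvM' hvM h hor
      · exact (h w hw').1 hw
    · exact Or.inr h

/-- The set `componentwise` is a minimum separator. When the cut vertex of a component is treated,
it replaces all vertices of this component; afterwards the component keeps a single vertex. -/
theorem componentwise_spec (hvs : ∀ v, v ∈ vs) (hG : IsTwoConnected G) (hst : s ≠ t)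
    (hnst : ¬ G.Adj s t) (hcut : ComponentsCut G s t) :
    IsMinimumSeparator G s t (componentwise G s t vs) := by
  classical
  have hcoe : ∀ v, (reachFin G ({s} ∪ {t}) v : Set V) = reachSet G.Adj {s, t} v := fun v => by
    rw [coe_reachFin]
    simp
  have hmem : ∀ {v w}, w ∈ reachFin G ({s} ∪ {t}) v ↔ w ∈ reachSet G.Adj {s, t} v := fun {v w} => by
    rw [← hcoe, Finset.mem_coe]
  have hsep₀ : IsSeparator G s t (Finset.univ \ ({s} ∪ {t})) := by
    refine IsSeparator.of_closed (X := {s}) (by simp) (by simp) rfl (fun h => hst h.symm) ?_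
    rintro p rfl q hpq hq
    simp only [Finset.mem_sdiff, Finset.mem_univ, Finset.mem_union, Finset.mem_singleton,
      true_and, not_not] at hq
    rcases hq with rfl | rfl
    exacts [rfl, absurd hpq hnst]
  choose! x hxC X h1 h2 h3 h4 using hcut
  set step : Finset V → V → Finset V := fun S v =>
    if IsSeparator G s t ((S \ reachFin G ({s} ∪ {t}) v) ∪ {v})
    then (S \ reachFin G ({s} ∪ {t}) v) ∪ {v} else S with hstep
  have key : ∀ (l : List V) (S : Finset V), IsSeparator G s t S →
      IsSeparator G s t (l.foldl step S) ∧
      ∀ p, p ≠ s → p ≠ t → (x p ∈ l ∨ ∀ a ∈ S, ∀ b ∈ S, a ∈ reachSet G.Adj {s, t} p →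
        b ∈ reachSet G.Adj {s, t} p → a = b) →
        ∀ a ∈ l.foldl step S, ∀ b ∈ l.foldl step S, a ∈ reachSet G.Adj {s, t} p →
          b ∈ reachSet G.Adj {s, t} p → a = b := by
    intro l
    induction l with
    | nil => exact fun S hS => ⟨hS, fun p _ _ h => h.resolve_left (by simp)⟩
    | cons v l ih =>
      intro S hS
      have hsep : IsSeparator G s t (step S v) := by
        by_cases h : IsSeparator G s t ((S \ reachFin G ({s} ∪ {t}) v) ∪ {v})
        · simpa only [hstep, if_pos h] using h
        · simpa only [hstep, if_neg h] using hS
      obtain ⟨h5, h6⟩ := ih _ hsep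
      refine ⟨h5, fun p hps hpt hor => h6 p hps hpt ?_⟩
      by_cases hxl : x p ∈ l
      · exact Or.inl hxl
      right
      have hpst : p ∉ ({s, t} : Set V) := by simp [hps, hpt]
      by_cases h : IsSeparator G s t ((S \ reachFin G ({s} ∪ {t}) v) ∪ {v})
      · simp only [hstep, if_pos h]
        have hvst : v ∉ ({s, t} : Set V) := by
          have := isSeparator_iff.1 h
          rintro (rfl | rfl)
          exacts [this.1 (by simp), this.2.1 (by simp)]
        intro a ha b hb haC hbC
        simp only [Finset.mem_union, Finset.mem_sdiff, hmem, Finset.mem_singleton] at ha hb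
        by_cases hvC : v ∈ reachSet G.Adj {s, t} p
        · have hv : ∀ c ∈ reachSet G.Adj {s, t} p, c ∈ reachSet G.Adj {s, t} v := fun c hc =>
            reachSet_trans (mem_reachSet_symm hpst hvC) hc
          have ha' : a = v := ha.resolve_left fun h => h.2 (hv a haC)
          have hb' : b = v := hb.resolve_left fun h => h.2 (hv b hbC)
          exact ha'.trans hb'.symm
        · have ha' : a ∈ S := ha.elim (·.1) fun h => absurd (h ▸ haC) hvC
          have hb' : b ∈ S := hb.elim (·.1) fun h => absurd (h ▸ hbC) hvC
          refine hor.elim (fun hx => ?_) fun hor => hor a ha' b hb' haC hbC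
          have hxv : x p = v := (List.mem_cons.1 hx).resolve_right hxl
          exact absurd (hxv ▸ hxC p hps hpt) hvC
      · simp only [hstep, if_neg h]
        refine hor.resolve_left fun hx => h ?_
        have hxv : x p = v := (List.mem_cons.1 hx).resolve_right hxl
        have hv := hxC p hps hpt
        refine isSeparator_replace hS hps hpt hv (h1 p hps hpt) (h2 p hps hpt) (h3 p hps hpt)
          (h4 p hps hpt) fun w => ?_
        have hw : w ∈ reachSet G.Adj {s, t} v ↔ w ∈ reachSet G.Adj {s, t} p := by
          rw [hxv] at hv
          exact ⟨fun h => reachSet_trans hv h, fun h =>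
            reachSet_trans (mem_reachSet_symm hpst hv) h⟩
        simp only [Finset.mem_union, Finset.mem_sdiff, hmem, Finset.mem_singleton, hw, hxv]
  obtain ⟨h5, h6⟩ := key vs _ hsep₀
  exact isMinimumSeparator_of_components hG hst h5 fun p hps hpt =>
    h6 p hps hpt (Or.inl (hvs _))

theorem someMinimum_spec (hvs : ∀ v, v ∈ vs) (hG : IsTwoConnectedSeriesParallel G) (hst : s ≠ t)
    (hnst : ¬ G.Adj s t) : IsMinimumSeparator G s t (someMinimum G s t vs) := by
  classical
  rcases foldl_eq_or (N := fun x => ∀ y ∈ vs, ¬ IsSeparator G s t ({x} ∪ {y}))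
    (Y := fun S => ∃ x y : V, IsSeparator G s t ({x} ∪ {y}) ∧ S = {x} ∪ {y})
    (step := fun acc x => vs.foldl (fun acc y =>
      if IsSeparator G s t ({x} ∪ {y}) then {x} ∪ {y} else acc) acc)
    (fun b x => foldl_eq_or (N := fun y => ¬ IsSeparator G s t ({x} ∪ {y}))
      (Y := fun S => ∃ x y : V, IsSeparator G s t ({x} ∪ {y}) ∧ S = {x} ∪ {y})
      (step := fun acc y => if IsSeparator G s t ({x} ∪ {y}) then {x} ∪ {y} else acc)
      (fun b y => by
        by_cases h : IsSeparator G s t ({x} ∪ {y})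
        · exact Or.inr ⟨x, y, h, if_pos h⟩
        · exact Or.inl ⟨if_neg h, h⟩) vs b) vs (componentwise G s t vs) with
    ⟨h1, h2⟩ | ⟨x, y, hxy, heq⟩
  · have : someMinimum G s t vs = componentwise G s t vs := h1
    rw [this]
    refine componentwise_spec hvs hG.twoConnected hst hnst (componentsCut hG hst hnst ?_)
    intro S hS hS2
    obtain ⟨x, y, -, rfl⟩ := Finset.card_eq_two.1 hS2
    exact h2 x (hvs x) y (hvs y) hS
  · have : someMinimum G s t vs = {x} ∪ {y} := heq
    rw [this]
    refine ⟨hxy, fun S hS => le_trans ?_ (two_le_card hG.twoConnected hS)⟩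
    exact (Finset.card_union_le _ _).trans (by simp)

theorem baseSeparator_spec (hvs : ∀ v, v ∈ vs) (hG : IsTwoConnectedSeriesParallel G) (hst : s ≠ t)
    (hnst : ¬ G.Adj s t) : IsMinimumSeparator G s t (baseSeparator G s t vs) ∧
      NoMove G s t (baseSeparator G s t vs) (reachSet G.Adj (baseSeparator G s t vs) s)
        (baseSeparator G s t vs) := by
  have hM := someMinimum_spec hvs hG hst hnst
  obtain ⟨h1, -, -, h4⟩ := advanceRun_spec hvs (Or.inl rfl) hM (two_le_card hG.twoConnected hM.1)
  exact ⟨h1 _ List.mem_cons_self, h4⟩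

theorem normalize_spec (hvs : ∀ v, v ∈ vs) (hG : IsTwoConnectedSeriesParallel G) (hst : s ≠ t)
    (hnst : ¬ G.Adj s t) {A : Finset V} (hA : IsSeparator G s t A) :
    IsTJSequence G s t (normalize G s t vs A).1 A (normalize G s t vs A).toList ∧
      (normalize G s t vs A).1.card = A.card ∧
      baseSeparator G s t vs ⊆ (normalize G s t vs A).1 := by
  have hd := descent hG hst hnst
  obtain ⟨hB, hBno⟩ := baseSeparator_spec hvs hG hst hnst
  obtain ⟨h1, h2, h3, h4⟩ := advanceRun_spec hvs (Or.inr rfl) hB (two_le_card hG.twoConnected hB.1)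
  have hnorm : normalize G s t vs A = (advanceRun G s t vs t (baseSeparator G s t vs)).toList.foldl
    (fun T M => greedyRun G s t vs M T) (A, []) := rfl
  generalize advanceRun G s t vs t (baseSeparator G s t vs) = C at h1 h2 h3 h4 hnorm
  obtain ⟨M, l⟩ := C
  have hM : IsMinimumSeparator G s t M := h1 M List.mem_cons_self
  obtain ⟨h5, h6, -, -, -, h7⟩ := greedyRun_spec (T := (A, [])) hvs (M := M)
    (IsTJSequence.singleton hA)
  have hsep := h5.isSeparator _ List.mem_cons_self
  obtain ⟨h8, h9, h10, h11⟩ := foldl_greedyRun_spec hvs hd l M (greedyRun G s t vs M (A, [])) h1 h2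
    h5 h7 ((hd.nested hM hsep h7).imp id fun h => h.resolve_left (hd.toTarget hM hsep h7 h4)) _ h3
    (normalize G s t vs A) hnorm
  refine ⟨h8, h11.trans h6, h10.resolve_right ?_⟩
  exact hd.toSource hB (h8.isSeparator _ List.mem_cons_self) h9 hBno

theorem reconfigure_spec (hvs : ∀ v, v ∈ vs) (hG : IsTwoConnectedSeriesParallel G) (hst : s ≠ t)
    (hnst : ¬ G.Adj s t) {A B : Finset V} (hA : IsSeparator G s t A) (hB : IsSeparator G s t B)
    (hAB : A.card = B.card) :
    IsTJSequence G s t A B (reconfigure G s t vs A B) ∧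
      ∃ S ∈ reconfigure G s t vs A B, baseSeparator G s t vs ⊆ S := by
  obtain ⟨hA1, hA2, hA3⟩ := normalize_spec hvs hG hst hnst hA
  obtain ⟨hB1, hB2, hB3⟩ := normalize_spec hvs hG hst hnst hB
  have hBsep := hB1.isSeparator _ List.mem_cons_self
  obtain ⟨h1, h2, h3, h4, -, h6⟩ := greedyRun_spec hvs (M := (normalize G s t vs B).1) hA1
  have hrec : reconfigure G s t vs A B = (greedyRun G s t vs (normalize G s t vs B).1
    (normalize G s t vs A)).toList.reverse ++ (normalize G s t vs B).2 := rfl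
  set B' := (normalize G s t vs B).1
  set T := greedyRun G s t vs B' (normalize G s t vs A)
  have hTsep := isSeparator_iff.1 (h1.isSeparator T.1 List.mem_cons_self)
  have hBsep' := isSeparator_iff.1 hBsep
  have hbase : baseSeparator G s t vs ⊆ T.1 := fun v hv =>
    h4 (Finset.mem_inter.2 ⟨hA3 hv, hB3 hv⟩)
  have hcard : T.1.card = B'.card := by rw [h2, hA2, hB2, hAB]
  -- a token off `B'` could still be moved, as the tokens on the base separator stay in place
  have hTB : T.1 = B' := by
    by_contra hne
    have hsub : ¬ T.1 ⊆ B' := fun h => hne (Finset.eq_of_subset_of_card_le h hcard.ge)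
    have hsub' : ¬ B' ⊆ T.1 := fun h => hne (Finset.eq_of_subset_of_card_le h hcard.le).symm
    obtain ⟨a, ha, haB⟩ := Finset.not_subset.1 hsub
    obtain ⟨v, hv, hvT⟩ := Finset.not_subset.1 hsub'
    refine h6 a (by simp [ha, haB]) v (by simp [hv, hvT])
      ((baseSeparator_spec hvs hG hst hnst).1.1.superset (fun w hw => ?_) ?_ ?_)
    · exact mem_moveToken.2 (Or.inl ⟨hbase hw, fun h => haB (h ▸ hB3 hw)⟩)
    · rw [mem_moveToken]
      rintro (h | h)
      exacts [hTsep.1 h.1, hBsep'.1 (h ▸ hv)]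
    · rw [mem_moveToken]
      rintro (h | h)
      exacts [hTsep.2.1 h.1, hBsep'.2.1 (h ▸ hv)]
  rw [hrec]
  refine ⟨?_, T.1, ?_, hbase⟩
  · have h7 := h1.reverse
    rw [hTB] at h7
    exact h7.append hB1
  · exact List.mem_append_left _ (List.mem_reverse.2 List.mem_cons_self)

/-- A sequence may be taken through a superset of any given minimum separator `M`: a superset of the
right size is a separator, so that sequences to and from it can be concatenated. -/
theorem exists_isTJSequence_through (hG : IsTwoConnectedSeriesParallel G) (hst : s ≠ t)
    (hnst : ¬ G.Adj s t) {A B : Finset V} (hA : IsSeparator G s t A) (hB : IsSeparator G s t B)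
    (hAB : A.card = B.card) {M : Finset V} (hM : IsMinimumSeparator G s t M) :
    ∃ L, IsTJSequence G s t A B L ∧ ∃ S ∈ L, M ⊆ S := by
  have hvs : ∀ v, v ∈ (Finset.univ : Finset V).toList := fun v => by simp
  have hA' := isSeparator_iff.1 hA
  have hM' := isSeparator_iff.1 hM.1
  obtain ⟨C, hMC, hCst, hC⟩ := Finset.exists_subsuperset_card_eq (s := M)
    (t := Finset.univ \ {s, t}) (n := A.card)
    (fun v hv => by
      simp only [Finset.mem_sdiff, Finset.mem_univ, Finset.mem_insert, Finset.mem_singleton,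
        true_and, not_or]
      exact ⟨fun h => hM'.1 (h ▸ hv), fun h => hM'.2.1 (h ▸ hv)⟩)
    (hM.2 A hA)
    (Finset.card_le_card fun v hv => by
      simp only [Finset.mem_sdiff, Finset.mem_univ, Finset.mem_insert, Finset.mem_singleton,
        true_and, not_or]
      exact ⟨fun h => hA'.1 (h ▸ hv), fun h => hA'.2.1 (h ▸ hv)⟩)
  have hCsep : IsSeparator G s t C := hM.1.superset hMC
    (fun h => by simpa using hCst h) (fun h => by simpa using hCst h)
  obtain ⟨h1, -⟩ := reconfigure_spec hvs hG hst hnst hA hCsep hC.symm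
  obtain ⟨h2, -⟩ := reconfigure_spec hvs hG hst hnst hCsep hB (hC.trans hAB)
  obtain ⟨l, hl⟩ : ∃ l, reconfigure G s t (Finset.univ : Finset V).toList C B = C :: l := by
    have := h2.head
    cases h : reconfigure G s t (Finset.univ : Finset V).toList C B with
    | nil => simp [h] at this
    | cons x l =>
      rw [h, List.head?_cons, Option.some_inj] at this
      exact ⟨l, by rw [this]⟩
  rw [hl] at h2
  refine ⟨_, h1.append h2, C, ?_, hMC⟩
  exact List.mem_append_left _ (List.mem_of_getLast? h1.last)

end Algorithm

/-! ### Programs with polynomial running time -/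

/-- The data `g n i` can be computed from `env n i` in time polynomial in `n`. Here `i` ranges over
an index type depending on `n`, whose elements are the values of the objects at hand. For each
number `k` there is a program that transforms the contents of variable `k` in this way, while it
leaves the variables below `k` unchanged; thus programs can be combined without interference. -/
def Computes {ι : ℕ → Type} (env g : ∀ n, ι n → Data) : Prop :=
  ∃ (c : ℕ → Program) (p : Polynomial ℕ), ∀ (n : ℕ) (i : ι n) (k : ℕ) (σ : ℕ → Data),
    σ k = env n i → ∃ (m : ℕ) (τ : ℕ → Data), m ≤ p.eval n ∧ Runs (c k) σ m τ ∧ τ k = g n i ∧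
      ∀ j < k, τ j = σ j

/-- The numbers `b n i` are bounded by a polynomial in `n`. -/
def PolyBounded {ι : ℕ → Type} (b : ∀ n, ι n → ℕ) : Prop :=
  ∃ q : Polynomial ℕ, ∀ n i, b n i ≤ q.eval n

namespace Computes

variable {ι : ℕ → Type} {env f g : ∀ n, ι n → Data}

theorem congr (h : Computes env f) (hfg : ∀ n i, f n i = g n i) : Computes env g := by
  have : f = g := by
    funext n i
    exact hfg n i
  exact this ▸ h

theorem id : Computes env env :=
  ⟨fun _ => .skip, 1, fun _ _ _ σ hσ => ⟨1, σ, by simp, .skip σ, hσ, fun _ _ => rfl⟩⟩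

theorem comp (hf : Computes env f) (hg : Computes f g) : Computes env g := by
  obtain ⟨c, p, hc⟩ := hf
  obtain ⟨d, q, hd⟩ := hg
  refine ⟨fun k => .seq (c k) (d k), p + q, fun n i k σ hσ => ?_⟩
  obtain ⟨m, τ, hm, hr, hτ, hτ'⟩ := hc n i k σ hσ
  obtain ⟨m', ρ, hm', hr', hρ, hρ'⟩ := hd n i k τ hτ
  exact ⟨m + m', ρ, by simpa using add_le_add hm hm', .seq hr hr', hρ,
    fun j hj => (hρ' j hj).trans (hτ' j hj)⟩

/-- The indices may be replaced along a map. -/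
theorem reindex {κ : ℕ → Type} (h : Computes env g) (φ : ∀ n, κ n → ι n) :
    Computes (fun n j => env n (φ n j)) (fun n j => g n (φ n j)) := by
  obtain ⟨c, p, hc⟩ := h
  exact ⟨c, p, fun n j => hc n (φ n j)⟩

theorem of_assign {e : ℕ → Expr} {b : ℕ} (hb : ∀ k, (e k).cost ≤ b)
    (he : ∀ n i k σ, σ k = env n i → (e k).eval σ = g n i) : Computes env g := by
  refine ⟨fun k => .assign k (e k), Polynomial.C (b + 1), fun n i k σ hσ =>
    ⟨_, _, ?_, .assign σ k (e k), ?_, fun j hj => ?_⟩⟩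
  · simpa using hb k
  · simpa using he n i k σ hσ
  · exact Function.update_of_ne hj.ne _ _

theorem nil : Computes env (fun _ _ => .nil) :=
  of_assign (e := fun _ => .nil) (b := 1) (fun _ => le_rfl) fun _ _ _ _ _ => rfl

theorem fst (h : Computes env g) : Computes env (fun n i => (g n i).fst) :=
  h.comp (of_assign (e := fun k => .fst (.var k)) (b := 2) (fun _ => le_rfl)
    fun _ _ _ _ hσ => congrArg Data.fst hσ)

theorem snd (h : Computes env g) : Computes env (fun n i => (g n i).snd) :=
  h.comp (of_assign (e := fun k => .snd (.var k)) (b := 2) (fun _ => le_rfl)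
    fun _ _ _ _ hσ => congrArg Data.snd hσ)

theorem pair (hf : Computes env f) (hg : Computes env g) :
    Computes env (fun n i => .pair (f n i) (g n i)) := by
  obtain ⟨c, p, hc⟩ := hf
  obtain ⟨d, q, hd⟩ := hg
  refine ⟨fun k => .seq (.assign (k + 1) (.var k)) (.seq (c (k + 1))
    (.seq (.assign (k + 2) (.var k)) (.seq (d (k + 2))
    (.assign k (.pair (.var (k + 1)) (.var (k + 2))))))), p + q + 8, fun n i k σ hσ => ?_⟩
  obtain ⟨m, τ, hm, hr, hτ, hτ'⟩ := hc n i (k + 1) (Function.update σ (k + 1) (σ k))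
    (by simpa using hσ)
  have hτk : τ k = σ k := by
    rw [hτ' k (by omega), Function.update_of_ne (by omega)]
  obtain ⟨m', ρ, hm', hr', hρ, hρ'⟩ := hd n i (k + 2) (Function.update τ (k + 2) (τ k))
    (by simpa [hτk] using hσ)
  refine ⟨_, _, ?_, .seq (.assign σ (k + 1) (.var k)) (.seq hr (.seq (.assign τ (k + 2) (.var k))
    (.seq hr' (.assign ρ k (.pair (.var (k + 1)) (.var (k + 2))))))), ?_, fun j hj => ?_⟩
  · simp only [Expr.cost, Polynomial.eval_add, Polynomial.eval_ofNat]
    omega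
  · have : ρ (k + 1) = f n i := by
      rw [hρ' (k + 1) (by omega), Function.update_of_ne (by omega), hτ]
    simp [Expr.eval, this, hρ]
  · rw [Function.update_of_ne (by omega), hρ' j (by omega), Function.update_of_ne (by omega),
      hτ' j (by omega), Function.update_of_ne (by omega)]

theorem encProp_true : Computes env (fun _ _ => encProp True) :=
  (nil.pair nil).congr fun _ _ => by simp [encProp]

theorem encProp_false : Computes env (fun _ _ => encProp False) :=
  nil.congr fun _ _ => by simp [encProp]

theorem ite {P : ∀ n, ι n → Prop} [∀ n i, Decidable (P n i)]
    (hP : Computes env (fun n i => encProp (P n i))) (hf : Computes env f) (hg : Computes env g) :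
    Computes env (fun n i => if P n i then f n i else g n i) := by
  obtain ⟨c, p, hc⟩ := hP
  obtain ⟨d, q, hd⟩ := hf
  obtain ⟨e, r, he⟩ := hg
  refine ⟨fun k => .seq (.assign (k + 1) (.var k)) (.seq (c (k + 1))
    (.ite (.var (k + 1)) (d k) (e k))), p + q + r + 4, fun n i k σ hσ => ?_⟩
  obtain ⟨m, τ, hm, hr, hτ, hτ'⟩ := hc n i (k + 1) (Function.update σ (k + 1) (σ k))
    (by simpa using hσ)
  have hτk : τ k = σ k := by
    rw [hτ' k (by omega), Function.update_of_ne (by omega)]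
  by_cases hPi : P n i
  · obtain ⟨m', ρ, hm', hr', hρ, hρ'⟩ := hd n i k τ (hτk.trans hσ)
    refine ⟨_, _, ?_, .seq (.assign σ (k + 1) (.var k)) (.seq hr (.ite_true ?_ hr')), ?_,
      fun j hj => ?_⟩
    · simp only [Expr.cost, Polynomial.eval_add, Polynomial.eval_ofNat]
      omega
    · simp [Expr.eval, hτ, encProp, hPi]
    · simp [hρ, hPi]
    · rw [hρ' j hj, hτ' j (by omega), Function.update_of_ne (by omega)]
  · obtain ⟨m', ρ, hm', hr', hρ, hρ'⟩ := he n i k τ (hτk.trans hσ)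
    refine ⟨_, _, ?_, .seq (.assign σ (k + 1) (.var k)) (.seq hr (.ite_false ?_ hr')), ?_,
      fun j hj => ?_⟩
    · simp only [Expr.cost, Polynomial.eval_add, Polynomial.eval_ofNat]
      omega
    · simp [Expr.eval, hτ, encProp, hPi]
    · simp [hρ, hPi]
    · rw [hρ' j hj, hτ' j (by omega), Function.update_of_ne (by omega)]

theorem not {P : ∀ n, ι n → Prop} (hP : Computes env (fun n i => encProp (P n i))) :
    Computes env (fun n i => encProp (¬ P n i)) := by
  classical
  exact (hP.ite encProp_false encProp_true).congr fun n i => by by_cases h : P n i <;> simp [h]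

theorem and {P Q : ∀ n, ι n → Prop} (hP : Computes env (fun n i => encProp (P n i)))
    (hQ : Computes env (fun n i => encProp (Q n i))) :
    Computes env (fun n i => encProp (P n i ∧ Q n i)) := by
  classical
  exact (hP.ite hQ encProp_false).congr fun n i => by by_cases h : P n i <;> simp [h]

theorem or {P Q : ∀ n, ι n → Prop} (hP : Computes env (fun n i => encProp (P n i)))
    (hQ : Computes env (fun n i => encProp (Q n i))) :
    Computes env (fun n i => encProp (P n i ∨ Q n i)) := by
  classical
  exact (hP.ite encProp_true hQ).congr fun n i => by by_cases h : P n i <;> simp [h]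

/-- A loop through a list: if `a n i j` is the state after `j` rounds, and each round computes the
next state from the environment, the current state and the current element of the list, then the
state after the last round can be computed. -/
theorem loop {l : ∀ n, ι n → List Data} {a : ∀ n, ι n → ℕ → Data}
    (hlen : PolyBounded fun n i => (l n i).length)
    (hl : Computes env (fun n i => encList (l n i))) (ha : Computes env (fun n i => a n i 0))
    (hbody : Computes (ι := fun n => Σ i : ι n, Fin (l n i).length)
      (fun n j => .pair (env n j.1) (.pair (a n j.1 j.2) ((l n j.1).get j.2)))
      (fun n j => a n j.1 (j.2 + 1))) :
    Computes env (fun n i => a n i (l n i).length) := by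
  obtain ⟨q, hq⟩ := hlen
  obtain ⟨c, p, hc⟩ := hl
  obtain ⟨d, p', hd⟩ := ha
  obtain ⟨e, r, he⟩ := hbody
  -- variable `k + 1` holds the rest of the list, and variable `k + 2` the state
  set body : ℕ → Program := fun k => .seq
    (.assign (k + 3) (.pair (.var k) (.pair (.var (k + 2)) (.fst (.var (k + 1))))))
    (.seq (e (k + 3)) (.seq (.assign (k + 2) (.var (k + 3)))
      (.assign (k + 1) (.snd (.var (k + 1)))))) with hbodyk
  have hloop : ∀ (n : ℕ) (i : ι n) (k d j : ℕ) (σ : ℕ → Data), j + d = (l n i).length →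
      σ k = env n i → σ (k + 1) = encList ((l n i).drop j) → σ (k + 2) = a n i j →
      ∃ (m : ℕ) (τ : ℕ → Data), m ≤ d * (r.eval n + 16) + 2 ∧
        Runs (.while (.var (k + 1)) (body k)) σ m τ ∧ τ (k + 2) = a n i (l n i).length ∧
        ∀ v < k, τ v = σ v := by
    intro n i k d
    induction d with
    | zero =>
      intro j σ hj _ h1 h2
      obtain rfl : j = (l n i).length := hj
      refine ⟨_, σ, ?_, .while_false ?_, h2, fun _ _ => rfl⟩
      · simp [Expr.cost]
      · simpa [Expr.eval, encList] using h1
    | succ d ih =>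
      intro j σ hj h0 h1 h2
      have hjl : j < (l n i).length := by omega
      rw [List.drop_eq_getElem_cons hjl] at h1
      obtain ⟨m, τ, hm, hr, hτ, hτ'⟩ := he n ⟨i, ⟨j, hjl⟩⟩ (k + 3)
        (Function.update σ (k + 3) (.pair (σ k) (.pair (σ (k + 2)) (σ (k + 1)).fst)))
        (by simp [h0, h1, h2, encList, Data.fst])
      have hτ0 : τ k = σ k := by rw [hτ' k (by omega), Function.update_of_ne (by omega)]
      have hτ1 : τ (k + 1) = σ (k + 1) := by
        rw [hτ' (k + 1) (by omega), Function.update_of_ne (by omega)]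
      set τ₂ := Function.update τ (k + 2) (τ (k + 3)) with hτ₂
      set τ₃ := Function.update τ₂ (k + 1) (τ₂ (k + 1)).snd with hτ₃
      obtain ⟨m', ρ, hm', hr', hρ, hρ'⟩ := ih (j + 1) τ₃ (by omega)
        (by rw [hτ₃, Function.update_of_ne (by omega), hτ₂, Function.update_of_ne (by omega), hτ0,
              h0])
        (by rw [hτ₃, Function.update_self, hτ₂, Function.update_of_ne (by omega), hτ1, h1]; rfl)
        (by rw [hτ₃, Function.update_of_ne (by omega), hτ₂, Function.update_self, hτ])
      refine ⟨_, ρ, ?_, .while_true ?_ (.seq (.assign σ (k + 3)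
        (.pair (.var k) (.pair (.var (k + 2)) (.fst (.var (k + 1))))))
        (.seq hr (.seq (.assign τ (k + 2) (.var (k + 3)))
          (.assign τ₂ (k + 1) (.snd (.var (k + 1))))))) hr', hρ, fun v hv => ?_⟩
      · simp only [Expr.cost, add_mul, one_mul]
        omega
      · simp [Expr.eval, h1, encList]
      · rw [hρ' v hv, hτ₃, Function.update_of_ne (by omega), hτ₂, Function.update_of_ne (by omega),
          hτ' v (by omega), Function.update_of_ne (by omega)]
  refine ⟨fun k => .seq (.assign (k + 1) (.var k)) (.seq (c (k + 1))
    (.seq (.assign (k + 2) (.var k)) (.seq (d (k + 2))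
    (.seq (.while (.var (k + 1)) (body k)) (.assign k (.var (k + 2))))))),
    p + p' + q * (r + 16) + 8, fun n i k σ hσ => ?_⟩
  obtain ⟨m, τ, hm, hr, hτ, hτ'⟩ := hc n i (k + 1) (Function.update σ (k + 1) (σ k))
    (by simpa using hσ)
  have hτk : τ k = σ k := by
    rw [hτ' k (by omega), Function.update_of_ne (by omega)]
  obtain ⟨m', ρ, hm', hr', hρ, hρ'⟩ := hd n i (k + 2) (Function.update τ (k + 2) (τ k))
    (by simpa [hτk] using hσ)
  obtain ⟨m'', υ, hm'', hr'', hυ, hυ'⟩ := hloop n i k (l n i).length 0 ρ (by simp)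
    (by rw [hρ' k (by omega), Function.update_of_ne (by omega), hτk, hσ])
    (by rw [hρ' (k + 1) (by omega), Function.update_of_ne (by omega), hτ, List.drop_zero])
    hρ
  refine ⟨_, _, ?_, .seq (.assign σ (k + 1) (.var k)) (.seq hr (.seq (.assign τ (k + 2) (.var k))
    (.seq hr' (.seq hr'' (.assign υ k (.var (k + 2))))))), ?_, fun j hj => ?_⟩
  · have : (l n i).length * (r.eval n + 16) ≤ q.eval n * (r.eval n + 16) :=
      Nat.mul_le_mul_right _ (hq n i)
    simp only [Expr.cost, Polynomial.eval_add, Polynomial.eval_mul, Polynomial.eval_ofNat]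
    omega
  · simpa [Expr.eval] using hυ
  · rw [Function.update_of_ne (by omega), hυ' j hj, hρ' j (by omega),
      Function.update_of_ne (by omega), hτ' j (by omega), Function.update_of_ne (by omega)]

/-! ### Computations with lists -/

variable {X A : ℕ → Type} {encX : ∀ n, ι n → X n → Data} {encA : ∀ n, ι n → A n → Data}
  {l : ∀ n, ι n → List (X n)}

/-- What can be computed in an environment can also be computed in the body of a loop. -/
theorem lift {κ : ℕ → Type} {φ : ∀ n, κ n → ι n} (h : Computes env g) {x : ∀ n, κ n → Data} :
    Computes (fun n j => .pair (env n (φ n j)) (x n j)) (fun n j => g n (φ n j)) := by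
  have h1 : Computes (fun n j => .pair (env n (φ n j)) (x n j)) (fun n j => env n (φ n j)) :=
    id.fst
  exact h1.comp (h.reindex φ)

theorem foldl {a : ∀ n, ι n → A n} {step : ∀ n, ι n → A n → X n → A n}
    (hlen : PolyBounded fun n i => (l n i).length)
    (hl : Computes env (fun n i => encList ((l n i).map (encX n i))))
    (ha : Computes env (fun n i => encA n i (a n i)))
    (hbody : Computes (ι := fun n => ι n × A n × X n)
      (fun n j => .pair (env n j.1) (.pair (encA n j.1 j.2.1) (encX n j.1 j.2.2)))
      (fun n j => encA n j.1 (step n j.1 j.2.1 j.2.2))) :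
    Computes env (fun n i => encA n i ((l n i).foldl (step n i) (a n i))) := by
  have := loop (l := fun n i => (l n i).map (encX n i))
    (a := fun n i j => encA n i (((l n i).take j).foldl (step n i) (a n i))) (by simpa using hlen)
    hl (by simpa using ha) ?_
  · simpa using this
  · have h := (hbody.reindex (κ := fun n => Σ i : ι n, Fin ((l n i).map (encX n i)).length)
      (fun n j => (j.1, ((l n j.1).take j.2).foldl (step n j.1) (a n j.1),
        (l n j.1)[j.2.1]'(by simpa using j.2.2)))).congr
      (g := fun n j => encA n j.1 (((l n j.1).take (j.2 + 1)).foldl (step n j.1) (a n j.1))) (by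
        rintro n ⟨i, j, hj⟩
        have hj' : j < (l n i).length := by simpa using hj
        simp only [List.take_succ_eq_append_getElem hj', List.foldl_append, List.foldl_cons,
          List.foldl_nil])
    simpa using h

theorem reverse (hlen : PolyBounded fun n i => (l n i).length)
    (hl : Computes env (fun n i => encList ((l n i).map (encX n i)))) :
    Computes env (fun n i => encList ((l n i).reverse.map (encX n i))) := by
  have := foldl (A := fun n => List (X n)) (encA := fun n i l => encList (l.map (encX n i)))
    (a := fun _ _ => []) (step := fun _ _ acc x => x :: acc) hlen hl (nil.congr fun _ _ => rfl)
    (id.snd.snd.pair id.snd.fst)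
  exact this.congr fun n i => by simp

theorem map {encY : ∀ n, ι n → X n → Data} (hlen : PolyBounded fun n i => (l n i).length)
    (hl : Computes env (fun n i => encList ((l n i).map (encX n i))))
    (hbody : Computes (ι := fun n => ι n × X n)
      (fun n j => .pair (env n j.1) (encX n j.1 j.2)) (fun n j => encY n j.1 j.2)) :
    Computes env (fun n i => encList ((l n i).map (encY n i))) := by
  have h1 : Computes (ι := fun n => ι n × List (X n) × X n)
      (fun n j => .pair (env n j.1) (.pair (encList (j.2.1.map (encY n j.1))) (encX n j.1 j.2.2)))
      (fun n j => encY n j.1 j.2.2) :=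
    (id.fst.pair id.snd.snd).comp
      (hbody.reindex (κ := fun n => ι n × List (X n) × X n) fun n j => (j.1, j.2.2))
  have := foldl (A := fun n => List (X n)) (encA := fun n i l => encList (l.map (encY n i)))
    (a := fun _ _ => []) (step := fun _ _ acc x => x :: acc) hlen hl (nil.congr fun _ _ => rfl)
    (h1.pair id.snd.fst)
  have h2 := reverse (l := fun n i => (l n i).reverse) (by simpa using hlen)
    (this.congr (g := fun n i => encList ((l n i).reverse.map (encY n i))) fun n i => by simp)
  exact h2.congr fun n i => by simp

theorem zip {encY : ∀ n, ι n → X n → Data} (hlen : PolyBounded fun n i => (l n i).length)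
    (hX : Computes env (fun n i => encList ((l n i).map (encX n i))))
    (hY : Computes env (fun n i => encList ((l n i).map (encY n i)))) :
    Computes env (fun n i =>
      encList ((l n i).map fun x => .pair (encX n i x) (encY n i x))) := by
  -- the state consists of the rest of the second list and the reversed list of pairs
  have h1 := loop (env := env) (l := fun n i => (l n i).map (encX n i))
    (a := fun n i j => .pair (encList (((l n i).drop j).map (encY n i)))
      (encList (((l n i).take j).reverse.map fun x => .pair (encX n i x) (encY n i x))))
    (by simpa using hlen) hX ((hY.pair nil).congr fun n i => by simp [encList]) (by
      refine (id.snd.fst.fst.snd.pair ((id.snd.snd.pair id.snd.fst.fst.fst).pair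
        id.snd.fst.snd)).congr ?_
      rintro n ⟨i, j, hj⟩
      have hj' : j < (l n i).length := by simpa using hj
      rw [List.drop_eq_getElem_cons hj', List.take_succ_eq_append_getElem hj']
      simp only [List.get_eq_getElem, List.getElem_map, List.map_cons, List.reverse_append,
        List.reverse_singleton, List.singleton_append, encList, Data.fst, Data.snd])
  have h2 := reverse (l := fun n i => (l n i).reverse) (by simpa using hlen)
    (h1.snd.congr (g := fun n i => encList ((l n i).reverse.map fun x =>
      .pair (encX n i x) (encY n i x))) fun n i => by simp [Data.snd])
  exact h2.congr fun n i => by simp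

end Computes

/-! ### Computations with sets of vertices -/

section Computations

variable {ι : ℕ → Type} {env : ∀ n, ι n → Data}

theorem polyBounded_finRange : PolyBounded (ι := ι) fun n _ => (List.finRange n).length :=
  ⟨Polynomial.X, fun n _ => by simp⟩

namespace Computes

/-- A set can be computed from two others if membership in it can be computed, for each vertex
separately, from membership in these. -/
theorem map₂ {R S T : ∀ n, ι n → Finset (Fin n)}
    (hR : Computes env (fun n i => encSet (R n i))) (hS : Computes env (fun n i => encSet (S n i)))
    (hbody : Computes (ι := fun n => ι n × Fin n)
      (fun n j => .pair (encProp (j.2 ∈ R n j.1)) (encProp (j.2 ∈ S n j.1)))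
      (fun n j => encProp (j.2 ∈ T n j.1))) : Computes env (fun n i => encSet (T n i)) := by
  have h := zip (X := fun n => Fin n) (l := fun n _ => List.finRange n)
    (encX := fun n i v => encProp (v ∈ R n i)) (encY := fun n i v => encProp (v ∈ S n i))
    polyBounded_finRange hR hS
  exact h.map polyBounded_finRange (id.snd.comp hbody)

theorem union {R S : ∀ n, ι n → Finset (Fin n)}
    (hR : Computes env (fun n i => encSet (R n i)))
    (hS : Computes env (fun n i => encSet (S n i))) :
    Computes env (fun n i => encSet (R n i ∪ S n i)) :=
  map₂ hR hS ((or (P := fun n (j : ι n × Fin n) => j.2 ∈ R n j.1) id.fst id.snd).congr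
    fun n j => by simp only [Finset.mem_union])

theorem sdiff {R S : ∀ n, ι n → Finset (Fin n)}
    (hR : Computes env (fun n i => encSet (R n i)))
    (hS : Computes env (fun n i => encSet (S n i))) :
    Computes env (fun n i => encSet (R n i \ S n i)) :=
  map₂ hR hS ((and (P := fun n (j : ι n × Fin n) => j.2 ∈ R n j.1) id.fst
    (not (P := fun n (j : ι n × Fin n) => j.2 ∈ S n j.1) id.snd)).congr
    fun n j => by simp only [Finset.mem_sdiff])

theorem isEmpty {S : ∀ n, ι n → Finset (Fin n)} (hS : Computes env (fun n i => encSet (S n i))) :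
    Computes env (fun n i => encProp (S n i = ∅)) := by
  have h := foldl (X := fun n => Fin n) (A := fun _ => Prop) (l := fun n _ => List.finRange n)
    (encX := fun n i v => encProp (v ∈ S n i)) (encA := fun _ _ P => encProp P)
    (a := fun _ _ => True) (step := fun n i P v => P ∧ ¬ v ∈ S n i) polyBounded_finRange hS
    encProp_true (and (P := fun n (j : ι n × Prop × Fin n) => j.2.1) id.snd.fst
      (not (P := fun n (j : ι n × Prop × Fin n) => j.2.2 ∈ S n j.1) id.snd.snd))
  refine h.congr fun n i => ?_
  have key : ∀ (l : List (Fin n)) (P : Prop),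
      l.foldl (fun P v => P ∧ ¬ v ∈ S n i) P ↔ P ∧ ∀ v ∈ l, v ∉ S n i := by
    intro l
    induction l with
    | nil => simp
    | cons x l ih =>
      intro P
      rw [List.foldl_cons, ih]
      simp [and_assoc]
  congr 1
  rw [eq_iff_iff, key]
  simp [Finset.eq_empty_iff_forall_notMem]

theorem empty {S : ∀ n, ι n → Finset (Fin n)} (hS : Computes env (fun n i => encSet (S n i))) :
    Computes env (fun n _ => encSet (∅ : Finset (Fin n))) :=
  (hS.sdiff hS).congr fun n i => by rw [sdiff_self]; rfl

theorem mem {v : ∀ n, ι n → Fin n} {S : ∀ n, ι n → Finset (Fin n)}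
    (hv : Computes env (fun n i => encSet {v n i}))
    (hS : Computes env (fun n i => encSet (S n i))) :
    Computes env (fun n i => encProp (v n i ∈ S n i)) :=
  (hv.sdiff hS).isEmpty.congr fun n i => by
    rw [Finset.sdiff_eq_empty_iff_subset, Finset.singleton_subset_iff]

/-- The list of all singletons, from a list with one entry for each vertex. -/
theorem singletons {l : ∀ n, ι n → List Data} (hlen : ∀ n i, (l n i).length = n)
    (hl : Computes env (fun n i => encList (l n i))) :
    Computes env (fun n _ => encList ((List.finRange n).map fun v => encSet {v})) := by
  -- the state consists of a zero vector of length `j` and the list of singletons of `Fin j`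
  have h := loop (env := env) (l := l) (a := fun _ _ j => .pair (encSet (∅ : Finset (Fin j)))
      (encList ((List.finRange j).map fun v => encSet {v})))
    ⟨Polynomial.X, fun n i => by simp [hlen]⟩ hl
    ((nil.pair nil).congr fun n i => by simp [encSet, encList]) ?_
  · exact h.snd.congr fun n i => by rw [hlen]; rfl
  · have h0 : ∀ j : ℕ, encSet (∅ : Finset (Fin (j + 1))) =
        .pair .nil (encSet (∅ : Finset (Fin j))) :=
      fun j => by
        simp only [encSet, List.finRange_succ, List.map_cons, List.map_map, encList]
        simp [encProp, Function.comp_def]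
    have h1 : ∀ j : ℕ, encSet ({0} : Finset (Fin (j + 1))) =
        .pair (.pair .nil .nil) (encSet (∅ : Finset (Fin j))) := fun j => by
      simp only [encSet, List.finRange_succ, List.map_cons, List.map_map, encList]
      simp [encProp, Function.comp_def]
    have h2 : ∀ (j : ℕ) (v : Fin j), encSet ({v.succ} : Finset (Fin (j + 1))) =
        .pair .nil (encSet {v}) := fun j v => by
      simp only [encSet, List.finRange_succ, List.map_cons, List.map_map, encList]
      have : (0 : Fin (j + 1)) ≠ v.succ := (Fin.succ_ne_zero v).symm
      simp [encProp, Function.comp_def, this]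
    have hmap := map (env := fun n (j : Σ i : ι n, Fin (l n i).length) => Data.pair (env n j.1)
        (.pair (.pair (encSet (∅ : Finset (Fin j.2)))
        (encList ((List.finRange j.2).map fun v => encSet {v}))) ((l n j.1).get j.2)))
      (X := fun _ => Data) (l := fun n j => (List.finRange j.2).map fun v => encSet {v})
      (encX := fun _ _ d => d) (encY := fun _ _ d => .pair .nil d)
      ⟨Polynomial.X, fun n j => by
        have := j.2.2
        have := hlen n j.1
        simp
        omega⟩ (id.snd.fst.snd.congr fun n j => by
        simp [Data.fst, Data.snd, Function.comp_def]) (nil.pair id.snd)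
    refine ((nil.pair id.snd.fst.fst).pair
      (((nil.pair nil).pair id.snd.fst.fst).pair hmap)).congr ?_
    rintro n ⟨i, j, hj⟩
    simp only [Data.fst, Data.snd, h0, List.finRange_succ, List.map_cons, List.map_map, encList, h1]
    congr 4
    funext v
    simp [h2]

/-- The singleton of a vertex given in unary. -/
theorem singleton_of_encNat {v : ∀ n, ι n → Fin n}
    (hs : Computes env (fun n _ => encList ((List.finRange n).map fun v => encSet {v})))
    (hv : Computes env (fun n i => encNat (v n i))) : Computes env (fun n i => encSet {v n i}) := by
  have h := foldl (X := fun _ => Data) (A := fun n => List (Fin n))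
    (l := fun n i => List.replicate (v n i) Data.nil) (encX := fun _ _ d => d)
    (encA := fun n _ l => encList (l.map fun v => encSet {v})) (a := fun n _ => List.finRange n)
    (step := fun _ _ l _ => l.tail)
    ⟨Polynomial.X, fun n i => by simp⟩ (hv.congr fun n i => by simp [encNat]) hs
    (id.snd.fst.snd.congr (by
      rintro n ⟨i, l, d⟩
      cases l <;> rfl))
  refine h.fst.congr fun n i => ?_
  have key : ∀ (k : ℕ) (l : List (Fin n)),
      (List.replicate k Data.nil).foldl (fun l _ => l.tail) l = l.drop k := by
    intro k
    induction k with
    | zero => intro l; rfl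
    | succ k ih =>
      intro l
      rw [List.replicate_succ, List.foldl_cons, ih, List.drop_tail]
  rw [key, List.drop_eq_getElem_cons (by simp)]
  simp [encList, Data.fst]

end Computes

open Classical in
/-- The set of all neighbours of vertices of `R`. -/
noncomputable def neighborsOf {V : Type*} [Fintype V] (G : SimpleGraph V) (R : Finset V) :
    Finset V :=
  {w | ∃ v ∈ R, G.Adj v w}

theorem mem_neighborsOf {V : Type*} [Fintype V] {G : SimpleGraph V} {R : Finset V} {w : V} :
    w ∈ neighborsOf G R ↔ ∃ v ∈ R, G.Adj v w := by
  simp [neighborsOf]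

/-- The graph `G n i` and the vertices `s n i` and `t n i` can be computed. -/
structure ComputesGraph (env : ∀ n, ι n → Data) (G : ∀ n, ι n → SimpleGraph (Fin n))
    (s t : ∀ n, ι n → Fin n) : Prop where
  graph : Computes env (fun n i => encGraph (G n i))
  singletons : Computes env (fun n _ => encList ((List.finRange n).map fun v => encSet {v}))
  source : Computes env (fun n i => encSet {s n i})
  target : Computes env (fun n i => encSet {t n i})

variable {G : ∀ n, ι n → SimpleGraph (Fin n)} {s t : ∀ n, ι n → Fin n}

namespace ComputesGraph

theorem lift {κ : ℕ → Type} {φ : ∀ n, κ n → ι n} (h : ComputesGraph env G s t)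
    {x : ∀ n, κ n → Data} : ComputesGraph (fun n j => .pair (env n (φ n j)) (x n j))
      (fun n j => G n (φ n j)) (fun n j => s n (φ n j)) (fun n j => t n (φ n j)) :=
  ⟨h.graph.lift, h.singletons.lift, h.source.lift, h.target.lift⟩

/-- A loop through all vertices, with the current vertex given as a singleton. -/
theorem foldl (h : ComputesGraph env G s t) {A : ℕ → Type} {encA : ∀ n, A n → Data}
    {a : ∀ n, ι n → A n} {step : ∀ n, ι n → A n → Fin n → A n}
    (ha : Computes env (fun n i => encA n (a n i)))
    (hbody : Computes (ι := fun n => ι n × A n × Fin n)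
      (fun n j => .pair (env n j.1) (.pair (encA n j.2.1) (encSet {j.2.2})))
      (fun n j => encA n (step n j.1 j.2.1 j.2.2))) :
    Computes env (fun n i => encA n ((List.finRange n).foldl (step n i) (a n i))) :=
  Computes.foldl (encX := fun _ _ v => encSet {v}) (encA := fun n _ => encA n)
    polyBounded_finRange h.singletons ha hbody

theorem neighbors (h : ComputesGraph env G s t) {R : ∀ n, ι n → Finset (Fin n)}
    (hR : Computes env (fun n i => encSet (R n i))) :
    Computes env (fun n i => encSet (neighborsOf (G n i) (R n i))) := by
  classical
  have hz := Computes.zip (X := fun n => Fin n) (l := fun n _ => List.finRange n)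
    (encX := fun n i v => encProp (v ∈ R n i))
    (encY := fun n i v => encSet (Finset.univ.filter fun w => (G n i).Adj v w))
    polyBounded_finRange hR (h.graph.congr fun n i => by simp [encGraph, encSet])
  have hf := Computes.foldl (A := fun n => Finset (Fin n)) (encA := fun _ _ S => encSet S)
    (a := fun _ _ => ∅)
    (step := fun n i S v =>
      if v ∈ R n i then S ∪ Finset.univ.filter (fun w => (G n i).Adj v w) else S)
    polyBounded_finRange hz hR.empty
    (((Computes.ite (P := fun n (j : ι n × Finset (Fin n) × Fin n) => j.2.2 ∈ R n j.1)
      Computes.id.snd.snd.fst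
      (Computes.union (R := fun n j => j.2.1)
        (S := fun n j => Finset.univ.filter (fun w => (G n j.1).Adj j.2.2 w))
        Computes.id.snd.fst Computes.id.snd.snd.snd) Computes.id.snd.fst)).congr fun n j => by
      by_cases hj : j.2.2 ∈ R n j.1 <;> simp [hj, Data.fst, Data.snd])
  refine hf.congr fun n i => ?_
  have key : ∀ (l : List (Fin n)) (S : Finset (Fin n)) (w : Fin n),
      w ∈ l.foldl (fun S v => if v ∈ R n i then S ∪ Finset.univ.filter (fun w => (G n i).Adj v w)
        else S) S ↔ w ∈ S ∨ ∃ v ∈ l, v ∈ R n i ∧ (G n i).Adj v w := by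
    intro l
    induction l with
    | nil => simp
    | cons x l ih =>
      intro S w
      rw [List.foldl_cons, ih]
      by_cases hx : x ∈ R n i <;> simp [hx, or_assoc]
  congr 1
  ext w
  rw [key]
  simp [mem_neighborsOf]

end ComputesGraph

end Computations

/-! ### The algorithm as a program -/

/-- Reachable vertices are found by adding neighbours as often as there are vertices. -/
theorem foldl_neighbors_eq_reachFin {V : Type*} [Fintype V] [DecidableEq V] (G : SimpleGraph V)
    {vs : List V} (hvs : ∀ v, v ∈ vs) (S : Finset V) (a : V) :
    vs.foldl (fun R _ => R ∪ (neighborsOf G R \ S)) {a} =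
      reachFin G S a := by
  set f : Finset V → Finset V :=
    fun R => R ∪ (neighborsOf G R \ S) with hf
  have hfix : ∀ (l : List V) (R : Finset V), f R = R → l.foldl (fun R _ => f R) R = R := by
    intro l R hR
    induction l with
    | nil => rfl
    | cons x l ih => rw [List.foldl_cons, hR, ih]
  have key : ∀ (l : List V) (R : Finset V), f (l.foldl (fun R _ => f R) R) =
      l.foldl (fun R _ => f R) R ∨ R.card + l.length ≤ (l.foldl (fun R _ => f R) R).card := by
    intro l
    induction l with
    | nil => exact fun R => Or.inr le_rfl
    | cons x l ih =>
      intro R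
      rw [List.foldl_cons]
      by_cases hR : f R = R
      · left
        rw [hR, hfix l R hR, hR]
      · refine (ih (f R)).imp _root_.id fun h => ?_
        have : R ⊂ f R := Finset.ssubset_iff_subset_ne.2 ⟨Finset.subset_union_left, Ne.symm hR⟩
        have := Finset.card_lt_card this
        rw [List.length_cons]
        omega
  have hclosed : f (vs.foldl (fun R _ => f R) {a}) = vs.foldl (fun R _ => f R) {a} := by
    refine (key vs {a}).resolve_right fun h => ?_
    have := card_le_length hvs (vs.foldl (fun R _ => f R) {a})
    rw [Finset.card_singleton] at h
    omega
  have hmono : ∀ (l : List V) (R : Finset V), R ⊆ l.foldl (fun R _ => f R) R := by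
    intro l
    induction l with
    | nil => exact fun R => le_rfl
    | cons x l ih => exact fun R => Finset.subset_union_left.trans (ih (f R))
  have hsub : ∀ (l : List V) (R : Finset V), (R : Set V) ⊆ reachSet G.Adj S a →
      ((l.foldl (fun R _ => f R) R : Finset V) : Set V) ⊆ reachSet G.Adj S a := by
    intro l
    induction l with
    | nil => exact fun R hR => hR
    | cons x l ih =>
      refine fun R hR => ih (f R) fun w hw => ?_
      simp only [hf, Finset.coe_union, Set.mem_union, Finset.mem_coe, Finset.mem_sdiff,
        mem_neighborsOf] at hw
      rcases hw with hw | ⟨⟨v, hv, hvw⟩, hw⟩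
      exacts [hR hw, reachSet_closed (hR hv) hvw hw]
  apply Finset.coe_injective
  rw [coe_reachFin]
  refine Set.Subset.antisymm (hsub vs {a} (by simpa using self_mem_reachSet _ _ _)) ?_
  refine reachSet_subset (hmono vs {a} (Finset.mem_singleton_self a)) fun p hp q hpq hq => ?_
  rw [← hclosed]
  refine Finset.mem_coe.2 (Finset.mem_union_right _ (Finset.mem_sdiff.2 ⟨?_, hq⟩))
  exact mem_neighborsOf.2 ⟨p, hp, hpq⟩

/-- The encoding of the list of the members of a trail. -/
noncomputable def encTrail {n : ℕ} (T : Trail (Fin n)) : Data := encSequence T.toList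

theorem length_extendAll_le {V : Type*} [DecidableEq V] (vs : List V)
    (f : Finset V → Finset V) (T : Trail V) :
    (extendAll vs f T).toList.length ≤ T.toList.length + vs.length := by
  induction vs generalizing T with
  | nil => exact le_rfl
  | cons x l ih =>
    have h1 : (extend f T).toList.length ≤ T.toList.length + 1 := by
      unfold extend
      split_ifs
      · omega
      · simp [Trail.toList]
    have h2 := ih (extend f T)
    have h3 : extendAll (x :: l) f T = extendAll l f (extend f T) := rfl
    rw [h3, List.length_cons]
    omega

theorem length_advanceRun_le {n : ℕ} (G : SimpleGraph (Fin n)) (s t r : Fin n)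
    (M : Finset (Fin n)) :
    (advanceRun G s t (List.finRange n) r M).toList.length ≤ n + 1 := by
  have := length_extendAll_le (List.finRange n)
    (fun M => jump G s t (List.finRange n) M (reachFin G M r) M) (M, [])
  simpa [advanceRun, Trail.toList, add_comm] using this

namespace ComputesGraph

variable {ι : ℕ → Type} {env : ∀ n, ι n → Data} {G : ∀ n, ι n → SimpleGraph (Fin n)}
  {s t : ∀ n, ι n → Fin n}

theorem reach (h : ComputesGraph env G s t) {S : ∀ n, ι n → Finset (Fin n)}
    {v : ∀ n, ι n → Fin n} (hS : Computes env (fun n i => encSet (S n i)))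
    (hv : Computes env (fun n i => encSet {v n i})) :
    Computes env (fun n i => encSet (reachFin (G n i) (S n i) (v n i))) := by
  classical
  let φ : ∀ n, ι n × Finset (Fin n) × Fin n → ι n := fun _ j => j.1
  have hg := h.lift (φ := φ) (x := fun n j => .pair (encSet j.2.1) (encSet {j.2.2}))
  have hstep := Computes.union (R := fun n j => j.2.1) Computes.id.snd.fst
    ((hg.neighbors (R := fun n j => j.2.1) Computes.id.snd.fst).sdiff hS.lift)
  have := h.foldl (A := fun n => Finset (Fin n)) (encA := fun _ R => encSet R)
    (a := fun n i => {v n i}) (step := fun n i R _ => R ∪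
      (neighborsOf (G n i) R \ S n i)) hv hstep
  exact this.congr fun n i => by
    rw [foldl_neighbors_eq_reachFin (G n i) List.mem_finRange]

theorem isSeparator (h : ComputesGraph env G s t) {S : ∀ n, ι n → Finset (Fin n)}
    (hS : Computes env (fun n i => encSet (S n i))) :
    Computes env (fun n i => encProp (IsSeparator (G n i) (s n i) (t n i) (S n i))) :=
  ((h.source.mem hS).not.and ((h.target.mem hS).not.and
    (h.target.mem (h.reach hS h.source)).not)).congr fun n i => by
      rw [isSeparator_iff, ← coe_reachFin, Finset.mem_coe]

theorem jump (h : ComputesGraph env G s t) {P Q A : ∀ n, ι n → Finset (Fin n)}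
    (hP : Computes env (fun n i => encSet (P n i))) (hQ : Computes env (fun n i => encSet (Q n i)))
    (hA : Computes env (fun n i => encSet (A n i))) :
    Computes env (fun n i => encSet (SepReconf.jump (G n i) (s n i) (t n i) (List.finRange n)
      (P n i) (Q n i) (A n i))) := by
  classical
  let φ : ∀ n, ι n × Finset (Fin n) × Fin n → ι n := fun _ j => j.1
  let ψ : ∀ n, (ι n × Finset (Fin n) × Fin n) × Finset (Fin n) × Fin n →
    ι n × Finset (Fin n) × Fin n := fun _ j => j.1
  have hg := (h.lift (φ := φ) (x := fun n j => .pair (encSet j.2.1) (encSet {j.2.2}))).lift (φ := ψ)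
    (x := fun n j => .pair (encSet j.2.1) (encSet {j.2.2}))
  have hP' := (hP.lift (φ := φ) (x := fun n j => .pair (encSet j.2.1) (encSet {j.2.2}))).lift
    (φ := ψ) (x := fun n j => .pair (encSet j.2.1) (encSet {j.2.2}))
  have hQ' := (hQ.lift (φ := φ) (x := fun n j => .pair (encSet j.2.1) (encSet {j.2.2}))).lift
    (φ := ψ) (x := fun n j => .pair (encSet j.2.1) (encSet {j.2.2}))
  have hA' := (hA.lift (φ := φ) (x := fun n j => .pair (encSet j.2.1) (encSet {j.2.2}))).lift
    (φ := ψ) (x := fun n j => .pair (encSet j.2.1) (encSet {j.2.2}))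
  have hmove := (hA'.sdiff (S := fun n j => {j.1.2.2}) Computes.id.fst.snd.snd).union
    (S := fun n j => {j.2.2}) Computes.id.snd.snd
  have hinner := Computes.ite (((Computes.mem (v := fun n j => j.1.2.2) Computes.id.fst.snd.snd
    hP').and ((Computes.mem (v := fun n j => j.2.2) Computes.id.snd.snd hQ').and
    (hg.isSeparator hmove)))) hmove Computes.id.snd.fst
  refine h.foldl (A := fun n => Finset (Fin n)) (encA := fun _ R => encSet R) hA ?_
  refine (h.lift (φ := φ)).foldl (A := fun n => Finset (Fin n)) (encA := fun _ R => encSet R)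
    (a := fun n j => j.2.1) Computes.id.snd.fst ?_
  refine hinner.congr fun n j => ?_
  symm
  exact apply_ite encSet _ _ _

theorem extendAll (h : ComputesGraph env G s t)
    {f : ∀ n, ι n → Finset (Fin n) → Finset (Fin n)}
    (hf : Computes (ι := fun n => ι n × Finset (Fin n)) (fun n j => .pair (env n j.1) (encSet j.2))
      (fun n j => encSet (f n j.1 j.2)))
    {T : ∀ n, ι n → Trail (Fin n)} (hT : Computes env (fun n i => encTrail (T n i))) :
    Computes env (fun n i => encTrail (SepReconf.extendAll (List.finRange n) (f n i) (T n i))) := by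
  classical
  refine h.foldl (A := fun n => Trail (Fin n)) (encA := fun _ T => encTrail T) hT ?_
  have hf' : Computes (ι := fun n => ι n × Trail (Fin n) × Fin n)
      (fun n j => .pair (env n j.1) (.pair (encTrail j.2.1) (encSet {j.2.2})))
      (fun n j => encSet (f n j.1 j.2.1.1)) :=
    (Computes.id.fst.pair Computes.id.snd.fst.fst).comp
      (hf.reindex (κ := fun n => ι n × Trail (Fin n) × Fin n) fun n j => (j.1, j.2.1.1))
  have := Computes.ite (hf'.sdiff (S := fun n j => j.2.1.1) Computes.id.snd.fst.fst).isEmpty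
    Computes.id.snd.fst (hf'.pair Computes.id.snd.fst)
  refine this.congr fun n j => ?_
  unfold extend
  by_cases hj : f n j.1 j.2.1.1 \ j.2.1.1 = ∅
  · simp only [if_pos hj]
    rfl
  · simp only [if_neg hj]
    rfl

theorem greedyRun (h : ComputesGraph env G s t) {M : ∀ n, ι n → Finset (Fin n)}
    {T : ∀ n, ι n → Trail (Fin n)} (hM : Computes env (fun n i => encSet (M n i)))
    (hT : Computes env (fun n i => encTrail (T n i))) :
    Computes env (fun n i => encTrail (SepReconf.greedyRun (G n i) (s n i) (t n i)
      (List.finRange n) (M n i) (T n i))) := by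
  let φ : ∀ n, ι n × Finset (Fin n) → ι n := fun _ j => j.1
  have hM' := hM.lift (φ := φ) (x := fun n j => encSet j.2)
  have hA : Computes (fun n j => .pair (env n (φ n j)) (encSet j.2)) (fun n j => encSet j.2) :=
    Computes.id.snd
  exact h.extendAll ((h.lift (φ := φ)).jump (hA.sdiff hM') (hM'.sdiff hA) hA) hT

theorem advanceRun (h : ComputesGraph env G s t) {r : ∀ n, ι n → Fin n}
    {M : ∀ n, ι n → Finset (Fin n)} (hr : Computes env (fun n i => encSet {r n i}))
    (hM : Computes env (fun n i => encSet (M n i))) :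
    Computes env (fun n i => encTrail (SepReconf.advanceRun (G n i) (s n i) (t n i)
      (List.finRange n) (r n i) (M n i))) := by
  let φ : ∀ n, ι n × Finset (Fin n) → ι n := fun _ j => j.1
  have hA : Computes (fun n j => .pair (env n (φ n j)) (encSet j.2)) (fun n j => encSet j.2) :=
    Computes.id.snd
  have hg := h.lift (φ := φ) (x := fun n j => encSet j.2)
  exact h.extendAll (hg.jump hA (hg.reach hA hr.lift) hA) ((hM.pair .nil).congr fun _ _ => rfl)

theorem componentwise (h : ComputesGraph env G s t) :
    Computes env (fun n i => encSet (SepReconf.componentwise (G n i) (s n i) (t n i)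
      (List.finRange n))) := by
  classical
  have huniv : Computes env (fun n _ => encSet (Finset.univ : Finset (Fin n))) :=
    (Computes.map (X := fun n => Fin n) (l := fun n _ => List.finRange n)
      (encX := fun n _ v => encSet {v})
      (encY := fun n _ v => encProp (v ∈ (Finset.univ : Finset (Fin n))))
      polyBounded_finRange h.singletons (Computes.encProp_true.congr fun n j => by simp))
  let φ : ∀ n, ι n × Finset (Fin n) × Fin n → ι n := fun _ j => j.1
  have hg := h.lift (φ := φ) (x := fun n j => .pair (encSet j.2.1) (encSet {j.2.2}))
  have hst := h.source.union h.target
  refine h.foldl (A := fun n => Finset (Fin n)) (encA := fun _ R => encSet R)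
    (huniv.sdiff hst) ?_
  have hset := Computes.union (Computes.sdiff (R := fun n j => j.2.1) Computes.id.snd.fst
    (hg.reach (v := fun n j => j.2.2) hst.lift Computes.id.snd.snd)) (S := fun n j => {j.2.2})
    Computes.id.snd.snd
  refine (Computes.ite (hg.isSeparator hset) hset Computes.id.snd.fst).congr fun n j => ?_
  symm
  exact apply_ite encSet _ _ _

theorem someMinimum (h : ComputesGraph env G s t) :
    Computes env (fun n i => encSet (SepReconf.someMinimum (G n i) (s n i) (t n i)
      (List.finRange n))) := by
  classical
  let φ : ∀ n, ι n × Finset (Fin n) × Fin n → ι n := fun _ j => j.1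
  let ψ : ∀ n, (ι n × Finset (Fin n) × Fin n) × Finset (Fin n) × Fin n →
    ι n × Finset (Fin n) × Fin n := fun _ j => j.1
  have hg := (h.lift (φ := φ) (x := fun n j => .pair (encSet j.2.1) (encSet {j.2.2}))).lift (φ := ψ)
    (x := fun n j => .pair (encSet j.2.1) (encSet {j.2.2}))
  refine h.foldl (A := fun n => Finset (Fin n)) (encA := fun _ R => encSet R) h.componentwise ?_
  refine (h.lift (φ := φ)).foldl (A := fun n => Finset (Fin n)) (encA := fun _ R => encSet R)
    (a := fun n j => j.2.1) Computes.id.snd.fst ?_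
  have hset : Computes (fun n j => .pair (.pair (env n (φ n (ψ n j)))
      (.pair (encSet (ψ n j).2.1) (encSet {(ψ n j).2.2}))) (.pair (encSet j.2.1) (encSet {j.2.2})))
      (fun n j => encSet ({j.1.2.2} ∪ {j.2.2})) :=
    Computes.union Computes.id.fst.snd.snd Computes.id.snd.snd
  refine (Computes.ite (hg.isSeparator hset) hset Computes.id.snd.fst).congr fun n j => ?_
  symm
  exact apply_ite encSet _ _ _

theorem baseSeparator (h : ComputesGraph env G s t) :
    Computes env (fun n i => encSet (SepReconf.baseSeparator (G n i) (s n i) (t n i)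
      (List.finRange n))) :=
  (h.advanceRun h.source h.someMinimum).fst

theorem polyBounded_normalize (A : ∀ n, ι n → Finset (Fin n)) :
    PolyBounded fun n i => (SepReconf.normalize (G n i) (s n i) (t n i)
      (List.finRange n) (A n i)).toList.length := by
  have key : ∀ {n : ℕ} (G : SimpleGraph (Fin n)) (s t : Fin n) (l : List (Finset (Fin n)))
      (T : Trail (Fin n)), (l.foldl (fun T M => SepReconf.greedyRun G s t (List.finRange n) M T)
        T).toList.length ≤ T.toList.length + l.length * n := by
    intro n G s t l
    induction l with
    | nil => intro T; simp
    | cons M l ih =>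
      intro T
      have h1 := ih (SepReconf.greedyRun G s t (List.finRange n) M T)
      have h2 := length_extendAll_le (List.finRange n)
        (fun A => SepReconf.jump G s t (List.finRange n) (A \ M) (M \ A) A) T
      rw [List.length_finRange] at h2
      rw [List.foldl_cons, List.length_cons, add_mul, one_mul]
      exact h1.trans (by
        have : (SepReconf.greedyRun G s t (List.finRange n) M T).toList.length ≤
          T.toList.length + n := h2
        omega)
  refine ⟨1 + (Polynomial.X + 1) * Polynomial.X, fun n i => (key _ _ _ _ _).trans ?_⟩
  have := length_advanceRun_le (G n i) (s n i) (t n i) (t n i)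
    (SepReconf.baseSeparator (G n i) (s n i) (t n i) (List.finRange n))
  have h3 := Nat.mul_le_mul_right n this
  simpa [Trail.toList] using h3

theorem normalize (h : ComputesGraph env G s t) {A : ∀ n, ι n → Finset (Fin n)}
    (hA : Computes env (fun n i => encSet (A n i))) :
    Computes env (fun n i => encTrail (SepReconf.normalize (G n i) (s n i) (t n i)
      (List.finRange n) (A n i))) := by
  refine Computes.foldl (X := fun n => Finset (Fin n)) (A := fun n => Trail (Fin n))
    (encX := fun _ _ S => encSet S) (encA := fun _ _ T => encTrail T)
    ⟨Polynomial.X + 1, fun n i => ?_⟩ (h.advanceRun h.target h.baseSeparator)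
    ((hA.pair .nil).congr fun _ _ => rfl) ?_
  · simpa using length_advanceRun_le (G n i) (s n i) (t n i) (t n i)
      (SepReconf.baseSeparator (G n i) (s n i) (t n i) (List.finRange n))
  · let φ : ∀ n, ι n × Trail (Fin n) × Finset (Fin n) → ι n := fun _ j => j.1
    exact (h.lift (φ := φ)).greedyRun Computes.id.snd.snd Computes.id.snd.fst

theorem reconfigure (h : ComputesGraph env G s t) {A B : ∀ n, ι n → Finset (Fin n)}
    (hA : Computes env (fun n i => encSet (A n i)))
    (hB : Computes env (fun n i => encSet (B n i))) :
    Computes env (fun n i => encSequence (SepReconf.reconfigure (G n i) (s n i) (t n i)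
      (List.finRange n) (A n i) (B n i))) := by
  have hTB := h.normalize hB
  obtain ⟨q, hq⟩ := polyBounded_normalize (G := G) (s := s) (t := t) A
  -- reversing one list onto another one is a loop
  have := Computes.foldl (X := fun n => Finset (Fin n)) (A := fun n => List (Finset (Fin n)))
    (encX := fun _ _ S => encSet S) (encA := fun _ _ L => encSequence L)
    (step := fun _ _ L S => S :: L) ⟨q + Polynomial.X, fun n i => ?_⟩
    (h.greedyRun hTB.fst (h.normalize hA)) hTB.snd (Computes.id.snd.snd.pair Computes.id.snd.fst)
  · refine this.congr fun n i => ?_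
    have key : ∀ (L l : List (Finset (Fin n))),
        L.foldl (fun L S => S :: L) l = L.reverse ++ l := fun L l => by simp
    rw [key]
    rfl
  · have h1 := length_extendAll_le (List.finRange n)
      (fun C => SepReconf.jump (G n i) (s n i) (t n i) (List.finRange n)
        (C \ (SepReconf.normalize (G n i) (s n i) (t n i) (List.finRange n) (B n i)).1)
        ((SepReconf.normalize (G n i) (s n i) (t n i) (List.finRange n) (B n i)).1 \ C) C)
      (SepReconf.normalize (G n i) (s n i) (t n i) (List.finRange n) (A n i))
    have h2 := hq n i
    rw [List.length_finRange] at h1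
    rw [Polynomial.eval_add, Polynomial.eval_X]
    exact h1.trans (Nat.add_le_add_right h2 n)

end ComputesGraph

/-- The whole algorithm is a program with polynomial running time. -/
theorem exists_program : ∃ (c : Program) (p : Polynomial ℕ), ∀ (n : ℕ) (G : SimpleGraph (Fin n))
    (s t : Fin n) (A B : Finset (Fin n)), OutputsWithin c (encInput G s t A B)
      (encSequence (reconfigure G s t (List.finRange n) A B)) (p.eval n) := by
  let ι : ℕ → Type := fun n =>
    SimpleGraph (Fin n) × Fin n × Fin n × Finset (Fin n) × Finset (Fin n)
  let env : ∀ n, ι n → Data := fun n i => encInput i.1 i.2.1 i.2.2.1 i.2.2.2.1 i.2.2.2.2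
  have hG : Computes env (fun n i => encGraph i.1) := Computes.id.fst
  have hs : Computes env (fun n i => encNat i.2.1) := Computes.id.snd.fst
  have ht : Computes env (fun n i => encNat i.2.2.1) := Computes.id.snd.snd.fst
  have hA : Computes env (fun n i => encSet i.2.2.2.1) := Computes.id.snd.snd.snd.fst
  have hB : Computes env (fun n i => encSet i.2.2.2.2) := Computes.id.snd.snd.snd.snd.fst
  have hsing := Computes.singletons (fun n i => by simp) hG
  have h : ComputesGraph env (fun n i => i.1) (fun n i => i.2.1) (fun n i => i.2.2.1) :=
    ⟨hG, hsing, Computes.singleton_of_encNat hsing hs, Computes.singleton_of_encNat hsing ht⟩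
  obtain ⟨c, p, hc⟩ := h.reconfigure hA hB
  refine ⟨c 0, p, fun n G s t A B => ?_⟩
  obtain ⟨m, τ, hm, hr, hτ, -⟩ := hc n (G, s, t, A, B) 0
    (Function.update (fun _ => Data.nil) 0 (encInput G s t A B)) (by simp [env])
  exact ⟨m, τ, hm, hr, hτ⟩

end SepReconf

theorem mainTheorem7 :
    -- any two separators of the same size are reconfigurable into each other, and the sequence
    -- can be taken through a separator containing any prescribed minimum separator
    (∀ (V : Type*) [Fintype V] [DecidableEq V] (G : SimpleGraph V),
      SepReconf.IsTwoConnectedSeriesParallel G →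
      ∀ s t : V, s ≠ t → ¬ G.Adj s t →
      ∀ A B : Finset V, SepReconf.IsSeparator G s t A → SepReconf.IsSeparator G s t B →
        A.card = B.card →
        (∃ L : List (Finset V), SepReconf.IsTJSequence G s t A B L) ∧
        ∀ M : Finset V, SepReconf.IsMinimumSeparator G s t M →
          ∃ L : List (Finset V), SepReconf.IsTJSequence G s t A B L ∧ ∃ S ∈ L, M ⊆ S) ∧
    -- a single program constructs such sequences in time polynomial in the number of vertices,
    -- the minimum separator used depending only on the graph and the two separated vertices
    (∃ (c : SepReconf.Program) (p : Polynomial ℕ), ∀ (n : ℕ) (G : SimpleGraph (Fin n)),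
      SepReconf.IsTwoConnectedSeriesParallel G →
      ∀ s t : Fin n, s ≠ t → ¬ G.Adj s t →
      ∃ M : Finset (Fin n), SepReconf.IsMinimumSeparator G s t M ∧
        ∀ A B : Finset (Fin n), SepReconf.IsSeparator G s t A → SepReconf.IsSeparator G s t B →
          A.card = B.card →
          ∃ L : List (Finset (Fin n)), SepReconf.IsTJSequence G s t A B L ∧ (∃ S ∈ L, M ⊆ S) ∧
            SepReconf.OutputsWithin c (SepReconf.encInput G s t A B) (SepReconf.encSequence L)
              (p.eval n)) := by
  refine ⟨fun V _ _ G hG s t hst hnst A B hA hB hAB => ⟨?_, fun M hM => ?_⟩, ?_⟩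
  · exact ⟨_, (SepReconf.reconfigure_spec (vs := Finset.univ.toList) (fun v => by simp)
      hG hst hnst hA hB hAB).1⟩
  · exact SepReconf.exists_isTJSequence_through hG hst hnst hA hB hAB hM
  · obtain ⟨c, p, hc⟩ := SepReconf.exists_program
    refine ⟨c, p, fun n G hG s t hst hnst => ⟨_, (SepReconf.baseSeparator_spec
      List.mem_finRange hG hst hnst).1, fun A B hA hB hAB => ⟨_, ?_, ?_, hc n G s t A B⟩⟩⟩
    · exact (SepReconf.reconfigure_spec List.mem_finRange hG hst hnst hA hB hAB).1
    · exact (SepReconf.reconfigure_spec List.mem_finRange hG hst hnst hA hB hAB).2
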